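/- Let $I=(0,1)$, let $q\ge 0$ and $p\ge 1$ be integers, let $\kappa\in\mathbb R$, and let $V:[0,1]\to\mathbb R$ and $Q:[0,1]\to\mathbb R^q$ be smooth (up to the endpoints). Let $A_V=-\partial_{xx}^2+V$ with domain $H^2\cap H^1_0(I;\mathbb C)$, let $A=A_0$, with eigenfunctions $\phi_k(x)=\sqrt2\sin(k\pi x)$ and eigenvalues $\lambda_k=k^2\pi^2$, $k\ge1$, and let $H^3_{(0)}=D(A^{3/2})$ with the norm $\|f\|_{(3)}=\|A^{3/2}f\|_{L^2}=\big(\sum_{k\ge1}\lambda_k^3|\langle f,\phi_k\rangle|^2\big)^{1/2}$. Write $J_T=[0,T]$, and let $C(J_T;H^3_{(0)})$ carry the maximum norm. For $\xi_0\in H^3_{(0)}$, a function $\xi\in C(J_T;H^3_{(0)})$ is called a solution of $i\partial_t\xi=-\partial_{xx}^2\xi+V\xi+F$, $\xi|_{x=0,1}=0$, $\xi(0)=\xi_0$, if $$\xi(t)=e^{-iA_Vt}\xi_0-i\int_0^te^{-iA_V(t-s)}F(s)\,ds,\qquad t\in J_T,$$ where $F$ may depend on $\xi$ and is integrable from $J_T$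 to $L^2(I;\mathbb C)$. Consider the problem $$i\partial_t\psi=-\partial_{xx}^2\psi+V(x)\psi+\kappa|\psi|^{2p}\psi+\langle u(t),Q(x)\rangle\psi,\qquad \psi(t,0)=\psi(t,1)=0. \tag{1}$$ **Proposition 2.1.** For every $T>0$ and every $\Lambda$ there is $\delta=\delta(T,\Lambda)>0$ (which may also depend on the fixed data $V,Q,\kappa,p$) such that the following holds. Let $\hat\psi_0\in H^3_{(0)}$ and $\hat u\in L^2(J_T;\mathbb R^q)$, let $\hat\psi\in C(J_T;H^3_{(0)})$ be a solution of (1) with control $\hat u$ and $\hat\psi(0)=\hat\psi_0$, and suppose that $\|\hat\psi\|_{C(J_T;H^3_{(0)})}+\|\hat u\|_{L^2(J_T;\mathbb R^q)}=\Lambda$. Then: (i) For all $\psi_0\in H^3_{(0)}$ and $u\in L^2(J_T;\mathbb R^q)$ with $$\|\psi_0-\hat\psi_0\|_{(3)}+\|u-\hat u\|_{L^2(J_T;\mathbb R^q)}<\delta, \tag{2}$$ problem (1) has a unique solution $\psi\in C(J_T;H^3_{(0)})$ with $\psi(0)=\psi_0$. (ii) Let $\Psi_T$ be the mapping that takes a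 couple $(\psi_0,u)$ satisfying (2) to $\psi(T)\in H^3_{(0)}$. Then $\Psi_T$ is $C^1$ (over the reals), and for every $v\in L^2(J_T;\mathbb R^q)$ we have $\partial_u\Psi_T(\hat\psi_0,\hat u)v=\xi(T)$, where $\xi\in C(J_T;H^3_{(0)})$ is the unique solution of the linearised system $$i\partial_t\xi=-\partial_{xx}^2\xi+V(x)\xi+(p+1)\kappa|\hat\psi|^{2p}\xi+p\kappa\,\hat\psi^2|\hat\psi|^{2(p-1)}\overline{\xi}+\langle\hat u(t),Q(x)\rangle\xi+\langle v(t),Q(x)\rangle\hat\psi,$$ $$\xi(t,0)=\xi(t,1)=0,\qquad \xi(0,x)=0.$$ -/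

import Mathlib

open MeasureTheory Set Filter
open scoped ContDiff ENNReal Topology

noncomputable section

/-- Lebesgue measure on the interval `I = (0,1)`. -/
abbrev volI : Measure ℝ := volume.restrict (Ioo (0 : ℝ) 1)

/-- `L²(I; ℂ)`. -/
abbrev L2I : Type := Lp ℂ 2 volI

/-- The controls `L²([0,T]; ℝ^q)`. -/
abbrev L2Control (T : ℝ) (q : ℕ) : Type :=
  Lp (EuclideanSpace ℝ (Fin q)) 2 (volume.restrict (Icc (0 : ℝ) T))

/-! ### The spectral data of the Dirichlet Laplacian and the space `D(A^{3/2})` -/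

/-- The eigenfunction `φ_k(x) = √2 sin(kπx)`, `k ≥ 1`, of the Dirichlet Laplacian `A` on `(0,1)`. -/
def dirichletEigenfun (k : ℕ) (x : ℝ) : ℂ := ((√2 * Real.sin (k * Real.pi * x) : ℝ) : ℂ)

/-- `(k π)³ = λ_k^{3/2}`, where `λ_k = k² π²` is the eigenvalue of `A` belonging to `φ_k`. -/
def dirichletWeight (k : ℕ) : ℝ := ((k : ℝ) * Real.pi) ^ 3

theorem memLp_dirichletEigenfun (k : ℕ) : MemLp (dirichletEigenfun k) 2 volI := by
  refine MemLp.of_bound (C := √2) ?_ (ae_of_all _ fun x => ?_)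
  · exact (by unfold dirichletEigenfun; fun_prop :
      Continuous (dirichletEigenfun k)).aestronglyMeasurable
  · rw [dirichletEigenfun, Complex.norm_real, norm_mul, Real.norm_of_nonneg (Real.sqrt_nonneg 2)]
    exact mul_le_of_le_one_right (Real.sqrt_nonneg 2) (Real.abs_sin_le_one _)

/-- `φ_k` as an element of `L²(I; ℂ)`. -/
def dirichletMode (k : ℕ) : L2I := (memLp_dirichletEigenfun k).toLp

/-- The coefficient `∫₀¹ f φ_k` of `f` along `φ_k`. -/
def sineCoeff (k : ℕ) (f : L2I) : ℂ := inner ℂ (dirichletMode k) f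

theorem sineCoeff_eq_integral (k : ℕ) (f : L2I) :
    sineCoeff k f = ∫ x in Ioo (0 : ℝ) 1, f x * dirichletEigenfun k x := by
  rw [sineCoeff, L2.inner_def]
  refine integral_congr_ae ?_
  filter_upwards [(memLp_dirichletEigenfun k).coeFn_toLp] with x hx
  rw [dirichletMode, hx]
  simp [dirichletEigenfun, -Complex.ofReal_mul]

/-- The sine system is complete in `L²(I; ℂ)`. -/
theorem eq_zero_of_sineCoeff_eq_zero (f : L2I) (h : ∀ k : ℕ, sineCoeff (k + 1) f = 0) :
    f = 0 := by
  set F : ℝ → ℂ := (Ioo (0 : ℝ) 1).indicator f with hF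
  have hFm : MemLp F 2 volume := by
    rw [hF, memLp_indicator_iff_restrict measurableSet_Ioo]
    exact Lp.memLp f
  have hGm : MemLp (fun x => F (-x)) 2 volume :=
    hFm.comp_measurePreserving (Measure.measurePreserving_neg volume)
  have hsub : MemLp (fun x => F x - F (-x)) 2 volume := hFm.sub hGm
  have hint : ∀ n : ℤ, ∫ x in (0 : ℝ)..1, (Real.sin (n * Real.pi * x) : ℂ) * F x = 0 := by
    have hpos : ∀ n : ℕ, ∫ x in (0 : ℝ)..1, (Real.sin (n * Real.pi * x) : ℂ) * F x = 0 := by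
      intro n
      rcases n with _ | n
      · simp
      have h1 := h n
      rw [sineCoeff_eq_integral] at h1
      rw [intervalIntegral.integral_of_le zero_le_one, integral_Ioc_eq_integral_Ioo]
      have h2 : ∫ x in Ioo (0 : ℝ) 1, f x * dirichletEigenfun (n + 1) x
          = (√2 : ℂ) * ∫ x in Ioo (0 : ℝ) 1,
            (Real.sin ((n + 1 : ℕ) * Real.pi * x) : ℂ) * F x := by
        rw [← integral_const_mul]
        refine setIntegral_congr_fun measurableSet_Ioo fun x hx => ?_
        simp only [dirichletEigenfun, hF, indicator_of_mem hx]
        push_cast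
        ring
      rw [h2] at h1
      exact (mul_eq_zero.1 h1).resolve_left (by simp)
    intro n
    rcases Int.eq_nat_or_neg n with ⟨m, rfl | rfl⟩
    · exact_mod_cast hpos m
    · have := hpos m
      rw [← neg_eq_zero, ← intervalIntegral.integral_neg, ← this]
      refine intervalIntegral.integral_congr fun x _ => ?_
      simp [neg_mul, Real.sin_neg]
  have hii : ∀ (g : ℝ → ℂ), MemLp g 2 volume → ∀ n : ℤ, IntervalIntegrable
      (fun x : ℝ => fourier (T := 1 - (-1)) n (x : AddCircle (1 - (-1) : ℝ)) • g x)
      volume (-1) 1 := by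
    intro g hg n
    have h1 : IntervalIntegrable g volume (-1) 1 := by
      rw [intervalIntegrable_iff]
      have : IsFiniteMeasure (volume.restrict (uIoc (-1 : ℝ) 1)) :=
        ⟨by simp [uIoc]⟩
      exact (hg.restrict _).integrable (by norm_num)
    refine h1.continuousOn_mul (Continuous.continuousOn ?_)
    exact (map_continuous (fourier n)).comp (AddCircle.continuous_mk' _)
  have hcoef : ∀ n : ℤ,
      fourierCoeffOn (by norm_num : (-1 : ℝ) < 1) (fun x => F x - F (-x)) n = 0 := by
    intro n
    rw [fourierCoeffOn_eq_integral]
    simp only [smul_sub]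
    rw [intervalIntegral.integral_sub (hii F hFm _) (hii _ hGm _)]
    have e1 : ∫ x in (-1 : ℝ)..1,
        fourier (-n) (x : AddCircle (1 - (-1) : ℝ)) • F (-x)
        = ∫ x in (-1 : ℝ)..1, fourier n (x : AddCircle (1 - (-1) : ℝ)) • F x := by
      have := intervalIntegral.integral_comp_neg (a := (-1 : ℝ)) (b := 1)
        (fun x : ℝ => fourier n (x : AddCircle (1 - (-1) : ℝ)) • F x)
      rw [neg_neg] at this
      rw [← this]
      refine intervalIntegral.integral_congr fun x _ => ?_
      simp only [AddCircle.coe_neg]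
      congr 1
      simp [fourier_apply]
    rw [e1, ← intervalIntegral.integral_sub (hii F hFm _) (hii F hFm _)]
    have e2 : ∀ x : ℝ, fourier (-n) (x : AddCircle (1 - (-1) : ℝ)) • F x
        - fourier n (x : AddCircle (1 - (-1) : ℝ)) • F x
        = (-2 * Complex.I) * ((Real.sin (n * Real.pi * x) : ℂ) * F x) := by
      intro x
      rw [fourier_coe_apply, fourier_coe_apply, ← sub_smul, smul_eq_mul]
      have a1 : (2 * Real.pi * Complex.I * ((-n : ℤ) : ℂ) * x / ((1 - (-1) : ℝ) : ℂ))
          = -((n * Real.pi * x : ℝ) : ℂ) * Complex.I := by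
        push_cast; ring
      have a2 : (2 * Real.pi * Complex.I * (n : ℂ) * x / ((1 - (-1) : ℝ) : ℂ))
          = ((n * Real.pi * x : ℝ) : ℂ) * Complex.I := by
        push_cast; ring
      rw [a1, a2, Complex.exp_mul_I, Complex.exp_mul_I, Complex.cos_neg, Complex.sin_neg,
        Complex.ofReal_sin]
      ring
    simp only [e2]
    rw [intervalIntegral.integral_const_mul]
    have hz : ∫ x in (-1 : ℝ)..0, (Real.sin (n * Real.pi * x) : ℂ) * F x = 0 := by
      rw [intervalIntegral.integral_of_le (by norm_num)]
      refine setIntegral_eq_zero_of_forall_eq_zero fun x hx => ?_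
      rw [hF, indicator_of_notMem (fun hx' => not_lt.2 hx.2 hx'.1), mul_zero]
    have hii2 : ∀ a b : ℝ, IntervalIntegrable
        (fun x => (Real.sin (n * Real.pi * x) : ℂ) * F x) volume a b := by
      intro a b
      have h1 : IntervalIntegrable F volume a b := by
        rw [intervalIntegrable_iff]
        have : IsFiniteMeasure (volume.restrict (uIoc a b)) := ⟨by simp [uIoc]⟩
        exact (hFm.restrict _).integrable (by norm_num)
      exact h1.continuousOn_mul (by fun_prop)
    rw [← intervalIntegral.integral_add_adjacent_intervals (hii2 (-1) 0) (hii2 0 1), hz, hint n]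
    simp
  have hpars := hasSum_sq_fourierCoeffOn (by norm_num : (-1 : ℝ) < 1) (hsub.restrict (Ioc (-1) 1))
  simp only [hcoef, norm_zero, ne_eq, OfNat.ofNat_ne_zero, not_false_eq_true, zero_pow] at hpars
  have hzero := hpars.unique hasSum_zero
  have hi : ∫ x in Ioc (-1 : ℝ) 1, ‖F x - F (-x)‖ ^ 2 = 0 := by
    rw [intervalIntegral.integral_of_le (by norm_num)] at hzero
    simpa using hzero
  rw [integral_eq_zero_iff_of_nonneg (fun x => by positivity)
    ((memLp_two_iff_integrable_sq_norm hsub.1.restrict).1 (hsub.restrict _))] at hi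
  have hsm : Ioo (0 : ℝ) 1 ⊆ Ioc (-1) 1 := fun x hx => ⟨by linarith [hx.1], hx.2.le⟩
  have hi2 := ae_restrict_of_ae_restrict_of_subset hsm hi
  rw [Lp.eq_zero_iff_ae_eq_zero]
  filter_upwards [hi2, ae_restrict_mem measurableSet_Ioo] with x hx hxm
  have h0 : F (-x) = 0 := by
    rw [hF, indicator_of_notMem]
    intro h'
    linarith [h'.1, hxm.1]
  have h1 : F x = f x := by rw [hF, indicator_of_mem hxm]
  simp only [Pi.zero_apply, h0, sub_zero, h1] at hx
  simpa using hx

/-- The sequence `(λ_k^{3/2} ∫₀¹ f φ_k)_{k ≥ 1}` of sine coefficients of `A^{3/2} f`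
(the entry `j` of the sequence belongs to `k = j + 1`). -/
def weightedCoeff : L2I →ₗ[ℂ] (ℕ → ℂ) where
  toFun f j := (dirichletWeight (j + 1) : ℂ) * sineCoeff (j + 1) f
  map_add' f g := by
    funext j
    simp [sineCoeff, inner_add_right, mul_add]
  map_smul' c f := by
    funext j
    simp [sineCoeff, inner_smul_right]
    ring

/-- `H³_{(0)} = D(A^{3/2})` as a set of functions: those `f ∈ L²` for which
`∑_k λ_k³ |∫₀¹ f φ_k|² < ∞`. -/
def h3Submodule : Submodule ℂ L2I where
  carrier := {f | Memℓp (weightedCoeff f) 2}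
  add_mem' {f g} hf hg := by
    simp only [mem_ofPred_eq, map_add] at *
    exact hf.add hg
  zero_mem' := by
    simp only [mem_ofPred_eq, map_zero]
    exact zero_memℓp
  smul_mem' c f hf := by
    simp only [mem_ofPred_eq, map_smul] at *
    exact hf.const_smul c

/-- The Hilbert space `H³_{(0)} = D(A^{3/2})`, with its own norm (below). -/
def H30 : Type := h3Submodule

namespace H30

instance : AddCommGroup H30 := inferInstanceAs (AddCommGroup h3Submodule)

instance : Module ℂ H30 := inferInstanceAs (Module ℂ h3Submodule)

/-- The inclusion `H³_{(0)} ⊆ L²`. -/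
def toL2 : H30 →ₗ[ℂ] L2I := h3Submodule.subtype

/-- The sine coefficients of `A^{3/2} f`, as an element of `ℓ²`. -/
def coeffs : H30 →ₗ[ℂ] lp (fun _ : ℕ => ℂ) 2 where
  toFun f := ⟨weightedCoeff (toL2 f), f.2⟩
  map_add' f g := Subtype.ext (weightedCoeff.map_add (toL2 f) (toL2 g))
  map_smul' c f := Subtype.ext (weightedCoeff.map_smul c (toL2 f))

theorem coeffs_injective : Function.Injective coeffs := by
  rw [injective_iff_map_eq_zero]
  intro f hf
  refine Subtype.ext (eq_zero_of_sineCoeff_eq_zero _ fun k => ?_)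
  have h1 : (coeffs f : ℕ → ℂ) k = 0 := by rw [hf]; rfl
  change (dirichletWeight (k + 1) : ℂ) * sineCoeff (k + 1) (toL2 f) = 0 at h1
  refine (mul_eq_zero.1 h1).resolve_left ?_
  refine Complex.ofReal_ne_zero.2 ?_
  rw [dirichletWeight]
  positivity

/-- The norm `‖f‖_{(3)} = ‖A^{3/2} f‖_{L²} = (∑_k λ_k³ |∫₀¹ f φ_k|²)^{1/2}`. -/
instance : NormedAddCommGroup H30 :=
  NormedAddCommGroup.induced H30 (lp (fun _ : ℕ => ℂ) 2) coeffs coeffs_injective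

instance : NormedSpace ℂ H30 :=
  NormedSpace.induced ℂ H30 (lp (fun _ : ℕ => ℂ) 2) coeffs

theorem norm_sq_eq (f : H30) :
    ‖f‖ ^ 2 = ∑' j : ℕ, (((j + 1 : ℕ) : ℝ) ^ 2 * Real.pi ^ 2) ^ 3 *
      ‖sineCoeff (j + 1) (toL2 f)‖ ^ 2 := by
  have h := lp.norm_rpow_eq_tsum (p := 2) (by norm_num) (coeffs f)
  have h2 : ‖f‖ = ‖coeffs f‖ := rfl
  rw [h2]
  simp only [ENNReal.toReal_ofNat, Real.rpow_ofNat] at h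
  rw [h]
  refine tsum_congr fun j => ?_
  change ‖(dirichletWeight (j + 1) : ℂ) * sineCoeff (j + 1) (toL2 f)‖ ^ 2 = _
  rw [norm_mul, Complex.norm_real, mul_pow, Real.norm_eq_abs, sq_abs, dirichletWeight]
  ring

end H30

/-! ### The Schrödinger operator `A_V = -∂ₓₓ + V` on `H² ∩ H¹₀` and its group -/

/-- `g` is the weak derivative of `f` on `(0,1)`. -/
def HasWeakDeriv (f g : L2I) : Prop :=
  ∀ θ : ℝ → ℝ, ContDiff ℝ ∞ θ → HasCompactSupport θ → tsupport θ ⊆ Ioo 0 1 →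
    ∫ x in Ioo (0 : ℝ) 1, deriv θ x • f x = -∫ x in Ioo (0 : ℝ) 1, θ x • g x

/-- `f` has a continuous representative on `[0,1]` that vanishes at `0` and `1`. For `f ∈ H¹(I)`
this says that `f ∈ H¹₀(I)`. -/
def VanishesAtEndpoints (f : L2I) : Prop :=
  ∃ F : ℝ → ℂ, ContinuousOn F (Icc 0 1) ∧ F 0 = 0 ∧ F 1 = 0 ∧ f =ᵐ[volI] F

/-- The graph of the Schrödinger operator `A_V`: `f ∈ D(A_V) = H² ∩ H¹₀(I; ℂ)` and
`g = -f'' + V f`. -/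
def IsSchrodingerOp (V : ℝ → ℝ) (f g : L2I) : Prop :=
  VanishesAtEndpoints f ∧ ∃ f₁ f₂ : L2I, HasWeakDeriv f f₁ ∧ HasWeakDeriv f₁ f₂ ∧
    g =ᵐ[volI] fun x => -f₂ x + (V x : ℂ) * f x

/-- `U t = e^{-i t A_V}`: `U` is the strongly continuous group on `L²(I; ℂ)` whose infinitesimal
generator is `-i A_V` (as `-i A_V f = g` if and only if `A_V f = i g`). A strongly continuous
group is determined by its generator, and by Stone's theorem this one exists, `A_V` being
self-adjoint for bounded real `V`. -/
structure IsSchrodingerGroup (V : ℝ → ℝ) (U : ℝ → L2I →L[ℂ] L2I) : Prop where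
  zero : U 0 = ContinuousLinearMap.id ℂ L2I
  add : ∀ s t, U (s + t) = (U s).comp (U t)
  continuous : ∀ f, Continuous fun t => U t f
  generator : ∀ f g, HasDerivAt (fun t => U t f) g 0 ↔ IsSchrodingerOp V f (Complex.I • g)

/-! ### Solutions -/

/-- `ξ ∈ C([0,T]; H³_{(0)})` is the solution of `i ∂ₜ ξ = -∂ₓₓ ξ + V ξ + F`,
`ξ(t,0) = ξ(t,1) = 0`, `ξ(0) = ξ₀`, in the sense that
`ξ(t) = e^{-i A_V t} ξ₀ - i ∫₀ᵗ e^{-i A_V (t-s)} F(s) ds` for all `t ∈ [0,T]`. -/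
def IsDuhamelSolution (V : ℝ → ℝ) {T : ℝ} (ξ₀ : H30) (F : ℝ → L2I)
    (ξ : C(Icc (0 : ℝ) T, H30)) : Prop :=
  IntervalIntegrable F volume 0 T ∧ ∃ U, IsSchrodingerGroup V U ∧ ∀ t : Icc (0 : ℝ) T,
    (ξ t).toL2 = U t ξ₀.toL2 - Complex.I • ∫ s in (0 : ℝ)..t, U (t - s) (F s)

/-- `ψ` is the solution of
`i ∂ₜ ψ = -∂ₓₓ ψ + V ψ + κ |ψ|^{2p} ψ + ⟨u(t), Q(x)⟩ ψ`, `ψ(t,0) = ψ(t,1) = 0`,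
`ψ(0) = ψ₀`. -/
def IsNLSSolution {q : ℕ} (V : ℝ → ℝ) (Q : ℝ → EuclideanSpace ℝ (Fin q)) (κ : ℝ) (p : ℕ)
    {T : ℝ} (ψ₀ : H30) (u : L2Control T q) (ψ : C(Icc (0 : ℝ) T, H30)) : Prop :=
  ∃ F : ℝ → L2I,
    (∀ᵐ s, ∀ hs : s ∈ Icc (0 : ℝ) T, F s =ᵐ[volI] fun x =>
      (κ : ℂ) * (‖(ψ ⟨s, hs⟩).toL2 x‖ : ℂ) ^ (2 * p) * (ψ ⟨s, hs⟩).toL2 x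
        + (inner ℝ (u s) (Q x) : ℂ) * (ψ ⟨s, hs⟩).toL2 x) ∧
    IsDuhamelSolution V ψ₀ F ψ

/-- `ξ` is the solution of the system linearised around `(ψ, u)`, in the direction `v`,
`i ∂ₜ ξ = -∂ₓₓ ξ + V ξ + (p+1) κ |ψ|^{2p} ξ + p κ ψ² |ψ|^{2(p-1)} ξ̄ + ⟨u(t), Q(x)⟩ ξ
+ ⟨v(t), Q(x)⟩ ψ`, `ξ(t,0) = ξ(t,1) = 0`, `ξ(0) = 0` (for `p ≥ 1`). -/
def IsLinearisedSolution {q : ℕ} (V : ℝ → ℝ) (Q : ℝ → EuclideanSpace ℝ (Fin q)) (κ : ℝ) (p : ℕ)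
    {T : ℝ} (u : L2Control T q) (ψ : C(Icc (0 : ℝ) T, H30)) (v : L2Control T q)
    (ξ : C(Icc (0 : ℝ) T, H30)) : Prop :=
  ∃ F : ℝ → L2I,
    (∀ᵐ s, ∀ hs : s ∈ Icc (0 : ℝ) T, F s =ᵐ[volI] fun x =>
      ((p : ℂ) + 1) * κ * (‖(ψ ⟨s, hs⟩).toL2 x‖ : ℂ) ^ (2 * p) * (ξ ⟨s, hs⟩).toL2 x
        + (p : ℂ) * κ * (ψ ⟨s, hs⟩).toL2 x ^ 2 * (‖(ψ ⟨s, hs⟩).toL2 x‖ : ℂ) ^ (2 * (p - 1))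
          * (starRingEnd ℂ) ((ξ ⟨s, hs⟩).toL2 x)
        + (inner ℝ (u s) (Q x) : ℂ) * (ξ ⟨s, hs⟩).toL2 x
        + (inner ℝ (v s) (Q x) : ℂ) * (ψ ⟨s, hs⟩).toL2 x) ∧
    IsDuhamelSolution V 0 F ξ

end

noncomputable section

/-! ### Integrals over triangles and Volterra inequalities -/

/-! Multiplication by `V` or by a component of `Q` keeps the condition f = 0 at the endpoints but
destroys f'' = 0, which D(A^{3/2}) contains as well. The sources therefore lie in H³ ∩ H¹₀ and not
in `H30`, and the Duhamel integral cannot be estimated in `H30` time by time. What saves the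
estimate is integration in time. For F(s) in H³ that vanishes at the endpoints, three integrations
by parts turn the sine coefficients of A^{3/2}F(s) into the boundary values of F'' and the cosine
coefficients of F''' (`tau_eq`). Against e^{iλ_k s} the boundary values become Fourier coefficients
in time of scalar L² functions. As λ_k = k²π², these exponentials are orthogonal over the period
2/π, and Bessel's inequality makes the coefficients square summable (`smoothing_estimate`).

The potential is moved to the source, so that only the explicit free flow of A acts on `H30`. The
mild equations for A_V and for A are compared one sine coefficient at a time
(`phase_mul_sineCoeff_duhamel`, `isDuhamelSolution_iff`). Problem (1) becomes a fixed-point equation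
ψ = F(z, ψ) in C([0,T]; `H30`) with parameter z = (ψ₀, u) (`isNLSSolution_iff`). As H³(0,1) is an
algebra, F is C¹, and the smoothing estimate bounds ‖F(z,ψ)(t) - F(z,φ)(t)‖² by ∫₀ᵗ m ‖ψ - φ‖² with
an integrable kernel m (`isVolterraMap_duhamelMap`).

The rest is abstract (`IsVolterraMap`). Grönwall's inequality gives uniqueness and a Lipschitz
dependence on z whose constant depends only on the bounds. Iterating the Volterra inequality makes 1
- ∂_ψF invertible (`isUnit_one_sub_fderiv`). The implicit function theorem then gives local C¹
solution maps (`exists_solutionMap`), and differentiating the fixed-point equation gives the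
linearised one (`fderiv_solutionMap`). Continuation along the segment from a solvable parameter to a
nearby one produces a radius δ that depends only on the bound (`exists_radius`). -/

theorem integral_triangle_swap {E : Type*} [NormedAddCommGroup E] [NormedSpace ℝ E]
    {K : ℝ → ℝ → E} {t : ℝ} (ht : 0 ≤ t)
    (hK : Integrable (Function.uncurry K)
      ((volume.restrict (Ioc 0 t)).prod (volume.restrict (Ioc 0 t)))) :
    ∫ s in (0 : ℝ)..t, ∫ r in (0 : ℝ)..s, K s r = ∫ r in (0 : ℝ)..t, ∫ s in r..t, K s r := by
  have hm : MeasurableSet {p : ℝ × ℝ | p.2 ≤ p.1} := measurableSet_le measurable_snd measurable_fst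
  have h1 := integral_integral_swap (f := fun s r => {p : ℝ × ℝ | p.2 ≤ p.1}.indicator
    (Function.uncurry K) (s, r)) (hK.indicator hm)
  rw [intervalIntegral.integral_of_le ht, intervalIntegral.integral_of_le ht]
  convert h1 using 1
  · refine setIntegral_congr_fun measurableSet_Ioc fun s hs => ?_
    rw [intervalIntegral.integral_of_le hs.1.le]
    have h2 : Ioc 0 s = Ioc 0 t ∩ Iic s := by
      rw [Ioc_inter_Iic, min_eq_right hs.2]
    rw [h2, ← setIntegral_indicator measurableSet_Iic]
    rfl
  · refine setIntegral_congr_fun measurableSet_Ioc fun r hr => ?_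
    rw [intervalIntegral.integral_of_le hr.2, ← integral_Icc_eq_integral_Ioc]
    have h2 : Icc r t = Ioc 0 t ∩ Ici r := by
      ext x
      simp only [mem_Icc, mem_inter_iff, mem_Ioc, mem_Ici]
      exact ⟨fun h => ⟨⟨hr.1.trans_le h.1, h.2⟩, h.1⟩, fun h => ⟨h.2, h.1.2⟩⟩
    rw [h2, ← setIntegral_indicator measurableSet_Ici]
    rfl

/-- The product of the integrals is an integral over a square, which the diagonal cuts into two
triangles. This serves as the product rule for primitives of merely integrable functions, without
any differentiation almost everywhere. -/
theorem integral_mul_integral {𝕜 : Type*} [RCLike 𝕜] {f g : ℝ → 𝕜} {t : ℝ} (ht : 0 ≤ t)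
    (hf : IntervalIntegrable f volume 0 t) (hg : IntervalIntegrable g volume 0 t) :
    (∫ s in (0 : ℝ)..t, f s) * (∫ s in (0 : ℝ)..t, g s) =
      (∫ s in (0 : ℝ)..t, (f s * ∫ r in (0 : ℝ)..s, g r)) +
        ∫ s in (0 : ℝ)..t, ((∫ r in (0 : ℝ)..s, f r) * g s) := by
  have hf' := (intervalIntegrable_iff_integrableOn_Ioc_of_le ht).1 hf
  have hg' := (intervalIntegrable_iff_integrableOn_Ioc_of_le ht).1 hg
  have h := integral_triangle_swap (K := fun s r => f s * g r) ht (hf'.mul_prod hg')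
  simp only [intervalIntegral.integral_const_mul, intervalIntegral.integral_mul_const] at h
  have hc : ContinuousOn (fun s => ∫ r in (0 : ℝ)..s, f r) (uIcc 0 t) :=
    intervalIntegral.continuousOn_primitive_interval' hf left_mem_uIcc
  rw [h, ← intervalIntegral.integral_add]
  · rw [← intervalIntegral.integral_const_mul]
    refine intervalIntegral.integral_congr fun s hs => ?_
    rw [uIcc_of_le ht] at hs
    rw [← intervalIntegral.integral_add_adjacent_intervals (a := 0) (b := s) (c := t)]
    · ring
    · exact hf.mono_set (by rw [uIcc_of_le ht, uIcc_of_le hs.1]; exact Icc_subset_Icc_right hs.2)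
    · exact hf.mono_set (by rw [uIcc_of_le ht, uIcc_of_le hs.2]; exact Icc_subset_Icc_left hs.1)
  · refine hg.continuousOn_mul ?_
    have : (fun r => ∫ s in r..t, f s) = fun r => -∫ s in t..r, f s := by
      funext r; rw [intervalIntegral.integral_symm]
    rw [this]
    exact (intervalIntegral.continuousOn_primitive_interval' hf right_mem_uIcc).neg
  · exact hg.continuousOn_mul hc

/-- With M the primitive of `m`, apply `integral_mul_integral` to m and m Mⁿ: by induction both
triangle integrals are multiples of the integral wanted. The rule M' = m is never used. -/
theorem integral_mul_primitive_pow {m : ℝ → ℝ} {T : ℝ} (hm : IntervalIntegrable m volume 0 T)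
    (n : ℕ) : ∀ t ∈ Icc 0 T, ∫ s in (0 : ℝ)..t, m s * (∫ r in (0 : ℝ)..s, m r) ^ n =
      (∫ s in (0 : ℝ)..t, m s) ^ (n + 1) / (n + 1) := by
  induction n with
  | zero => intro t ht; simp
  | succ n ih =>
    intro t ht
    have hmt : IntervalIntegrable m volume 0 t := hm.mono_set (by
      rw [uIcc_of_le ht.1, uIcc_of_le (ht.1.trans ht.2)]; exact Icc_subset_Icc_right ht.2)
    have hc : ContinuousOn (fun s => ∫ r in (0 : ℝ)..s, m r) (uIcc 0 t) :=
      intervalIntegral.continuousOn_primitive_interval' hmt left_mem_uIcc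
    have h := integral_mul_integral ht.1 hmt (hmt.mul_continuousOn (hc.pow n))
    simp only [Pi.pow_apply] at h
    rw [ih t ht] at h
    have h1 : ∫ s in (0 : ℝ)..t, (m s * ∫ r in (0 : ℝ)..s, m r * (∫ x in (0 : ℝ)..r, m x) ^ n) =
        (∫ s in (0 : ℝ)..t, m s * (∫ r in (0 : ℝ)..s, m r) ^ (n + 1)) / (n + 1) := by
      rw [← intervalIntegral.integral_div]
      refine intervalIntegral.integral_congr fun s hs => ?_
      rw [uIcc_of_le ht.1] at hs
      rw [ih s ⟨hs.1, hs.2.trans ht.2⟩]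
      ring
    have h2 : ∫ s in (0 : ℝ)..t, ((∫ r in (0 : ℝ)..s, m r) * (m s * (∫ x in (0 : ℝ)..s, m x) ^ n)) =
        ∫ s in (0 : ℝ)..t, m s * (∫ r in (0 : ℝ)..s, m r) ^ (n + 1) := by
      refine intervalIntegral.integral_congr fun s _ => ?_
      ring
    rw [h1, h2] at h
    push_cast
    field_simp at h ⊢
    linear_combination (-1) * h

theorem primitive_mem_Icc {m : ℝ → ℝ} {T : ℝ} (hm : IntervalIntegrable m volume 0 T)
    (h0 : ∀ s, 0 ≤ m s) {t : ℝ} (ht : t ∈ Icc 0 T) :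
    ∫ s in (0 : ℝ)..t, m s ∈ Icc 0 (∫ s in (0 : ℝ)..T, m s) :=
  ⟨intervalIntegral.integral_nonneg ht.1 fun s _ => h0 s,
    intervalIntegral.integral_mono_interval le_rfl ht.1 ht.2 (ae_of_all _ h0) hm⟩

/-- Iterated Volterra inequalities gain factorials. -/
theorem volterra_iterate {m : ℝ → ℝ} {T B : ℝ} (hm : IntervalIntegrable m volume 0 T)
    (h0 : ∀ s, 0 ≤ m s) (v : ℕ → ℝ → ℝ) (hv : ∀ n, ContinuousOn (v n) (Icc 0 T))
    (hB : ∀ t ∈ Icc 0 T, v 0 t ≤ B)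
    (hs : ∀ n, ∀ t ∈ Icc 0 T, v (n + 1) t ≤ ∫ s in (0 : ℝ)..t, m s * v n s) (n : ℕ) :
    ∀ t ∈ Icc 0 T, v n t ≤ B * (∫ s in (0 : ℝ)..t, m s) ^ n / n.factorial := by
  induction n with
  | zero => intro t ht; simpa using hB t ht
  | succ n ih =>
    intro t ht
    have hsub : uIcc 0 t ⊆ Icc 0 T := by
      rw [uIcc_of_le ht.1]; exact Icc_subset_Icc_right ht.2
    have hmt : IntervalIntegrable m volume 0 t :=
      hm.mono_set (by rwa [uIcc_of_le (ht.1.trans ht.2)])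
    have hc : ContinuousOn (fun s => ∫ r in (0 : ℝ)..s, m r) (uIcc 0 t) :=
      intervalIntegral.continuousOn_primitive_interval' hmt left_mem_uIcc
    calc v (n + 1) t ≤ ∫ s in (0 : ℝ)..t, m s * v n s := hs n t ht
      _ ≤ ∫ s in (0 : ℝ)..t,
          (m s * (∫ r in (0 : ℝ)..s, m r) ^ n) * (B / n.factorial) := by
        refine intervalIntegral.integral_mono_on ht.1 ?_ ?_ fun s hs' => ?_
        · exact hmt.mul_continuousOn ((hv n).mono hsub)
        · exact (hmt.mul_continuousOn (hc.pow n)).mul_const _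
        · have := mul_le_mul_of_nonneg_left (ih s ⟨hs'.1, hs'.2.trans ht.2⟩) (h0 s)
          calc _ ≤ _ := this
            _ = _ := by ring
      _ = _ := by
        rw [intervalIntegral.integral_mul_const, integral_mul_primitive_pow hm n t ht,
          Nat.factorial_succ]
        push_cast
        field_simp

/-- Grönwall's inequality with an integrable kernel. -/
theorem gronwall_integrable {m v : ℝ → ℝ} {T a : ℝ} (hm : IntervalIntegrable m volume 0 T)
    (h0 : ∀ s, 0 ≤ m s) (ha : 0 ≤ a) (hv : ContinuousOn v (Icc 0 T))
    (h : ∀ t ∈ Icc 0 T, v t ≤ a + ∫ s in (0 : ℝ)..t, m s * v s) :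
    ∀ t ∈ Icc 0 T, v t ≤ a * Real.exp (∫ s in (0 : ℝ)..T, m s) := by
  intro t ht
  obtain ⟨B, hB⟩ := (isCompact_Icc.image_of_continuousOn hv).bddAbove
  have hT : 0 ≤ T := ht.1.trans ht.2
  set M : ℝ → ℝ := fun t => ∫ s in (0 : ℝ)..t, m s with hM
  have hMc : ContinuousOn M (Icc 0 T) := by
    rw [← uIcc_of_le hT]
    exact intervalIntegral.continuousOn_primitive_interval' hm left_mem_uIcc
  -- `w n` subtracts from v the first n terms of the series of a exp(M). This absorbs the constant
  -- a, so that `w` obeys the homogeneous recursion of `volterra_iterate`, whose bound tends to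
  -- zero.
  set w : ℕ → ℝ → ℝ := fun n t => v t - a * ∑ i ∈ Finset.range n, M t ^ i / i.factorial with hw
  have hwc : ∀ n, ContinuousOn (w n) (Icc 0 T) := fun n =>
    hv.sub (continuousOn_const.mul (continuousOn_finsetSum _ fun i _ => (hMc.pow i).div_const _))
  have key := volterra_iterate hm h0 w hwc (B := B)
    (fun t ht => by simpa [hw] using hB (mem_image_of_mem v ht)) (fun n t ht => ?_)
  · have h1 : ∀ n : ℕ, v t ≤ a * Real.exp (M t) + B * (M t ^ n / n.factorial) := by
      intro n
      have h2 := key n t ht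
      have h3 := Real.sum_le_exp_of_nonneg (primitive_mem_Icc hm h0 ht).1 n
      have h4 := mul_le_mul_of_nonneg_left h3 ha
      simp only [hw] at h2
      rw [mul_div_assoc] at h2
      linarith
    have h5 : Tendsto (fun n : ℕ => a * Real.exp (M t) + B * (M t ^ n / n.factorial)) atTop
        (𝓝 (a * Real.exp (M t) + B * 0)) :=
      tendsto_const_nhds.add ((FloorSemiring.tendsto_pow_div_factorial_atTop _).const_mul B)
    have h6 := ge_of_tendsto' h5 h1
    rw [mul_zero, add_zero] at h6
    exact h6.trans (mul_le_mul_of_nonneg_left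
      (Real.exp_le_exp.2 (primitive_mem_Icc hm h0 ht).2) ha)
  · have hsub : uIcc 0 t ⊆ Icc 0 T := by
      rw [uIcc_of_le ht.1]; exact Icc_subset_Icc_right ht.2
    have hmt : IntervalIntegrable m volume 0 t :=
      hm.mono_set (by rwa [uIcc_of_le hT])
    have h1 : ∫ s in (0 : ℝ)..t, m s * w n s = (∫ s in (0 : ℝ)..t, m s * v s) -
        ∑ i ∈ Finset.range n, ∫ s in (0 : ℝ)..t, m s * M s ^ i * (a / i.factorial) := by
      rw [← intervalIntegral.integral_finsetSum, ← intervalIntegral.integral_sub]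
      · refine intervalIntegral.integral_congr fun s _ => ?_
        simp only [hw, mul_sub, Finset.mul_sum]
        congr 1
        refine Finset.sum_congr rfl fun i _ => ?_
        ring
      · exact hmt.mul_continuousOn (hv.mono hsub)
      · have h2 : ContinuousOn (fun s => ∑ i ∈ Finset.range n, M s ^ i * (a / i.factorial))
            (uIcc 0 t) :=
          continuousOn_finsetSum _ fun i _ => ((hMc.mono hsub).pow i).mul_const _
        simpa only [Finset.mul_sum, mul_assoc] using hmt.mul_continuousOn h2
      · exact fun i _ => (hmt.mul_continuousOn ((hMc.mono hsub).pow i)).mul_const _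
    have h2 : ∀ i ∈ Finset.range n, ∫ s in (0 : ℝ)..t, m s * M s ^ i * (a / i.factorial) =
        a * (M t ^ (i + 1) / (i + 1).factorial) := by
      intro i _
      rw [intervalIntegral.integral_mul_const, integral_mul_primitive_pow hm i t ht,
        Nat.factorial_succ]
      push_cast
      field_simp
      exact mul_comm _ _
    rw [h1, Finset.sum_congr rfl h2, ← Finset.mul_sum]
    simp only [hw]
    -- The term i = 0 is the constant a of the hypothesis; the others are the integrals just
    -- computed.
    rw [Finset.sum_range_succ']
    have := h t ht
    simp only [pow_zero, Nat.factorial_zero, Nat.cast_one, div_one, mul_add, mul_one]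
    linarith

end

noncomputable section

/-! ### Continuous functions on `[0,1]`, primitives, and multiplication of `L²` functions -/

/-- The continuous functions on `[0,1]`. -/
abbrev CI : Type := C(Icc (0 : ℝ) 1, ℂ)

namespace CI

/-- The extension of a continuous function on `[0,1]` to the line by constants. -/
def ext (f : CI) : ℝ → ℂ := IccExtend zero_le_one f

theorem continuous_ext (f : CI) : Continuous f.ext := f.continuous.Icc_extend'

theorem ext_apply (f : CI) {x : ℝ} (hx : x ∈ Icc (0 : ℝ) 1) : f.ext x = f ⟨x, hx⟩ :=
  IccExtend_of_mem _ _ hx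

theorem norm_ext_le (f : CI) (x : ℝ) : ‖f.ext x‖ ≤ ‖f‖ := f.norm_coe_le_norm _

theorem memLp_ext (p : ℝ≥0∞) (f : CI) : MemLp f.ext p volI :=
  MemLp.of_bound f.continuous_ext.aestronglyMeasurable ‖f‖ (ae_of_all _ f.norm_ext_le)

/-- The inclusion of the continuous functions on `[0,1]` in `Lᵖ(I; ℂ)`. -/
def toLp (p : ℝ≥0∞) [Fact (1 ≤ p)] : CI →L[ℂ] Lp ℂ p volI :=
  LinearMap.mkContinuous
    { toFun := fun f => (f.memLp_ext p).toLp
      map_add' := fun f g => (MemLp.toLp_add (f.memLp_ext p) (g.memLp_ext p))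
      map_smul' := fun c f => (MemLp.toLp_const_smul c (f.memLp_ext p)) }
    (measureUnivNNReal volI ^ p.toReal⁻¹) (fun f => Lp.norm_le_of_ae_bound (norm_nonneg _) (by
      filter_upwards [(f.memLp_ext p).coeFn_toLp] with x hx
      exact (congrArg norm hx).trans_le (f.norm_ext_le x)))

theorem coeFn_toLp (p : ℝ≥0∞) [Fact (1 ≤ p)] (f : CI) : toLp p f =ᵐ[volI] f.ext :=
  (f.memLp_ext p).coeFn_toLp

end CI

theorem L2I.integrable (h : L2I) : Integrable h volI :=
  (Lp.memLp h).integrable (by norm_num)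

theorem L2I.intervalIntegrable (h : L2I) {x y : ℝ} (hx : x ∈ Icc (0 : ℝ) 1)
    (hy : y ∈ Icc (0 : ℝ) 1) : IntervalIntegrable h volume x y := by
  have h1 : IntervalIntegrable h volume 0 1 := by
    rw [intervalIntegrable_iff_integrableOn_Ioo_of_le zero_le_one]
    exact L2I.integrable h
  exact h1.mono_set (by rw [uIcc_of_le (zero_le_one : (0 : ℝ) ≤ 1)]; exact uIcc_subset_Icc hx hy)

theorem L2I.intervalIntegral_congr {f g : ℝ → ℂ} (h : f =ᵐ[volI] g) {x : ℝ}
    (hx : x ∈ Icc (0 : ℝ) 1) : ∫ s in (0 : ℝ)..x, f s = ∫ s in (0 : ℝ)..x, g s := by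
  rw [intervalIntegral.integral_of_le hx.1, intervalIntegral.integral_of_le hx.1,
    integral_Ioc_eq_integral_Ioo, integral_Ioc_eq_integral_Ioo]
  exact integral_congr_ae (ae_restrict_of_ae_restrict_of_subset (Ioo_subset_Ioo_right hx.2) h)

/-- The integral is the inner product with the indicator of (0, x), whose norm is at most 1 since x
≤ 1. -/
theorem L2I.norm_intervalIntegral_le (h : L2I) {x : ℝ} (hx : x ∈ Icc (0 : ℝ) 1) :
    ‖∫ s in (0 : ℝ)..x, h s‖ ≤ ‖h‖ := by
  have h1 : ∫ s in (0 : ℝ)..x, h s =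
      inner ℂ (indicatorConstLp 2 (μ := volI) (measurableSet_Ioo (a := (0 : ℝ)) (b := x))
        (measure_ne_top _ _) (1 : ℂ)) h := by
    rw [L2.inner_indicatorConstLp_one, intervalIntegral.integral_of_le hx.1,
      integral_Ioc_eq_integral_Ioo, Measure.restrict_restrict measurableSet_Ioo,
      inter_eq_left.2 (Ioo_subset_Ioo_right hx.2)]
  rw [h1]
  refine (norm_inner_le_norm _ _).trans (mul_le_of_le_one_left (norm_nonneg _) ?_)
  refine norm_indicatorConstLp_le.trans ?_
  rw [norm_one, one_mul]
  refine Real.rpow_le_one measureReal_nonneg ?_ (by simp)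
  have h2 : volI.real (Ioo 0 x) ≤ volI.real univ := measureReal_mono (subset_univ _)
  simpa using h2

/-- The primitive of an `L²` function that vanishes at `0`. -/
def primitiveFun (h : L2I) : CI where
  toFun x := ∫ s in (0 : ℝ)..x, h s
  continuous_toFun := by
    have h1 : ContinuousOn (fun x => ∫ s in (0 : ℝ)..x, h s) (uIcc 0 1) :=
      intervalIntegral.continuousOn_primitive_interval'
        (L2I.intervalIntegrable h (by simp) (by simp)) left_mem_uIcc
    rw [uIcc_of_le zero_le_one] at h1
    exact continuousOn_iff_continuous_domRestrict.1 h1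

theorem primitiveFun_apply (h : L2I) (x : Icc (0 : ℝ) 1) :
    primitiveFun h x = ∫ s in (0 : ℝ)..x, h s := rfl

/-- The primitive, as a bounded linear map. -/
def primitiveL : L2I →L[ℂ] CI :=
  LinearMap.mkContinuous
    { toFun := primitiveFun
      map_add' := fun f g => by
        ext x
        rw [ContinuousMap.add_apply, primitiveFun_apply, primitiveFun_apply, primitiveFun_apply,
          ← intervalIntegral.integral_add (L2I.intervalIntegrable f (by simp) x.2)
          (L2I.intervalIntegrable g (by simp) x.2)]
        exact L2I.intervalIntegral_congr (Lp.coeFn_add f g) x.2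
      map_smul' := fun c f => by
        ext x
        rw [ContinuousMap.smul_apply, primitiveFun_apply, primitiveFun_apply, RingHom.id_apply,
          ← intervalIntegral.integral_smul]
        exact L2I.intervalIntegral_congr (Lp.coeFn_smul c f) x.2 }
    1 (fun h => by
      rw [one_mul, ContinuousMap.norm_le _ (norm_nonneg _)]
      exact fun x => L2I.norm_intervalIntegral_le h x.2)

theorem primitiveL_apply (h : L2I) (x : Icc (0 : ℝ) 1) :
    primitiveL h x = ∫ s in (0 : ℝ)..x, h s := rfl

/-- `x ↦ a + ∫₀ˣ h`. -/
def affinePrimitive : ℂ × L2I →L[ℂ] CI :=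
  (ContinuousLinearMap.fst ℂ ℂ L2I).smulRight (1 : CI) +
    primitiveL.comp (ContinuousLinearMap.snd ℂ ℂ L2I)

theorem affinePrimitive_apply (a : ℂ) (h : L2I) (x : Icc (0 : ℝ) 1) :
    affinePrimitive (a, h) x = a + ∫ s in (0 : ℝ)..x, h s := by
  simp [affinePrimitive, primitiveL_apply]

theorem affinePrimitive_zero (a : ℂ) (h : L2I) :
    affinePrimitive (a, h) ⟨0, by simp⟩ = a := by
  simp [affinePrimitive_apply]

/-- Multiplication of an `L²` function with a continuous function. -/
def mulL2 : CI →L[ℂ] L2I →L[ℂ] L2I :=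
  ((ContinuousLinearMap.mul ℂ ℂ).holderL volI ∞ 2 2).comp (CI.toLp ∞)

theorem coeFn_mulL2 (g : CI) (h : L2I) : mulL2 g h =ᵐ[volI] fun x => g.ext x * h x := by
  have h1 := (ContinuousLinearMap.mul ℂ ℂ).coeFn_holder (r := 2) (CI.toLp ∞ g) h
  filter_upwards [h1, CI.coeFn_toLp ∞ g] with x h1 h2
  rw [← h2]
  exact h1

theorem mulL2_toLp (f g : CI) : mulL2 f (CI.toLp 2 g) = CI.toLp 2 (f * g) := by
  apply Lp.ext
  filter_upwards [coeFn_mulL2 f (CI.toLp 2 g), CI.coeFn_toLp 2 g, CI.coeFn_toLp 2 (f * g)]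
    with x h1 h2 h3
  rw [h1, h2, h3]
  rfl

/-- The product rule for primitives of `L²` functions. -/
theorem affinePrimitive_mul (a b : ℂ) (f g : L2I) :
    affinePrimitive (a, f) * affinePrimitive (b, g) =
      affinePrimitive (a * b, mulL2 (affinePrimitive (b, g)) f +
        mulL2 (affinePrimitive (a, f)) g) := by
  ext x
  have hf := L2I.intervalIntegrable f (by simp : (0 : ℝ) ∈ Icc (0 : ℝ) 1) x.2
  have hg := L2I.intervalIntegrable g (by simp : (0 : ℝ) ∈ Icc (0 : ℝ) 1) x.2
  have h1 := integral_mul_integral x.2.1 hf hg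
  have hcf := intervalIntegral.continuousOn_primitive_interval' hf left_mem_uIcc
  have hcg := intervalIntegral.continuousOn_primitive_interval' hg left_mem_uIcc
  have h2 : ∫ s in (0 : ℝ)..x, (mulL2 (affinePrimitive (b, g)) f +
        mulL2 (affinePrimitive (a, f)) g : L2I) s =
      ∫ s in (0 : ℝ)..x, ((b * f s + f s * ∫ r in (0 : ℝ)..s, g r) +
        (a * g s + (∫ r in (0 : ℝ)..s, f r) * g s)) := by
    refine L2I.intervalIntegral_congr ?_ x.2
    filter_upwards [Lp.coeFn_add (mulL2 (affinePrimitive (b, g)) f)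
      (mulL2 (affinePrimitive (a, f)) g), coeFn_mulL2 (affinePrimitive (b, g)) f,
      coeFn_mulL2 (affinePrimitive (a, f)) g, ae_restrict_mem measurableSet_Ioo] with s h1 h2 h3 hs
    rw [h1, Pi.add_apply, h2, h3, CI.ext_apply _ (Ioo_subset_Icc_self hs),
      CI.ext_apply _ (Ioo_subset_Icc_self hs), affinePrimitive_apply, affinePrimitive_apply]
    ring
  rw [ContinuousMap.mul_apply, affinePrimitive_apply, affinePrimitive_apply,
    affinePrimitive_apply, h2, intervalIntegral.integral_add, intervalIntegral.integral_add,
    intervalIntegral.integral_add, intervalIntegral.integral_const_mul,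
    intervalIntegral.integral_const_mul]
  · linear_combination h1
  · exact hg.const_mul _
  · exact hg.continuousOn_mul hcf
  · exact hf.const_mul _
  · exact hf.mul_continuousOn hcg
  · exact (hf.const_mul _).add (hf.mul_continuousOn hcg)
  · exact (hg.const_mul _).add (hg.continuousOn_mul hcf)

/-! ### The algebra `H³(0,1)` -/

/-- The space `H³(0,1)`: the tuple `(a₀, a₁, a₂, h)` stands for the function `f` with `f(0) = a₀`,
`f'(0) = a₁`, `f''(0) = a₂`, `f''' = h`. -/
abbrev Y : Type := ℂ × ℂ × ℂ × L2I

namespace Y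

/-- The value of `f` at `0`. -/
def a0 : Y →L[ℂ] ℂ := ContinuousLinearMap.fst ℂ _ _
/-- The value of `f'` at `0`. -/
def a1 : Y →L[ℂ] ℂ := (ContinuousLinearMap.fst ℂ _ _).comp (ContinuousLinearMap.snd ℂ _ _)
/-- The value of `f''` at `0`. -/
def a2 : Y →L[ℂ] ℂ := (ContinuousLinearMap.fst ℂ _ _).comp
  ((ContinuousLinearMap.snd ℂ _ _).comp (ContinuousLinearMap.snd ℂ _ _))
/-- The third derivative of `f`. -/
def d3 : Y →L[ℂ] L2I := (ContinuousLinearMap.snd ℂ _ _).comp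
  ((ContinuousLinearMap.snd ℂ _ _).comp (ContinuousLinearMap.snd ℂ _ _))
/-- The second derivative of `f`. -/
def c2 : Y →L[ℂ] CI := affinePrimitive.comp (a2.prod d3)
/-- The first derivative of `f`. -/
def c1 : Y →L[ℂ] CI := affinePrimitive.comp (a1.prod ((CI.toLp 2).comp c2))
/-- The function `f`. -/
def c0 : Y →L[ℂ] CI := affinePrimitive.comp (a0.prod ((CI.toLp 2).comp c1))
/-- The function `f` as an element of `L²`. -/
def toL2 : Y →L[ℂ] L2I := (CI.toLp 2).comp c0

theorem c2_eq (y : Y) : c2 y = affinePrimitive (a2 y, d3 y) := rfl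
theorem c1_eq (y : Y) : c1 y = affinePrimitive (a1 y, CI.toLp 2 (c2 y)) := rfl
theorem c0_eq (y : Y) : c0 y = affinePrimitive (a0 y, CI.toLp 2 (c1 y)) := rfl

/-- `(y, z) ↦ j (B (p y) (r z))`. -/
def bil {A A' C : Type*} [NormedAddCommGroup A] [NormedSpace ℂ A] [NormedAddCommGroup A']
    [NormedSpace ℂ A'] [NormedAddCommGroup C] [NormedSpace ℂ C] (j : C →L[ℂ] Y)
    (B : A →L[ℂ] A' →L[ℂ] C) (p : Y →L[ℂ] A) (r : Y →L[ℂ] A') : Y →L[ℂ] Y →L[ℂ] Y :=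
  (ContinuousLinearMap.compL ℂ Y C Y j).comp (B.bilinearComp p r)

theorem bil_apply {A A' C : Type*} [NormedAddCommGroup A] [NormedSpace ℂ A] [NormedAddCommGroup A']
    [NormedSpace ℂ A'] [NormedAddCommGroup C] [NormedSpace ℂ C] (j : C →L[ℂ] Y)
    (B : A →L[ℂ] A' →L[ℂ] C) (p : Y →L[ℂ] A) (r : Y →L[ℂ] A') (y z : Y) :
    bil j B p r y z = j (B (p y) (r z)) := rfl

/-- The embedding of the coordinate `f(0)`. -/
def j0 : ℂ →L[ℂ] Y := ContinuousLinearMap.inl ℂ _ _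
/-- The embedding of the coordinate `f'(0)`. -/
def j1 : ℂ →L[ℂ] Y := (ContinuousLinearMap.inr ℂ _ _).comp (ContinuousLinearMap.inl ℂ _ _)
/-- The embedding of the coordinate `f''(0)`. -/
def j2 : ℂ →L[ℂ] Y := (ContinuousLinearMap.inr ℂ _ _).comp
  ((ContinuousLinearMap.inr ℂ _ _).comp (ContinuousLinearMap.inl ℂ _ _))
/-- The embedding of the coordinate `f'''`. -/
def j3 : L2I →L[ℂ] Y := (ContinuousLinearMap.inr ℂ _ _).comp
  ((ContinuousLinearMap.inr ℂ _ _).comp (ContinuousLinearMap.inr ℂ _ _))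

/-- The multiplication of `H³(0,1)`. -/
def mul : Y →L[ℂ] Y →L[ℂ] Y :=
  bil j0 (ContinuousLinearMap.mul ℂ ℂ) a0 a0 +
  (bil j1 (ContinuousLinearMap.mul ℂ ℂ) a1 a0 + bil j1 (ContinuousLinearMap.mul ℂ ℂ) a0 a1) +
  (bil j2 (ContinuousLinearMap.mul ℂ ℂ) a2 a0 +
    (2 : ℂ) • bil j2 (ContinuousLinearMap.mul ℂ ℂ) a1 a1 +
    bil j2 (ContinuousLinearMap.mul ℂ ℂ) a0 a2) +
  (bil j3 mulL2.flip d3 c0 + (3 : ℂ) • bil j3 mulL2.flip ((CI.toLp 2).comp c2) c1 +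
    (3 : ℂ) • bil j3 mulL2 c1 ((CI.toLp 2).comp c2) + bil j3 mulL2 c0 d3)

theorem mul_apply (y z : Y) : mul y z = (a0 y * a0 z, a1 y * a0 z + a0 y * a1 z,
    a2 y * a0 z + 2 * (a1 y * a1 z) + a0 y * a2 z,
    mulL2 (c0 z) (d3 y) + (3 : ℂ) • mulL2 (c1 z) (CI.toLp 2 (c2 y)) +
      (3 : ℂ) • mulL2 (c1 y) (CI.toLp 2 (c2 z)) + mulL2 (c0 y) (d3 z)) := by
  simp [mul, bil_apply, j0, j1, j2, j3]

/-- The coefficients in `mul` are those of the Leibniz rule up to order three. The second derivative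
comes first, since `c1` is built from `c2` and `c0` from `c1`: each level then follows from the
product rule `affinePrimitive_mul` and the level above. -/
theorem c2_mul (y z : Y) : c2 (mul y z) = c2 y * c0 z + (2 : ℂ) • (c1 y * c1 z) + c0 y * c2 z := by
  have h1 : c2 y * c0 z = affinePrimitive (a2 y * a0 z,
    mulL2 (c0 z) (d3 y) + mulL2 (c2 y) (CI.toLp 2 (c1 z))) := affinePrimitive_mul _ _ _ _
  have h2 : c1 y * c1 z = affinePrimitive (a1 y * a1 z,
    mulL2 (c1 z) (CI.toLp 2 (c2 y)) + mulL2 (c1 y) (CI.toLp 2 (c2 z))) :=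
      affinePrimitive_mul _ _ _ _
  have h3 : c0 y * c2 z = affinePrimitive (a0 y * a2 z,
    mulL2 (c2 z) (CI.toLp 2 (c1 y)) + mulL2 (c0 y) (d3 z)) := affinePrimitive_mul _ _ _ _
  have h4 : c2 (mul y z) = affinePrimitive (a2 y * a0 z + 2 * (a1 y * a1 z) + a0 y * a2 z,
    mulL2 (c0 z) (d3 y) + (3 : ℂ) • mulL2 (c1 z) (CI.toLp 2 (c2 y)) +
      (3 : ℂ) • mulL2 (c1 y) (CI.toLp 2 (c2 z)) + mulL2 (c0 y) (d3 z)) := by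
    rw [mul_apply]; rfl
  rw [h1, h2, h3, h4, ← map_smul affinePrimitive, ← map_add affinePrimitive,
    ← map_add affinePrimitive]
  congr 1
  simp only [Prod.smul_mk, Prod.mk_add_mk, smul_eq_mul, smul_add]
  congr 1
  simp only [mulL2_toLp]
  rw [mul_comm (c2 y) (c1 z), mul_comm (c2 z) (c1 y)]
  module

theorem c1_mul (y z : Y) : c1 (mul y z) = c1 y * c0 z + c0 y * c1 z := by
  have h1 : c1 y * c0 z = affinePrimitive (a1 y * a0 z,
    mulL2 (c0 z) (CI.toLp 2 (c2 y)) + mulL2 (c1 y) (CI.toLp 2 (c1 z))) :=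
      affinePrimitive_mul _ _ _ _
  have h2 : c0 y * c1 z = affinePrimitive (a0 y * a1 z,
    mulL2 (c1 z) (CI.toLp 2 (c1 y)) + mulL2 (c0 y) (CI.toLp 2 (c2 z))) :=
      affinePrimitive_mul _ _ _ _
  have h3 : a1 (mul y z) = a1 y * a0 z + a0 y * a1 z := by rw [mul_apply]; rfl
  rw [h1, h2, c1_eq, h3, c2_mul, ← map_add]
  congr 1
  simp only [Prod.mk_add_mk]
  congr 1
  simp only [mulL2_toLp, ← map_add]
  congr 1
  rw [two_smul ℂ (c1 y * c1 z)]
  ring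

theorem c0_mul (y z : Y) : c0 (mul y z) = c0 y * c0 z := by
  have h1 : c0 y * c0 z = affinePrimitive (a0 y * a0 z,
    mulL2 (c0 z) (CI.toLp 2 (c1 y)) + mulL2 (c0 y) (CI.toLp 2 (c1 z))) :=
      affinePrimitive_mul _ _ _ _
  have h3 : a0 (mul y z) = a0 y * a0 z := by rw [mul_apply]; rfl
  rw [h1, c0_eq, h3, c1_mul]
  congr 1
  congr 1
  simp only [mulL2_toLp, ← map_add]
  congr 1
  ring

/-- Complex conjugation on `H³(0,1)`. -/
def conj : Y →L[ℝ] Y :=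
  (Complex.conjCLE : ℂ →L[ℝ] ℂ).prodMap ((Complex.conjCLE : ℂ →L[ℝ] ℂ).prodMap
    ((Complex.conjCLE : ℂ →L[ℝ] ℂ).prodMap ((Complex.conjCLE : ℂ →L[ℝ] ℂ).compLpL 2 volI)))

theorem affinePrimitive_conj (a : ℂ) (h : L2I) : affinePrimitive ((starRingEnd ℂ) a,
    (Complex.conjCLE : ℂ →L[ℝ] ℂ).compLpL 2 volI h) = star (affinePrimitive (a, h)) := by
  ext x
  simp only [ContinuousMap.star_apply, affinePrimitive_apply, RCLike.star_def, map_add]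
  congr 1
  rw [L2I.intervalIntegral_congr (ContinuousLinearMap.coeFn_compLpL _ h) x.2]
  simp only [intervalIntegral.integral_of_le x.2.1]
  exact integral_conj

theorem toLp_star (f : CI) : CI.toLp 2 (star f) =
    (Complex.conjCLE : ℂ →L[ℝ] ℂ).compLpL 2 volI (CI.toLp 2 f) := by
  apply Lp.ext
  filter_upwards [CI.coeFn_toLp 2 (star f), CI.coeFn_toLp 2 f,
    ContinuousLinearMap.coeFn_compLpL (Complex.conjCLE : ℂ →L[ℝ] ℂ) (CI.toLp 2 f)] with x h1 h2 h3
  rw [h1, h3, h2]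
  rfl

theorem c2_conj (y : Y) : c2 (conj y) = star (c2 y) := by
  rw [c2_eq, c2_eq, ← affinePrimitive_conj]; rfl

theorem c1_conj (y : Y) : c1 (conj y) = star (c1 y) := by
  rw [c1_eq, c1_eq, ← affinePrimitive_conj, c2_conj, toLp_star]; rfl

theorem c0_conj (y : Y) : c0 (conj y) = star (c0 y) := by
  rw [c0_eq, c0_eq, ← affinePrimitive_conj, c1_conj, toLp_star]; rfl

end Y

/-- A continuously differentiable function is the primitive of its derivative. -/
theorem affinePrimitive_derivWithin {f : ℝ → ℂ} (hf : ContDiffOn ℝ ∞ f (Icc 0 1)) {g : CI}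
    (hg : ∀ x : Icc (0 : ℝ) 1, g x = derivWithin f (Icc 0 1) x) (x : Icc (0 : ℝ) 1) :
    affinePrimitive (f 0, CI.toLp 2 g) x = f x := by
  have hf' : ContinuousOn (derivWithin f (Icc 0 1)) (Icc 0 1) :=
    hf.continuousOn_derivWithin (uniqueDiffOn_Icc zero_lt_one) (by simp)
  rw [affinePrimitive_apply, L2I.intervalIntegral_congr
    (g := derivWithin f (Icc 0 1)) _ x.2]
  · rw [intervalIntegral.integral_eq_sub_of_hasDerivAt_of_le x.2.1 (f := f)]
    · ring
    · exact hf.continuousOn.mono (Icc_subset_Icc_right x.2.2)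
    · intro s hs
      have hs' : s ∈ Icc (0 : ℝ) 1 := ⟨hs.1.le, hs.2.le.trans x.2.2⟩
      exact (((hf.differentiableOn (by simp)) s hs').hasDerivWithinAt).hasDerivAt
        (Icc_mem_nhds hs.1 (hs.2.trans_le x.2.2))
    · refine ContinuousOn.intervalIntegrable ?_
      rw [uIcc_of_le x.2.1]
      exact hf'.mono (Icc_subset_Icc_right x.2.2)
  · filter_upwards [CI.coeFn_toLp 2 g, ae_restrict_mem measurableSet_Ioo] with s h1 hs
    rw [h1, CI.ext_apply _ (Ioo_subset_Icc_self hs), hg]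

/-- Smooth functions belong to `H³(0,1)`. -/
theorem exists_Y_of_contDiffOn {f : ℝ → ℂ} (hf : ContDiffOn ℝ ∞ f (Icc 0 1)) :
    ∃ y : Y, ∀ x : Icc (0 : ℝ) 1, Y.c0 y x = f x := by
  have hu : UniqueDiffOn ℝ (Icc (0 : ℝ) 1) := uniqueDiffOn_Icc zero_lt_one
  have hf1 : ContDiffOn ℝ ∞ (derivWithin f (Icc 0 1)) (Icc 0 1) :=
    hf.derivWithin hu (by simp)
  set f1 := derivWithin f (Icc 0 1)
  have hf2 : ContDiffOn ℝ ∞ (derivWithin f1 (Icc 0 1)) (Icc 0 1) :=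
    hf1.derivWithin hu (by simp)
  set f2 := derivWithin f1 (Icc 0 1)
  have hf3 : ContinuousOn (derivWithin f2 (Icc 0 1)) (Icc 0 1) :=
    hf2.continuousOn_derivWithin hu (by simp)
  set g : CI := ⟨_, continuousOn_iff_continuous_domRestrict.1 hf3⟩
  refine ⟨(f 0, f1 0, f2 0, CI.toLp 2 g), fun x => ?_⟩
  exact affinePrimitive_derivWithin hf (affinePrimitive_derivWithin hf1
    (affinePrimitive_derivWithin hf2 (fun _ => rfl))) x

end

noncomputable section

/-! ### Trigonometric systems on `(0,1)` -/

theorem integral_cos_int (n : ℤ) :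
    ∫ x in (0 : ℝ)..1, Real.cos (n * Real.pi * x) = if n = 0 then 1 else 0 := by
  split_ifs with h
  · simp [h]
  · have h1 : (n : ℝ) * Real.pi ≠ 0 := by
      have := Real.pi_ne_zero
      have : (n : ℝ) ≠ 0 := by exact_mod_cast h
      positivity
    rw [intervalIntegral.integral_comp_mul_left (fun x => Real.cos x) h1]
    simp [Real.sin_int_mul_pi]

theorem integral_sin_mul_sin (k l : ℕ) :
    ∫ x in (0 : ℝ)..1, (√2 * Real.sin ((k + 1 : ℕ) * Real.pi * x)) *
      (√2 * Real.sin ((l + 1 : ℕ) * Real.pi * x)) = if k = l then 1 else 0 := by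
  have h1 : ∀ x : ℝ, (√2 * Real.sin ((k + 1 : ℕ) * Real.pi * x)) *
      (√2 * Real.sin ((l + 1 : ℕ) * Real.pi * x)) =
      Real.cos (((k - l : ℤ) : ℝ) * Real.pi * x) -
        Real.cos (((k + l + 2 : ℤ) : ℝ) * Real.pi * x) := by
    intro x
    have e1 : ((k - l : ℤ) : ℝ) * Real.pi * x =
      (k + 1 : ℕ) * Real.pi * x - (l + 1 : ℕ) * Real.pi * x := by push_cast; ring
    have e2 : ((k + l + 2 : ℤ) : ℝ) * Real.pi * x =
      (k + 1 : ℕ) * Real.pi * x + (l + 1 : ℕ) * Real.pi * x := by push_cast; ring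
    rw [e1, e2, Real.cos_sub, Real.cos_add]
    have := Real.mul_self_sqrt (show (0 : ℝ) ≤ 2 by norm_num)
    linear_combination (Real.sin ((k + 1 : ℕ) * Real.pi * x) *
      Real.sin ((l + 1 : ℕ) * Real.pi * x)) * this
  simp only [h1]
  rw [intervalIntegral.integral_sub (Continuous.intervalIntegrable (by fun_prop) _ _)
    (Continuous.intervalIntegrable (by fun_prop) _ _), integral_cos_int, integral_cos_int,
    if_neg (show ¬ ((k : ℤ) + l + 2 = 0) by omega), sub_zero]
  exact if_congr (by omega) rfl rfl

theorem integral_cos_mul_cos (k l : ℕ) :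
    ∫ x in (0 : ℝ)..1, (√2 * Real.cos ((k + 1 : ℕ) * Real.pi * x)) *
      (√2 * Real.cos ((l + 1 : ℕ) * Real.pi * x)) = if k = l then 1 else 0 := by
  have h1 : ∀ x : ℝ, (√2 * Real.cos ((k + 1 : ℕ) * Real.pi * x)) *
      (√2 * Real.cos ((l + 1 : ℕ) * Real.pi * x)) =
      Real.cos (((k - l : ℤ) : ℝ) * Real.pi * x) +
        Real.cos (((k + l + 2 : ℤ) : ℝ) * Real.pi * x) := by
    intro x
    have e1 : ((k - l : ℤ) : ℝ) * Real.pi * x =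
      (k + 1 : ℕ) * Real.pi * x - (l + 1 : ℕ) * Real.pi * x := by push_cast; ring
    have e2 : ((k + l + 2 : ℤ) : ℝ) * Real.pi * x =
      (k + 1 : ℕ) * Real.pi * x + (l + 1 : ℕ) * Real.pi * x := by push_cast; ring
    rw [e1, e2, Real.cos_sub, Real.cos_add]
    have := Real.mul_self_sqrt (show (0 : ℝ) ≤ 2 by norm_num)
    linear_combination (Real.cos ((k + 1 : ℕ) * Real.pi * x) *
      Real.cos ((l + 1 : ℕ) * Real.pi * x)) * this
  simp only [h1]
  rw [intervalIntegral.integral_add (Continuous.intervalIntegrable (by fun_prop) _ _)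
    (Continuous.intervalIntegrable (by fun_prop) _ _), integral_cos_int, integral_cos_int,
    if_neg (show ¬ ((k : ℤ) + l + 2 = 0) by omega), add_zero]
  exact if_congr (by omega) rfl rfl

/-- The function `√2 cos(kπx)`. -/
def cosFun (k : ℕ) : CI where
  toFun x := ((√2 * Real.cos (k * Real.pi * x) : ℝ) : ℂ)
  continuous_toFun := by fun_prop

/-- The function `√2 cos(kπx)` as an element of `L²`. -/
def cosMode (k : ℕ) : L2I := CI.toLp 2 (cosFun k)

theorem coeFn_cosMode (k : ℕ) :
    cosMode k =ᵐ[volI] fun x => ((√2 * Real.cos (k * Real.pi * x) : ℝ) : ℂ) := by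
  filter_upwards [CI.coeFn_toLp 2 (cosFun k), ae_restrict_mem measurableSet_Ioo] with x h1 hx
  rw [cosMode, h1, CI.ext_apply _ (Ioo_subset_Icc_self hx)]
  rfl

theorem coeFn_dirichletMode (k : ℕ) :
    dirichletMode k =ᵐ[volI] fun x => ((√2 * Real.sin (k * Real.pi * x) : ℝ) : ℂ) :=
  (memLp_dirichletEigenfun k).coeFn_toLp

theorem inner_of_real {f : L2I} {u : ℝ → ℝ} (hf : f =ᵐ[volI] fun x => (u x : ℂ)) (g : L2I) :
    inner ℂ f g = ∫ x in (0 : ℝ)..1, (u x : ℂ) * g x := by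
  rw [L2.inner_def, intervalIntegral.integral_of_le zero_le_one, integral_Ioc_eq_integral_Ioo]
  refine integral_congr_ae ?_
  filter_upwards [hf] with x hx
  rw [hx]
  simp [mul_comm]

theorem inner_of_real_real {f g : L2I} {u v : ℝ → ℝ} (hf : f =ᵐ[volI] fun x => (u x : ℂ))
    (hg : g =ᵐ[volI] fun x => (v x : ℂ)) :
    inner ℂ f g = ((∫ x in (0 : ℝ)..1, u x * v x : ℝ) : ℂ) := by
  rw [inner_of_real hf, ← intervalIntegral.integral_ofReal]
  refine L2I.intervalIntegral_congr ?_ (by simp)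
  filter_upwards [hg] with x hx
  rw [hx]
  push_cast
  rfl

theorem orthonormal_dirichletMode : Orthonormal ℂ fun j : ℕ => dirichletMode (j + 1) := by
  rw [orthonormal_iff_ite]
  intro k l
  rw [inner_of_real_real (coeFn_dirichletMode _) (coeFn_dirichletMode _), integral_sin_mul_sin]
  split_ifs <;> simp

theorem orthonormal_cosMode : Orthonormal ℂ fun j : ℕ => cosMode (j + 1) := by
  rw [orthonormal_iff_ite]
  intro k l
  rw [inner_of_real_real (coeFn_cosMode _) (coeFn_cosMode _), integral_cos_mul_cos]
  split_ifs <;> simp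

/-- The sine basis of `L²`. -/
def sineBasis : HilbertBasis ℕ ℂ L2I :=
  HilbertBasis.mkOfOrthogonalEqBot orthonormal_dirichletMode (by
    rw [Submodule.eq_bot_iff]
    intro f hf
    refine eq_zero_of_sineCoeff_eq_zero f fun k => ?_
    exact hf _ (Submodule.subset_span ⟨k, rfl⟩))

theorem sineBasis_apply (j : ℕ) : sineBasis j = dirichletMode (j + 1) := by
  simp [sineBasis]

theorem sineBasis_repr (f : L2I) (j : ℕ) : sineBasis.repr f j = sineCoeff (j + 1) f := by
  rw [HilbertBasis.repr_apply_apply, sineBasis_apply]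
  rfl

theorem ext_sineCoeff {f g : L2I} (h : ∀ j, sineCoeff (j + 1) f = sineCoeff (j + 1) g) : f = g := by
  refine sineBasis.repr.injective (lp.ext (funext fun j => ?_))
  rw [sineBasis_repr, sineBasis_repr, h]

/-- The coefficient functional along the mode `k`. -/
def sineCoeffL (k : ℕ) : L2I →L[ℂ] ℂ := innerSL ℂ (dirichletMode k)

theorem sineCoeffL_apply (k : ℕ) (f : L2I) : sineCoeffL k f = sineCoeff k f := rfl

theorem sineCoeff_eq_intervalIntegral (k : ℕ) (f : L2I) :
    sineCoeff k f = ∫ x in (0 : ℝ)..1, ((√2 * Real.sin (k * Real.pi * x) : ℝ) : ℂ) * f x :=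
  inner_of_real (coeFn_dirichletMode k) f

/-! ### Integration by parts -/

/-- Integration by parts for a function with only an L² derivative; `integral_mul_integral` replaces
the product rule. -/
theorem integral_affinePrimitive_mul_deriv (a : ℂ) (f : L2I) {G G' : ℝ → ℝ}
    (hG : ∀ x, HasDerivAt G (G' x) x) (hG' : Continuous G') :
    ∫ x in (0 : ℝ)..1, (G' x : ℂ) * (affinePrimitive (a, f)).ext x =
      affinePrimitive (a, f) 1 * G 1 - a * G 0 - ∫ x in (0 : ℝ)..1, (G x : ℂ) * f x := by
  have hf := L2I.intervalIntegrable f (by simp : (0 : ℝ) ∈ Icc (0 : ℝ) 1)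
    (by simp : (1 : ℝ) ∈ Icc (0 : ℝ) 1)
  have hGc : Continuous G := continuous_iff_continuousAt.2 fun x => (hG x).continuousAt
  have hGi : ∀ s : ℝ, ∫ r in (0 : ℝ)..s, (G' r : ℂ) = G s - G 0 := by
    intro s
    rw [intervalIntegral.integral_ofReal, intervalIntegral.integral_eq_sub_of_hasDerivAt
      (fun x _ => hG x) (hG'.intervalIntegrable _ _)]
    push_cast
    rfl
  have hGii : IntervalIntegrable (fun r => (G' r : ℂ)) volume 0 1 :=
    Continuous.intervalIntegrable (by fun_prop) _ _
  have h1 := integral_mul_integral zero_le_one hf hGii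
  simp only [hGi] at h1
  have hcf := intervalIntegral.continuousOn_primitive_interval' hf left_mem_uIcc
  have h2 : ∫ x in (0 : ℝ)..1, (G' x : ℂ) * (affinePrimitive (a, f)).ext x =
      ∫ x in (0 : ℝ)..1, (a * G' x + (∫ r in (0 : ℝ)..x, f r) * G' x) := by
    refine intervalIntegral.integral_congr fun x hx => ?_
    rw [uIcc_of_le zero_le_one] at hx
    rw [CI.ext_apply _ hx, affinePrimitive_apply]
    ring
  have h3 : ∫ s in (0 : ℝ)..1, f s * ((G s : ℂ) - G 0) =
      (∫ x in (0 : ℝ)..1, (G x : ℂ) * f x) - G 0 * ∫ x in (0 : ℝ)..1, f x := by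
    rw [← intervalIntegral.integral_const_mul, ← intervalIntegral.integral_sub]
    · refine intervalIntegral.integral_congr fun x _ => ?_
      ring
    · exact hf.continuousOn_mul (by fun_prop)
    · exact hf.const_mul _
  rw [h3] at h1
  rw [h2, intervalIntegral.integral_add, intervalIntegral.integral_const_mul, hGi,
    affinePrimitive_apply]
  · change _ = (a + _) * _ - _ - _
    linear_combination -h1
  · exact hGii.const_mul _
  · exact hGii.continuousOn_mul hcf

theorem integral_toLp (G : ℝ → ℝ) (f : CI) :
    ∫ x in (0 : ℝ)..1, (G x : ℂ) * (CI.toLp 2 f) x = ∫ x in (0 : ℝ)..1, (G x : ℂ) * f.ext x := by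
  refine L2I.intervalIntegral_congr ?_ (by simp)
  filter_upwards [CI.coeFn_toLp 2 f] with x h1
  rw [h1]

theorem integral_cos_deriv (k : ℕ) (a : ℂ) (f : L2I) :
    (-(k * Real.pi : ℝ) : ℂ) * ∫ x in (0 : ℝ)..1, (Real.sin (k * Real.pi * x) : ℂ) *
      (affinePrimitive (a, f)).ext x = affinePrimitive (a, f) 1 * (-1) ^ k - a -
        ∫ x in (0 : ℝ)..1, (Real.cos (k * Real.pi * x) : ℂ) * f x := by
  have h := integral_affinePrimitive_mul_deriv a f (G := fun x => Real.cos (k * Real.pi * x))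
    (G' := fun x => -Real.sin (k * Real.pi * x) * (k * Real.pi)) (fun x => by
      have := ((hasDerivAt_id x).const_mul (k * Real.pi)).cos
      simpa using this) (by fun_prop)
  rw [mul_one, Real.cos_nat_mul_pi, mul_zero, Real.cos_zero] at h
  push_cast at h
  rw [mul_one] at h
  rw [← intervalIntegral.integral_const_mul]
  push_cast
  rw [← h]
  refine intervalIntegral.integral_congr fun x _ => ?_
  ring

theorem integral_sin_deriv (k : ℕ) (a : ℂ) (f : L2I) :
    ((k * Real.pi : ℝ) : ℂ) * ∫ x in (0 : ℝ)..1, (Real.cos (k * Real.pi * x) : ℂ) *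
      (affinePrimitive (a, f)).ext x =
        -∫ x in (0 : ℝ)..1, (Real.sin (k * Real.pi * x) : ℂ) * f x := by
  have h := integral_affinePrimitive_mul_deriv a f (G := fun x => Real.sin (k * Real.pi * x))
    (G' := fun x => Real.cos (k * Real.pi * x) * (k * Real.pi)) (fun x => by
      have := ((hasDerivAt_id x).const_mul (k * Real.pi)).sin
      simpa using this) (by fun_prop)
  rw [mul_one, Real.sin_nat_mul_pi, mul_zero, Real.sin_zero] at h
  push_cast at h
  rw [mul_zero, mul_zero, sub_zero, zero_sub] at h
  rw [← intervalIntegral.integral_const_mul]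
  push_cast
  rw [← h]
  refine intervalIntegral.integral_congr fun x _ => ?_
  ring

/-- The functional on `H³(0,1)` that gives the sine coefficients of `A^{3/2} f` for
`f(0) = f(1) = 0`. -/
def tau (j : ℕ) : Y →L[ℂ] ℂ :=
  ((√2 : ℂ) * (-1) ^ (j + 1)) • (ContinuousMap.evalCLM ℂ (1 : Icc (0 : ℝ) 1)).comp Y.c2
    - (√2 : ℂ) • Y.a2 - (innerSL ℂ (cosMode (j + 1))).comp Y.d3

theorem tau_apply (j : ℕ) (y : Y) : tau j y = ((√2 : ℂ) * (-1) ^ (j + 1)) * Y.c2 y 1 -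
    (√2 : ℂ) * Y.a2 y - inner ℂ (cosMode (j + 1)) (Y.d3 y) := rfl

/-- Integrate by parts three times, alternating sine and cosine. The first boundary term vanishes by
`h0` and `h1`, the second because the sine does. The third contains f'' at the endpoints, on which
nothing is assumed, and stays in `tau`. Thus `tau` extends the coefficients of A^{3/2} f from
D(A^{3/2}) to H³ ∩ H¹₀. -/
theorem tau_eq (j : ℕ) {y : Y} (h0 : Y.c0 y 0 = 0) (h1 : Y.c0 y 1 = 0) :
    tau j y = (dirichletWeight (j + 1) : ℂ) * sineCoeff (j + 1) (Y.toL2 y) := by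
  have h0' : Y.a0 y = 0 := by
    rw [← h0, Y.c0_eq]; exact (affinePrimitive_zero _ _).symm
  have e1 := integral_cos_deriv (j + 1) (Y.a0 y) (CI.toLp 2 (Y.c1 y))
  have e2 := integral_sin_deriv (j + 1) (Y.a1 y) (CI.toLp 2 (Y.c2 y))
  have e3 := integral_cos_deriv (j + 1) (Y.a2 y) (Y.d3 y)
  rw [integral_toLp (fun x => Real.cos ((j + 1 : ℕ) * Real.pi * x)), ← Y.c0_eq, h1, h0'] at e1
  rw [integral_toLp (fun x => Real.sin ((j + 1 : ℕ) * Real.pi * x)), ← Y.c1_eq] at e2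
  rw [← Y.c2_eq] at e3
  have e4 : sineCoeff (j + 1) (Y.toL2 y) = (√2 : ℂ) * ∫ x in (0 : ℝ)..1,
      (Real.sin ((j + 1 : ℕ) * Real.pi * x) : ℂ) * (Y.c0 y).ext x := by
    rw [sineCoeff_eq_intervalIntegral, Y.toL2, ContinuousLinearMap.comp_apply,
      integral_toLp (fun x => √2 * Real.sin ((j + 1 : ℕ) * Real.pi * x)),
      ← intervalIntegral.integral_const_mul]
    refine intervalIntegral.integral_congr fun x _ => ?_
    push_cast
    ring
  have e5 : inner ℂ (cosMode (j + 1)) (Y.d3 y) = (√2 : ℂ) * ∫ x in (0 : ℝ)..1,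
      (Real.cos ((j + 1 : ℕ) * Real.pi * x) : ℂ) * (Y.d3 y) x := by
    rw [inner_of_real (coeFn_cosMode _), ← intervalIntegral.integral_const_mul]
    refine intervalIntegral.integral_congr fun x _ => ?_
    push_cast
    ring
  rw [tau_apply, e4, e5, dirichletWeight]
  set K : ℂ := (((j + 1 : ℕ) * Real.pi : ℝ) : ℂ)
  have hK : (((((j + 1 : ℕ) : ℝ) * Real.pi) ^ 3 : ℝ) : ℂ) = K ^ 3 := Complex.ofReal_pow _ _
  rw [hK]
  linear_combination (-(√2 : ℂ)) * e3 - (√2 : ℂ) * K * e2 + (√2 : ℂ) * K ^ 2 * e1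

/-! ### The space `H³_{(0)}` -/

theorem one_le_dirichletWeight (j : ℕ) : 1 ≤ dirichletWeight (j + 1) := by
  rw [dirichletWeight]
  refine one_le_pow₀ ?_
  have := Real.pi_gt_three
  push_cast
  nlinarith [(Nat.cast_nonneg j : (0 : ℝ) ≤ j)]

theorem dirichletWeight_ne_zero (j : ℕ) : (dirichletWeight (j + 1) : ℂ) ≠ 0 :=
  Complex.ofReal_ne_zero.2 (by linarith [one_le_dirichletWeight j])

namespace H30

theorem coeffs_apply (f : H30) (j : ℕ) :
    coeffs f j = (dirichletWeight (j + 1) : ℂ) * sineCoeff (j + 1) (toL2 f) := rfl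

/-- Since the weights are at least 1, dividing an ℓ² sequence by them leaves it in ℓ², and the sine
basis turns the quotient into a function. -/
theorem coeffs_surjective : Function.Surjective coeffs := by
  intro c
  have hm : Memℓp (fun j => c j / (dirichletWeight (j + 1) : ℂ)) 2 := by
    refine (lp.memℓp c).mono' (fun j => ?_)
    rw [norm_div, Complex.norm_real, Real.norm_of_nonneg (by linarith [one_le_dirichletWeight j])]
    exact div_le_self (norm_nonneg _) (one_le_dirichletWeight j)
  set f : L2I := sineBasis.repr.symm ⟨_, hm⟩ with hf
  have h1 : weightedCoeff f = c := by
    funext j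
    change (dirichletWeight (j + 1) : ℂ) * sineCoeff (j + 1) f = c j
    rw [← sineBasis_repr, hf, LinearIsometryEquiv.apply_symm_apply]
    exact mul_div_cancel₀ _ (dirichletWeight_ne_zero j)
  have h2 : f ∈ h3Submodule := by
    change Memℓp (weightedCoeff f) 2
    rw [h1]
    exact lp.memℓp c
  exact ⟨⟨f, h2⟩, Subtype.ext h1⟩

/-- `H³_{(0)}` is isometric to `ℓ²`. -/
def coeffsEquiv : H30 ≃ₗᵢ[ℂ] lp (fun _ : ℕ => ℂ) 2 where
  toLinearEquiv := LinearEquiv.ofBijective coeffs ⟨coeffs_injective, coeffs_surjective⟩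
  norm_map' _ := rfl

theorem coeffsEquiv_apply (f : H30) : coeffsEquiv f = coeffs f := rfl

instance : CompleteSpace H30 :=
  (completeSpace_congr (e := coeffsEquiv.toEquiv) coeffsEquiv.isometry.isUniformEmbedding).2
    inferInstance

theorem ext_coeffs {f g : H30} (h : ∀ j, coeffs f j = coeffs g j) : f = g :=
  coeffs_injective (lp.ext (funext h))

/-- The third derivative of an element of `H³_{(0)}`. -/
def d3 : H30 →L[ℂ] L2I :=
  -((orthonormal_cosMode.orthogonalFamily).linearIsometry.toContinuousLinearMap.comp
    (coeffsEquiv : H30 →L[ℂ] lp (fun _ : ℕ => ℂ) 2))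

theorem hasSum_d3 (f : H30) : HasSum (fun j => -(coeffs f j • cosMode (j + 1))) (d3 f) :=
  ((orthonormal_cosMode.orthogonalFamily).hasSum_linearIsometry (coeffs f)).neg

theorem inner_cosMode_d3 (f : H30) (j : ℕ) : inner ℂ (cosMode (j + 1)) (d3 f) = -coeffs f j := by
  have h := (hasSum_d3 f).mapL (innerSL ℂ (cosMode (j + 1)))
  refine h.unique ?_
  have h2 : ∀ k, innerSL ℂ (cosMode (j + 1)) (-(coeffs f k • cosMode (k + 1))) =
      if k = j then -coeffs f j else 0 := by
    intro k
    rw [map_neg, map_smul, innerSL_apply_apply, orthonormal_iff_ite.1 orthonormal_cosMode j k]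
    by_cases hk : k = j
    · subst hk; simp
    · rw [if_neg hk, if_neg (Ne.symm hk)]; simp
  simp only [h2]
  exact hasSum_ite_eq j _

/-- Every cosine mode with k ≥ 1 has mean zero. With f''(0) = 0 this gives f''(1) = 0, the
second-order boundary condition hidden in D(A^{3/2}). -/
theorem primitiveL_d3_one (f : H30) : primitiveL (d3 f) 1 = 0 := by
  have h := (hasSum_d3 f).mapL
    ((ContinuousMap.evalCLM ℂ (1 : Icc (0 : ℝ) 1)).comp primitiveL)
  refine h.unique ?_
  convert hasSum_zero using 2 with j
  rw [map_neg, map_smul, ContinuousLinearMap.comp_apply, ContinuousMap.evalCLM_apply,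
    primitiveL_apply, L2I.intervalIntegral_congr (coeFn_cosMode (j + 1)) (by simp),
    intervalIntegral.integral_ofReal, intervalIntegral.integral_const_mul]
  have := integral_cos_int (j + 1)
  rw [if_neg (by omega)] at this
  push_cast at this
  simp [this]

/-- The inclusion `H³_{(0)} ⊆ H³(0,1)`. -/
def toY : H30 →L[ℂ] Y :=
  (Y.j3 - Y.j1.comp ((ContinuousMap.evalCLM ℂ (1 : Icc (0 : ℝ) 1)).comp (Y.c0.comp Y.j3))).comp d3

/-- `j1 a` is the function a x. In `toY` a multiple of it corrects the triple primitive of f''' so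
that the value at x = 1 becomes zero. -/
theorem c0_j1_one (a : ℂ) : Y.c0 (Y.j1 a) 1 = a := by
  have h0 : Y.c0 (Y.j1 a) = affinePrimitive (0, CI.toLp 2 (affinePrimitive (a, CI.toLp 2
    (affinePrimitive (0, 0))))) := rfl
  have h1 : affinePrimitive (0, 0) = 0 := map_zero affinePrimitive
  rw [h0, h1, map_zero, affinePrimitive_apply, L2I.intervalIntegral_congr (g := fun _ => a) _
    (by simp)]
  · simp
  · filter_upwards [CI.coeFn_toLp 2 (affinePrimitive (a, 0)), ae_restrict_mem measurableSet_Ioo,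
      Lp.coeFn_zero ℂ 2 volI] with x h1 hx h2
    rw [h1, CI.ext_apply _ (Ioo_subset_Icc_self hx), affinePrimitive_apply,
      L2I.intervalIntegral_congr (Lp.coeFn_zero ℂ 2 volI) (Ioo_subset_Icc_self hx)]
    simp

theorem c0_toY_zero (f : H30) : Y.c0 (toY f) 0 = 0 := by
  have h : Y.a0 (toY f) = 0 := by simp [Y.a0, toY, Y.j3, Y.j1]
  rw [Y.c0_eq, h]
  exact affinePrimitive_zero _ _

theorem c0_toY_one (f : H30) : Y.c0 (toY f) 1 = 0 := by
  simp only [toY, ContinuousLinearMap.comp_apply, _root_.sub_apply, map_sub,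
    ContinuousMap.sub_apply, c0_j1_one]
  exact sub_self _

theorem tau_toY (f : H30) (j : ℕ) : tau j (toY f) = coeffs f j := by
  have h2 : Y.a2 (toY f) = 0 := by simp [Y.a2, toY, Y.j3, Y.j1]
  have h3 : Y.d3 (toY f) = d3 f := by simp [Y.d3, toY, Y.j3, Y.j1]
  have h4 : Y.c2 (toY f) 1 = 0 := by
    rw [Y.c2_eq, h2, h3, affinePrimitive_apply, zero_add]
    exact primitiveL_d3_one f
  rw [tau_apply, h2, h3, h4, inner_cosMode_d3]
  ring

/-- `toY f` is assembled from a cosine series, so it must be checked that it is f. By `tau_eq` and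
`tau_toY` both have the same sine coefficients. -/
theorem toL2_toY (f : H30) : Y.toL2 (toY f) = toL2 f := by
  refine ext_sineCoeff fun j => ?_
  have h := tau_eq j (c0_toY_zero f) (c0_toY_one f)
  rw [tau_toY, coeffs_apply] at h
  exact (mul_left_cancel₀ (dirichletWeight_ne_zero j) h).symm

end H30

end

noncomputable section

/-! ### Weak derivatives on `(0,1)` -/

theorem image_eq_zero_of_tsupport_subset {θ : ℝ → ℝ} (h : tsupport θ ⊆ Ioo 0 1) {x : ℝ}
    (hx : x ∉ Ioo (0 : ℝ) 1) : θ x = 0 :=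
  image_eq_zero_of_notMem_tsupport fun hx' => hx (h hx')

theorem setIntegral_smul_eq (θ : ℝ → ℝ) (f : ℝ → ℂ) :
    ∫ x in Ioo (0 : ℝ) 1, θ x • f x = ∫ x in (0 : ℝ)..1, (θ x : ℂ) * f x := by
  rw [intervalIntegral.integral_of_le zero_le_one, integral_Ioc_eq_integral_Ioo]
  simp only [Complex.real_smul]

theorem hasWeakDeriv_affinePrimitive (a : ℂ) (h : L2I) :
    HasWeakDeriv (CI.toLp 2 (affinePrimitive (a, h))) h := by
  intro θ hθ hc hs
  have h1 := integral_affinePrimitive_mul_deriv a h (G := θ) (G' := deriv θ)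
    (fun x => (hθ.differentiable (by simp) x).hasDerivAt) (hθ.continuous_deriv (by simp))
  rw [image_eq_zero_of_tsupport_subset hs (by simp : (0 : ℝ) ∉ Ioo (0 : ℝ) 1),
    image_eq_zero_of_tsupport_subset hs (by simp : (1 : ℝ) ∉ Ioo (0 : ℝ) 1)] at h1
  rw [setIntegral_smul_eq, setIntegral_smul_eq, integral_toLp (deriv θ), h1]
  simp

/-- A smooth bump of integral one in `(0,1)`. -/
theorem exists_unit_bump : ∃ η : ℝ → ℝ, ContDiff ℝ ∞ η ∧ HasCompactSupport η ∧
    tsupport η ⊆ Ioo 0 1 ∧ (1 / 2 : ℝ) ∈ tsupport η ∧ ∫ x in (0 : ℝ)..1, η x = 1 := by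
  let φ : ContDiffBump (1 / 2 : ℝ) := ⟨1 / 8, 1 / 4, by norm_num, by norm_num⟩
  have hs : tsupport (φ.normed volume) ⊆ Ioo 0 1 := by
    rw [φ.tsupport_normed_eq, Real.closedBall_eq_Icc]
    intro x hx
    have h1 : φ.rOut = 1 / 4 := rfl
    rw [h1] at hx
    exact ⟨by linarith [hx.1], by linarith [hx.2]⟩
  refine ⟨φ.normed volume, φ.contDiff_normed, φ.hasCompactSupport_normed, hs, ?_, ?_⟩
  · rw [φ.tsupport_normed_eq]
    exact Metric.mem_closedBall_self φ.rOut_pos.le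
  · rw [intervalIntegral.integral_of_le zero_le_one, integral_Ioc_eq_integral_Ioo,
      setIntegral_eq_integral_of_forall_compl_eq_zero
        (fun x hx => image_eq_zero_of_tsupport_subset hs hx)]
    exact φ.integral_normed

/-- A test function of integral zero is the derivative of a test function. -/
theorem exists_primitive_test {ψ : ℝ → ℝ} (hψ : ContDiff ℝ ∞ ψ) {K : Set ℝ} (hK : IsCompact K)
    (hne : K.Nonempty) (hK1 : K ⊆ Ioo 0 1) (hz : ∀ x ∉ K, ψ x = 0)
    (h0 : ∫ x in (0 : ℝ)..1, ψ x = 0) :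
    ∃ θ : ℝ → ℝ, ContDiff ℝ ∞ θ ∧ HasCompactSupport θ ∧ tsupport θ ⊆ Ioo 0 1 ∧ deriv θ = ψ := by
  obtain ⟨a, ha, hal⟩ := hK.exists_isLeast hne
  obtain ⟨b, hb, hbg⟩ := hK.exists_isGreatest hne
  set θ : ℝ → ℝ := fun x => ∫ s in (0 : ℝ)..x, ψ s with hθ
  have hd : ∀ x, HasDerivAt θ (ψ x) x := fun x =>
    intervalIntegral.integral_hasDerivAt_right (hψ.continuous.intervalIntegrable _ _)
      (hψ.continuous.stronglyMeasurableAtFilter _ _) hψ.continuous.continuousAt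
  have hd' : deriv θ = ψ := funext fun x => (hd x).deriv
  have hsm : ContDiff ℝ ∞ θ := by
    rw [contDiff_infty_iff_deriv, hd']
    exact ⟨fun x => (hd x).differentiableAt, hψ⟩
  have hlt : ∀ x ∈ Iic a, ∫ s in (0 : ℝ)..x, ψ s = 0 := by
    intro x hx
    rw [intervalIntegral.integral_congr_ae (g := fun _ => 0)]
    · simp
    · have h1 : ∀ᵐ s : ℝ, s ≠ a := by simp [ae_iff]
      filter_upwards [h1] with s hs hs'
      refine hz s fun hsK => hs (le_antisymm ?_ (hal hsK))
      exact hs'.2.trans (max_le (hK1 ha).1.le hx)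
  have hsupp : tsupport θ ⊆ Icc a b := by
    refine closure_minimal (fun x hx => ?_) isClosed_Icc
    by_contra hx'
    refine hx ?_
    rcases lt_or_ge x a with h | h
    · exact hlt x h.le
    · have hbx : b < x := by
        by_contra h'
        exact hx' ⟨h, not_lt.1 h'⟩
      have hint : ∀ c d : ℝ, IntervalIntegrable ψ volume c d :=
        fun c d => hψ.continuous.intervalIntegrable _ _
      have h1 : ∀ y, b < y → ∫ s in b..y, ψ s = 0 := by
        intro y hy
        rw [intervalIntegral.integral_congr_ae (g := fun _ => 0)]
        · simp
        · refine ae_of_all _ fun s hs => hz s fun hsK => ?_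
          rw [uIoc_of_le hy.le] at hs
          exact absurd (hbg hsK) (not_le.2 hs.1)
      have h2 := intervalIntegral.integral_add_adjacent_intervals (hint 0 b) (hint b x)
      have h3 := intervalIntegral.integral_add_adjacent_intervals (hint 0 b) (hint b 1)
      rw [h1 1 (hK1 hb).2, h0] at h3
      rw [h1 x hbx] at h2
      change ∫ s in (0 : ℝ)..x, ψ s = 0
      linarith
  exact ⟨θ, hsm, HasCompactSupport.of_support_subset_isCompact isCompact_Icc
    ((subset_tsupport _).trans hsupp), hsupp.trans (Icc_subset_Ioo (hK1 ha).1 (hK1 hb).2), hd'⟩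

theorem intervalIntegrable_ofReal_mul {θ : ℝ → ℝ} (hθ : Continuous θ) (f : L2I) :
    IntervalIntegrable (fun x => (θ x : ℂ) * f x) volume 0 1 :=
  (L2I.intervalIntegrable f (by simp) (by simp)).continuousOn_mul
    (Complex.continuous_ofReal.comp hθ).continuousOn

/-- A function in `H¹(0,1)` is the primitive of its weak derivative. -/
theorem HasWeakDeriv.eq_affinePrimitive {f g : L2I} (h : HasWeakDeriv f g) :
    ∃ a : ℂ, f = CI.toLp 2 (affinePrimitive (a, g)) := by
  obtain ⟨η, hη, hηc, hηs, hηm, hη1⟩ := exists_unit_bump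
  set G := CI.toLp 2 (affinePrimitive (0, g)) with hG
  -- The difference `w` has weak derivative zero, so it should be constant; the constant is found by
  -- testing against the unit bump `η`.
  set w : L2I := f - G with hw
  have hwd : ∀ θ : ℝ → ℝ, ContDiff ℝ ∞ θ → HasCompactSupport θ → tsupport θ ⊆ Ioo 0 1 →
      ∫ x in (0 : ℝ)..1, ((deriv θ x : ℝ) : ℂ) * w x = 0 := by
    intro θ hθ hc hs
    have h1 := h θ hθ hc hs
    rw [← hasWeakDeriv_affinePrimitive 0 g θ hθ hc hs, setIntegral_smul_eq,
      setIntegral_smul_eq] at h1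
    have hcd : Continuous (deriv θ) := hθ.continuous_deriv (by simp)
    rw [L2I.intervalIntegral_congr (g := fun x => ((deriv θ x : ℝ) : ℂ) * f x - ((deriv θ x : ℝ) : ℂ) * G x) _
      (by simp), intervalIntegral.integral_sub (intervalIntegrable_ofReal_mul hcd f)
      (intervalIntegrable_ofReal_mul hcd G), h1, sub_self]
    filter_upwards [Lp.coeFn_sub f G] with x hx
    rw [hw, hx, Pi.sub_apply]
    ring
  set c : ℂ := ∫ x in (0 : ℝ)..1, (η x : ℂ) * w x with hc
  have hae : ∀ᵐ x, x ∈ Ioo (0 : ℝ) 1 → w x - c = 0 := by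
    refine isOpen_Ioo.ae_eq_zero_of_integral_contDiff_smul_eq_zero ?_ ?_
    · refine (IntegrableOn.locallyIntegrableOn ?_)
      exact (L2I.integrable w).sub (integrable_const c)
    · intro χ hχ hχc hχs
      set C : ℝ := ∫ x in (0 : ℝ)..1, χ x with hC
      have hz : ∀ x ∉ tsupport χ ∪ tsupport η, χ x - C * η x = 0 := by
        intro x hx
        rw [image_eq_zero_of_notMem_tsupport fun h' => hx (Or.inl h'),
          image_eq_zero_of_notMem_tsupport fun h' => hx (Or.inr h')]
        simp
      -- χ - C η has integral zero, hence is the derivative of a test function, and `hwd` applies to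
      -- it.
      obtain ⟨θ, h1, h2, h3, h4⟩ := exists_primitive_test (ψ := fun x => χ x - C * η x)
        (hχ.sub (contDiff_const.mul hη)) (hχc.isCompact.union hηc.isCompact) ⟨_, Or.inr hηm⟩
        (union_subset hχs hηs) hz (by
          rw [intervalIntegral.integral_sub (hχ.continuous.intervalIntegrable _ _)
            ((hη.continuous.intervalIntegrable _ _).const_mul C),
            intervalIntegral.integral_const_mul, hη1, ← hC]
          ring)
      have h5 := hwd θ h1 h2 h3
      rw [h4] at h5
      rw [← setIntegral_eq_integral_of_forall_compl_eq_zero (s := Ioo 0 1), setIntegral_smul_eq]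
      · have e1 : ∫ x in (0 : ℝ)..1, ((χ x - C * η x : ℝ) : ℂ) * w x =
            (∫ x in (0 : ℝ)..1, (χ x : ℂ) * w x) - C * c := by
          rw [hc, ← intervalIntegral.integral_const_mul, ← intervalIntegral.integral_sub]
          · refine intervalIntegral.integral_congr fun x _ => ?_
            push_cast
            ring
          · exact intervalIntegrable_ofReal_mul hχ.continuous w
          · exact (intervalIntegrable_ofReal_mul hη.continuous w).const_mul _
        have e2 : ∫ x in (0 : ℝ)..1, (χ x : ℂ) * (w x - c) =
            (∫ x in (0 : ℝ)..1, (χ x : ℂ) * w x) - C * c := by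
          rw [hC, ← intervalIntegral.integral_ofReal, ← intervalIntegral.integral_mul_const,
            ← intervalIntegral.integral_sub]
          · refine intervalIntegral.integral_congr fun x _ => ?_
            ring
          · exact intervalIntegrable_ofReal_mul hχ.continuous w
          · exact Continuous.intervalIntegrable
              ((Complex.continuous_ofReal.comp hχ.continuous).mul continuous_const) _ _
        rw [e2, ← e1]
        exact h5
      · intro x hx
        rw [image_eq_zero_of_tsupport_subset hχs hx, zero_smul]
  refine ⟨c, Lp.ext ?_⟩
  filter_upwards [ae_restrict_of_ae hae, ae_restrict_mem measurableSet_Ioo, Lp.coeFn_sub f G,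
    CI.coeFn_toLp 2 (affinePrimitive (c, g)), CI.coeFn_toLp 2 (affinePrimitive (0, g))]
    with x h1 hx h2 h3 h4
  have h5 := h1 hx
  rw [hw, h2, Pi.sub_apply, hG, h4] at h5
  rw [h3]
  rw [CI.ext_apply _ (Ioo_subset_Icc_self hx), affinePrimitive_apply] at h5 ⊢
  linear_combination h5

/-! ### The domain of `A_V` -/

/-- The eigenvalue `λ_k = k²π²` of `A`, `k = j + 1`. -/
def eigenvalue (j : ℕ) : ℝ := ((j + 1 : ℕ) * Real.pi) ^ 2

theorem VanishesAtEndpoints.of_CI {f : CI} (h0 : f 0 = 0) (h1 : f 1 = 0) :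
    VanishesAtEndpoints (CI.toLp 2 f) := by
  refine ⟨f.ext, f.continuous_ext.continuousOn, ?_, ?_, CI.coeFn_toLp 2 f⟩
  · rw [CI.ext_apply f (by simp : (0 : ℝ) ∈ Icc (0 : ℝ) 1)]; exact h0
  · rw [CI.ext_apply f (by simp : (1 : ℝ) ∈ Icc (0 : ℝ) 1)]; exact h1

theorem VanishesAtEndpoints.apply_eq_zero {f : CI} (h : VanishesAtEndpoints (CI.toLp 2 f)) :
    f 0 = 0 ∧ f 1 = 0 := by
  obtain ⟨F, hF, h0, h1, hae⟩ := h
  have h2 : f.ext =ᵐ[volume.restrict (Icc (0 : ℝ) 1)] F := by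
    rw [← restrict_Ioo_eq_restrict_Icc]
    exact (CI.coeFn_toLp 2 f).symm.trans hae
  have h3 := Measure.eqOn_Icc_of_ae_eq volume (zero_ne_one (α := ℝ)) h2
    f.continuous_ext.continuousOn hF
  constructor
  · have := h3 (by simp : (0 : ℝ) ∈ Icc (0 : ℝ) 1)
    rwa [h0, CI.ext_apply f (by simp : (0 : ℝ) ∈ Icc (0 : ℝ) 1)] at this
  · have := h3 (by simp : (1 : ℝ) ∈ Icc (0 : ℝ) 1)
    rwa [h1, CI.ext_apply f (by simp : (1 : ℝ) ∈ Icc (0 : ℝ) 1)] at this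

/-- After passing to primitives, two integrations by parts suffice. The endpoint values of f vanish,
those of f₁ are multiplied by the sine, so no condition on f₁ is needed. -/
theorem neg_sineCoeff_weakDeriv {f f₁ f₂ : L2I} (hv : VanishesAtEndpoints f)
    (h1 : HasWeakDeriv f f₁) (h2 : HasWeakDeriv f₁ f₂) (j : ℕ) :
    -sineCoeff (j + 1) f₂ = eigenvalue j * sineCoeff (j + 1) f := by
  obtain ⟨a, ha⟩ := h1.eq_affinePrimitive
  obtain ⟨b, hb⟩ := h2.eq_affinePrimitive
  rw [ha] at hv
  obtain ⟨h3, h4⟩ := hv.apply_eq_zero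
  have ha0 : a = 0 := by rw [← h3]; exact (affinePrimitive_zero _ _).symm
  have e1 := integral_cos_deriv (j + 1) a f₁
  have e2 := integral_sin_deriv (j + 1) b f₂
  rw [h4, ha0, ← integral_toLp (fun x => Real.sin ((j + 1 : ℕ) * Real.pi * x)), ← ha0, ← ha] at e1
  rw [← integral_toLp (fun x => Real.cos ((j + 1 : ℕ) * Real.pi * x)), ← hb] at e2
  have e3 : ∀ u : L2I, sineCoeff (j + 1) u = (√2 : ℂ) * ∫ x in (0 : ℝ)..1,
      (Real.sin ((j + 1 : ℕ) * Real.pi * x) : ℂ) * u x := by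
    intro u
    rw [sineCoeff_eq_intervalIntegral, ← intervalIntegral.integral_const_mul]
    refine intervalIntegral.integral_congr fun x _ => ?_
    push_cast
    ring
  rw [ha0] at e1
  rw [e3, e3, eigenvalue]
  set K : ℂ := (((j + 1 : ℕ) * Real.pi : ℝ) : ℂ)
  have hK : (((((j + 1 : ℕ) : ℝ) * Real.pi) ^ 2 : ℝ) : ℂ) = K ^ 2 := Complex.ofReal_pow _ _
  rw [hK]
  linear_combination (-(√2 : ℂ)) * e2 + (√2 : ℂ) * K * e1

/-- `W` is the restriction of the real function `V` to `[0,1]`. -/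
def IsRestriction (V : ℝ → ℝ) (W : CI) : Prop := ∀ x : Icc (0 : ℝ) 1, W x = V x

theorem IsRestriction.coeFn_mulL2 {V : ℝ → ℝ} {W : CI} (hW : IsRestriction V W) (f : L2I) :
    mulL2 W f =ᵐ[volI] fun x => (V x : ℂ) * f x := by
  filter_upwards [_root_.coeFn_mulL2 W f, ae_restrict_mem measurableSet_Ioo] with x h1 hx
  rw [h1, CI.ext_apply _ (Ioo_subset_Icc_self hx), hW]

theorem IsSchrodingerOp.sineCoeff_eq {V : ℝ → ℝ} {W : CI} (hW : IsRestriction V W) {f g : L2I}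
    (h : IsSchrodingerOp V f g) (j : ℕ) :
    sineCoeff (j + 1) g = eigenvalue j * sineCoeff (j + 1) f + sineCoeff (j + 1) (mulL2 W f) := by
  obtain ⟨hv, f₁, f₂, h1, h2, hg⟩ := h
  have hg' : g = -f₂ + mulL2 W f := by
    apply Lp.ext
    filter_upwards [hg, Lp.coeFn_add (-f₂) (mulL2 W f), Lp.coeFn_neg f₂, hW.coeFn_mulL2 f]
      with x h1 h2 h3 h4
    rw [h1, h2, Pi.add_apply, h3, Pi.neg_apply, h4]
  rw [← neg_sineCoeff_weakDeriv hv h1 h2 j, hg']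
  simp only [← sineCoeffL_apply, map_add, map_neg]

theorem exists_isSchrodingerOp {V : ℝ → ℝ} {W : CI} (hW : IsRestriction V W) (f : H30) :
    ∃ g, IsSchrodingerOp V f.toL2 g := by
  rw [← H30.toL2_toY]
  set y := H30.toY f
  refine ⟨-CI.toLp 2 (Y.c2 y) + mulL2 W (Y.toL2 y),
    VanishesAtEndpoints.of_CI (H30.c0_toY_zero f) (H30.c0_toY_one f), CI.toLp 2 (Y.c1 y),
    CI.toLp 2 (Y.c2 y), hasWeakDeriv_affinePrimitive _ _, hasWeakDeriv_affinePrimitive _ _, ?_⟩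
  filter_upwards [Lp.coeFn_add (-CI.toLp 2 (Y.c2 y)) (mulL2 W (Y.toL2 y)),
    Lp.coeFn_neg (CI.toLp 2 (Y.c2 y)), hW.coeFn_mulL2 (Y.toL2 y)] with x h2 h3 h4
  rw [h2, Pi.add_apply, h3, Pi.neg_apply, h4]

/-- The range contains every sine mode. Density allows identities proved on the domain of the
generator to be extended to all of L². -/
theorem H30.dense_range_toL2 : Dense (Set.range H30.toL2) := by
  have h1 : ∀ j, dirichletMode (j + 1) ∈ LinearMap.range H30.toL2 := by
    intro j
    refine ⟨H30.coeffsEquiv.symm (lp.single 2 j (dirichletWeight (j + 1) : ℂ)), ?_⟩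
    refine ext_sineCoeff fun k => ?_
    have h2 := H30.coeffs_apply
      (H30.coeffsEquiv.symm (lp.single 2 j (dirichletWeight (j + 1) : ℂ))) k
    rw [← H30.coeffsEquiv_apply, LinearIsometryEquiv.apply_symm_apply] at h2
    refine mul_left_cancel₀ (dirichletWeight_ne_zero k) (h2.symm.trans ?_)
    rw [sineCoeff, orthonormal_iff_ite.1 orthonormal_dirichletMode k j, lp.single_apply]
    by_cases hk : k = j
    · subst hk; simp
    · simp [hk]
  have h2 : Submodule.span ℂ (Set.range sineBasis) ≤ LinearMap.range H30.toL2 := by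
    rw [Submodule.span_le]
    rintro _ ⟨j, rfl⟩
    rw [sineBasis_apply]
    exact h1 j
  have h3 := Submodule.topologicalClosure_mono h2
  rw [sineBasis.dense_span, top_le_iff] at h3
  rw [← LinearMap.coe_range]
  exact Submodule.dense_iff_topologicalClosure_eq_top.2 h3

end

noncomputable section

/-! ### Strongly continuous groups -/

namespace IsSchrodingerGroup

variable {V : ℝ → ℝ} {U : ℝ → L2I →L[ℂ] L2I}

theorem exists_bound (hU : IsSchrodingerGroup V U) (R : ℝ) :
    ∃ C, 0 ≤ C ∧ ∀ t ∈ Icc (-R) R, ‖U t‖ ≤ C := by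
  obtain ⟨C, hC⟩ := banach_steinhaus (g := fun t : Icc (-R) R => U t) (fun f => by
    obtain ⟨C, hC⟩ := (isCompact_Icc (a := -R) (b := R)).exists_bound_of_continuousOn
      (hU.continuous f).continuousOn
    exact ⟨C, fun t => hC t t.2⟩)
  exact ⟨max C 0, le_max_right _ _, fun t ht => (hC ⟨t, ht⟩).trans (le_max_left _ _)⟩

/-- Strong continuity becomes joint continuity because the operators are bounded uniformly near each
time (`exists_bound`, by Banach–Steinhaus). Joint continuity gives the measurability of s ↦ U(t - s)
F(s). -/
theorem continuous_uncurry (hU : IsSchrodingerGroup V U) :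
    Continuous fun p : ℝ × L2I => U p.1 p.2 := by
  rw [continuous_iff_continuousAt]
  rintro ⟨t, f⟩
  obtain ⟨C, hC0, hC⟩ := hU.exists_bound (|t| + 1)
  rw [ContinuousAt, tendsto_iff_norm_sub_tendsto_zero]
  have h1 : Tendsto (fun p : ℝ × L2I => C * ‖p.2 - f‖ + ‖U p.1 f - U t f‖) (𝓝 (t, f))
      (𝓝 (C * ‖f - f‖ + ‖U t f - U t f‖)) := by
    have hc : Continuous fun p : ℝ × L2I => C * ‖p.2 - f‖ + ‖U p.1 f - U t f‖ := by
      have h2 : Continuous fun p : ℝ × L2I => U p.1 f := (hU.continuous f).comp continuous_fst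
      exact (continuous_const.mul (continuous_snd.sub continuous_const).norm).add
        (h2.sub continuous_const).norm
    exact hc.tendsto (t, f)
  simp only [sub_self, norm_zero, mul_zero, add_zero] at h1
  refine squeeze_zero' (Eventually.of_forall fun _ => norm_nonneg _) ?_ h1
  have h2 : ∀ᶠ p : ℝ × L2I in 𝓝 (t, f), p.1 ∈ Icc (-(|t| + 1)) (|t| + 1) := by
    refine continuous_fst.continuousAt.eventually_mem (Icc_mem_nhds ?_ ?_)
    · have := neg_abs_le t
      change _ < t
      linarith
    · have := le_abs_self t
      change t < _
      linarith
  filter_upwards [h2] with p hp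
  have h3 : U p.1 p.2 - U t f = U p.1 (p.2 - f) + (U p.1 f - U t f) := by
    rw [map_sub]; abel
  rw [h3]
  exact (norm_add_le _ _).trans (add_le_add_left ((U p.1).le_of_opNorm_le (hC _ hp) _) _)

theorem hasDerivAt (hU : IsSchrodingerGroup V U) {f g : L2I} (h : IsSchrodingerOp V f g) (s : ℝ) :
    HasDerivAt (fun t => U t f) (U s (-Complex.I • g)) s := by
  have h0 : HasDerivAt (fun t => U t f) (-Complex.I • g) 0 := by
    rw [hU.generator, smul_smul]
    simpa using h
  have h1 : HasDerivAt (fun t => U s (U t f)) (U s (-Complex.I • g)) 0 :=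
    (((U s).restrictScalars ℝ).hasFDerivAt.comp_hasDerivAt 0 h0)
  have h2 : HasDerivAt (fun t : ℝ => t - s) 1 s := (hasDerivAt_id s).sub_const s
  rw [← sub_self s] at h1
  have h3 := HasDerivAt.scomp (h := fun t : ℝ => t - s) s h1 h2
  rw [one_smul] at h3
  refine h3.congr_of_eventuallyEq (Eventually.of_forall fun t => ?_)
  simp only [Function.comp_apply]
  rw [← ContinuousLinearMap.comp_apply, ← hU.add, add_sub_cancel]

/-- The group commutes with its generator. Since the field `generator` is an equivalence,
differentiability at time 0 of the orbit through `U s f` puts `U s f` in the domain. -/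
theorem isSchrodingerOp (hU : IsSchrodingerGroup V U) {f g : L2I} (h : IsSchrodingerOp V f g)
    (s : ℝ) : IsSchrodingerOp V (U s f) (U s g) := by
  have h1 := hU.hasDerivAt h s
  have h2 : HasDerivAt (fun t => U t (U s f)) (U s (-Complex.I • g)) 0 := by
    have h3 : HasDerivAt (fun t : ℝ => t + s) 1 0 := (hasDerivAt_id (0 : ℝ)).add_const s
    rw [← zero_add s] at h1
    have h4 := h1.scomp (0 : ℝ) h3
    rw [one_smul, zero_add] at h4
    refine h4.congr_of_eventuallyEq (Eventually.of_forall fun t => ?_)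
    simp only [Function.comp_apply]
    rw [hU.add, ContinuousLinearMap.comp_apply]
  rw [hU.generator, map_smul, smul_smul] at h2
  simpa using h2

end IsSchrodingerGroup

/-! ### The group e^{-iA_V t} through its sine coefficients -/

/-- `e^{iλ_k t}`, `k = j + 1`. -/
def phase (j : ℕ) (t : ℝ) : ℂ := Complex.exp ((eigenvalue j * t : ℝ) * Complex.I)

theorem norm_phase (j : ℕ) (t : ℝ) : ‖phase j t‖ = 1 := Complex.norm_exp_ofReal_mul_I _

theorem continuous_phase (j : ℕ) : Continuous (phase j) := by
  unfold phase; fun_prop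

theorem phase_add (j : ℕ) (s t : ℝ) : phase j (s + t) = phase j s * phase j t := by
  rw [phase, phase, phase, ← Complex.exp_add]
  congr 1
  push_cast
  ring

theorem phase_zero (j : ℕ) : phase j 0 = 1 := by simp [phase]

theorem hasDerivAt_phase (j : ℕ) (t : ℝ) :
    HasDerivAt (phase j) (Complex.I * eigenvalue j * phase j t) t := by
  have h1 : HasDerivAt (fun t : ℝ => ((eigenvalue j * t : ℝ) : ℂ) * Complex.I)
      (Complex.I * eigenvalue j) t := by
    have := (((hasDerivAt_id t).const_mul (eigenvalue j)).ofReal_comp).mul_const Complex.I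
    simpa [mul_comm] using this
  have := h1.cexp
  rwa [mul_comm] at this

namespace IsSchrodingerGroup

variable {V : ℝ → ℝ} {U : ℝ → L2I →L[ℂ] L2I} {W : CI}

/-- For f in the domain, differentiate e^{iλs}⟨U(s)f, φ⟩: the eigenvalue terms cancel and only the
potential remains. -/
theorem phase_mul_sineCoeff (hU : IsSchrodingerGroup V U) (hW : IsRestriction V W) (f : L2I)
    (t : ℝ) (j : ℕ) : phase j t * sineCoeff (j + 1) (U t f) = sineCoeff (j + 1) f -
      Complex.I * ∫ s in (0 : ℝ)..t, phase j s * sineCoeff (j + 1) (mulL2 W (U s f)) := by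
  have hcont : ∀ f, Continuous fun s => phase j s * sineCoeffL (j + 1) (mulL2 W (U s f)) :=
    fun f => (continuous_phase j).mul
      ((sineCoeffL (j + 1)).continuous.comp ((mulL2 W).continuous.comp (hU.continuous f)))
  have h0 : ∀ f : H30, phase j t * sineCoeff (j + 1) (U t f.toL2) = sineCoeff (j + 1) f.toL2 -
      Complex.I * ∫ s in (0 : ℝ)..t, phase j s * sineCoeff (j + 1) (mulL2 W (U s f.toL2)) := by
    intro f
    obtain ⟨g, hg⟩ := exists_isSchrodingerOp hW f
    have hd : ∀ s, HasDerivAt (fun s => phase j s * sineCoeffL (j + 1) (U s f.toL2))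
        (-Complex.I * (phase j s * sineCoeffL (j + 1) (mulL2 W (U s f.toL2)))) s := by
      intro s
      have h1 := (((sineCoeffL (j + 1)).restrictScalars ℝ).hasFDerivAt.comp_hasDerivAt s
        (hU.hasDerivAt hg s))
      have h2 := (hasDerivAt_phase j s).mul h1
      refine h2.congr_deriv ?_
      have h3 := (hU.isSchrodingerOp hg s).sineCoeff_eq hW j
      simp only [ContinuousLinearMap.coe_restrictScalars', map_smul, sineCoeffL_apply,
        Function.comp_apply, h3]
      simp only [smul_eq_mul]
      ring
    have h4 := intervalIntegral.integral_eq_sub_of_hasDerivAt (a := 0) (b := t)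
      (fun s _ => hd s) ((continuous_const.mul (hcont f.toL2)).intervalIntegrable _ _)
    rw [intervalIntegral.integral_const_mul, hU.zero, phase_zero] at h4
    simp only [sineCoeffL_apply, ContinuousLinearMap.id_apply] at h4
    linear_combination (-1) * h4
  -- Both sides depend continuously on f, the integral because U is bounded on [-|t|, |t|]. The
  -- identity thus passes from the dense range of `H30.toL2` to L².
  have hcl : IsClosed {f : L2I | phase j t * sineCoeffL (j + 1) (U t f) = sineCoeffL (j + 1) f -
      Complex.I * ∫ s in (0 : ℝ)..t, phase j s * sineCoeffL (j + 1) (mulL2 W (U s f))} := by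
    refine isClosed_eq (by fun_prop) ((sineCoeffL (j + 1)).continuous.sub
      (continuous_const.mul ?_))
    obtain ⟨C, hC0, hC⟩ := hU.exists_bound |t|
    let Φ : L2I →ₗ[ℂ] ℂ :=
      { toFun := fun f => ∫ s in (0 : ℝ)..t, phase j s * sineCoeffL (j + 1) (mulL2 W (U s f))
        map_add' := fun f g => by
          rw [← intervalIntegral.integral_add ((hcont f).intervalIntegrable _ _)
            ((hcont g).intervalIntegrable _ _)]
          simp only [map_add, mul_add]
        map_smul' := fun c f => by
          rw [RingHom.id_apply, smul_eq_mul, ← intervalIntegral.integral_const_mul]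
          refine intervalIntegral.integral_congr fun s _ => ?_
          simp only [map_smul, smul_eq_mul]
          ring }
    have hΦ := (Φ.mkContinuous (‖sineCoeffL (j + 1)‖ * (‖mulL2 W‖ * C) * |t - 0|) (fun f => by
      refine (intervalIntegral.norm_integral_le_of_norm_le_const
        (C := ‖sineCoeffL (j + 1)‖ * (‖mulL2 W‖ * C) * ‖f‖) fun s hs => ?_).trans_eq (by ring)
      rw [norm_mul, norm_phase, one_mul, mul_assoc, mul_assoc]
      refine (sineCoeffL (j + 1)).le_opNorm_of_le ((mulL2 W).le_opNorm_of_le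
        ((U s).le_of_opNorm_le (hC s ?_) f))
      have h5 : |s| ≤ |t| := by
        have := abs_sub_left_of_mem_uIcc (uIoc_subset_uIcc hs)
        simpa using this
      exact abs_le.1 h5)).continuous
    exact hΦ
  exact hcl.closure_subset_iff.2 (by rintro _ ⟨f, rfl⟩; exact h0 f) (H30.dense_range_toL2 f)

/-- The right-hand side of Duhamel's formula. -/
def _root_.duhamel (U : ℝ → L2I →L[ℂ] L2I) (f : L2I) (F : ℝ → L2I) (t : ℝ) : L2I :=
  U t f - Complex.I • ∫ s in (0 : ℝ)..t, U (t - s) (F s)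

theorem aestronglyMeasurable (hU : IsSchrodingerGroup V U) {α : Type*} [MeasurableSpace α]
    {μ : Measure α} {φ : α → ℝ} (hφ : AEStronglyMeasurable φ μ) {F : α → L2I}
    (hF : AEStronglyMeasurable F μ) : AEStronglyMeasurable (fun x => U (φ x) (F x)) μ :=
  hU.continuous_uncurry.comp_aestronglyMeasurable (hφ.prodMk hF)

theorem intervalIntegrable (hU : IsSchrodingerGroup V U) {F : ℝ → L2I} {T : ℝ}
    (hF : IntervalIntegrable F volume 0 T) {φ : ℝ → ℝ} (hφ : Continuous φ) :
    IntervalIntegrable (fun s => U (φ s) (F s)) volume 0 T := by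
  obtain ⟨R, hR⟩ := isCompact_uIcc.exists_bound_of_continuousOn
    (hφ.continuousOn (s := uIcc 0 T))
  obtain ⟨C, hC0, hC⟩ := hU.exists_bound R
  rw [intervalIntegrable_iff] at hF ⊢
  refine Integrable.mono' (hF.norm.const_mul C)
    (hU.aestronglyMeasurable hφ.aestronglyMeasurable hF.aestronglyMeasurable) ?_
  filter_upwards [ae_restrict_mem measurableSet_uIoc] with s hs
  exact (U (φ s)).le_of_opNorm_le (hC _ (abs_le.1 (hR s (uIoc_subset_uIcc hs)))) _

theorem continuousOn_integral (hU : IsSchrodingerGroup V U) {F : ℝ → L2I} {T : ℝ} (hT : 0 ≤ T)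
    (hF : IntervalIntegrable F volume 0 T) :
    ContinuousOn (fun t => ∫ s in (0 : ℝ)..t, U (t - s) (F s)) (Icc 0 T) := by
  have h1 := intervalIntegral.continuousOn_primitive_interval'
    (hU.intervalIntegrable hF continuous_neg) left_mem_uIcc
  rw [uIcc_of_le hT] at h1
  refine (hU.continuous_uncurry.comp_continuousOn (continuousOn_id.prodMk h1)).congr
    fun t ht => ?_
  simp only [Function.comp_apply, id]
  rw [← ContinuousLinearMap.intervalIntegral_comp_comm]
  · refine intervalIntegral.integral_congr fun s _ => ?_
    rw [← ContinuousLinearMap.comp_apply, ← hU.add, sub_eq_add_neg]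
  · refine (hU.intervalIntegrable hF continuous_neg).mono_set ?_
    rw [uIcc_of_le ht.1, uIcc_of_le hT]
    exact Icc_subset_Icc_right ht.2

theorem continuousOn_duhamel (hU : IsSchrodingerGroup V U) {F : ℝ → L2I} {T : ℝ} (hT : 0 ≤ T)
    (hF : IntervalIntegrable F volume 0 T) (f : L2I) :
    ContinuousOn (duhamel U f F) (Icc 0 T) :=
  by
  have h1 := (hU.continuousOn_integral hT hF).const_smul Complex.I
  exact (hU.continuous f).continuousOn.sub h1

/-- Duhamel's formula for `A_V` implies that for `A`, with the potential moved to the source. -/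
theorem phase_mul_sineCoeff_duhamel (hU : IsSchrodingerGroup V U) (hW : IsRestriction V W)
    {F : ℝ → L2I} {T : ℝ} (hF : IntervalIntegrable F volume 0 T) (f : L2I) {t : ℝ}
    (ht : t ∈ Icc 0 T) (j : ℕ) :
    phase j t * sineCoeff (j + 1) (duhamel U f F t) = sineCoeff (j + 1) f -
      Complex.I * ∫ s in (0 : ℝ)..t,
        phase j s * sineCoeff (j + 1) (F s + mulL2 W (duhamel U f F s)) := by
  have hT := ht.1.trans ht.2
  have hFt : IntervalIntegrable F volume 0 t := by
    refine hF.mono_set ?_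
    rw [uIcc_of_le ht.1, uIcc_of_le hT]
    exact Icc_subset_Icc_right ht.2
  set L := sineCoeffL (j + 1)
  have hL : ∀ f, sineCoeff (j + 1) f = L f := fun _ => rfl
  simp only [hL]
  have hA : ∀ f t, phase j t * L (U t f) = L f -
      Complex.I * ∫ s in (0 : ℝ)..t, phase j s * L (mulL2 W (U s f)) :=
    fun f t => hU.phase_mul_sineCoeff hW f t j
  -- The homogeneous identity `hA` is applied to F(s) with elapsed time t - s; the phase splits as
  -- e^{iλs} e^{iλ(t-s)}.
  have e1 : phase j t * L (∫ s in (0 : ℝ)..t, U (t - s) (F s)) =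
      ∫ s in (0 : ℝ)..t, (phase j s * L (F s) -
        Complex.I * ∫ r in s..t, phase j r * L (mulL2 W (U (r - s) (F s)))) := by
    rw [← ContinuousLinearMap.intervalIntegral_comp_comm _
      (hU.intervalIntegrable hFt (by fun_prop)), ← intervalIntegral.integral_const_mul]
    refine intervalIntegral.integral_congr fun s _ => ?_
    have h1 := hA (F s) (t - s)
    have h2 : phase j t = phase j s * phase j (t - s) := by rw [← phase_add, add_sub_cancel]
    have h3 : ∫ r in s..t, phase j r * L (mulL2 W (U (r - s) (F s))) =
        phase j s * ∫ r in (0 : ℝ)..t - s, phase j r * L (mulL2 W (U r (F s))) := by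
      have := intervalIntegral.integral_comp_sub_right (a := s) (b := t)
        (fun r => phase j (s + r) * L (mulL2 W (U r (F s)))) s
      simp only [add_sub_cancel, sub_self] at this
      rw [this, ← intervalIntegral.integral_const_mul]
      refine intervalIntegral.integral_congr fun r _ => ?_
      simp only [phase_add]
      ring
    rw [h2, h3]
    linear_combination (phase j s) * h1
  obtain ⟨C, hC0, hC⟩ := hU.exists_bound t
  have hK : Integrable (Function.uncurry fun r s => phase j r * L (mulL2 W (U (r - s) (F s))))
      ((volume.restrict (Ioc 0 t)).prod (volume.restrict (Ioc 0 t))) := by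
    have hFi : Integrable F (volume.restrict (Ioc 0 t)) :=
      (intervalIntegrable_iff_integrableOn_Ioc_of_le ht.1).1 hFt
    refine Integrable.mono' (g := fun p => ‖L‖ * (‖mulL2 W‖ * (C * ‖F p.2‖)))
      ((((hFi.norm.comp_snd _).const_mul C).const_mul _).const_mul _) ?_ ?_
    · refine ((continuous_phase j).comp continuous_fst).aestronglyMeasurable.mul
        (L.continuous.comp_aestronglyMeasurable ((mulL2 W).continuous.comp_aestronglyMeasurable
          (hU.aestronglyMeasurable (Continuous.aestronglyMeasurable (by fun_prop))
            hFi.aestronglyMeasurable.comp_snd)))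
    · rw [Measure.prod_restrict]
      filter_upwards [ae_restrict_mem (measurableSet_Ioc.prod measurableSet_Ioc)] with p hp
      simp only [Function.uncurry, norm_mul, norm_phase, one_mul]
      refine L.le_opNorm_of_le ((mulL2 W).le_opNorm_of_le
        ((U _).le_of_opNorm_le (hC _ ?_) _))
      exact ⟨by linarith [hp.1.1, hp.2.2], by linarith [hp.1.2, hp.2.1]⟩
  -- Exchanging the order of integration reassembles, at each time r, the Duhamel integral up to r
  -- under the potential.
  have e2 := integral_triangle_swap ht.1 hK
  have hmono : ∀ r ∈ Icc 0 t, IntervalIntegrable F volume 0 r := fun r hr => by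
    refine hFt.mono_set ?_
    rw [uIcc_of_le ht.1, uIcc_of_le hr.1]
    exact Icc_subset_Icc_right hr.2
  have e3 : ∫ r in (0 : ℝ)..t, ∫ s in (0 : ℝ)..r, phase j r * L (mulL2 W (U (r - s) (F s))) =
      ∫ r in (0 : ℝ)..t, phase j r * L (mulL2 W (∫ s in (0 : ℝ)..r, U (r - s) (F s))) := by
    refine intervalIntegral.integral_congr fun r hr => ?_
    rw [uIcc_of_le ht.1] at hr
    rw [intervalIntegral.integral_const_mul, ← ContinuousLinearMap.comp_apply,
      ← ContinuousLinearMap.intervalIntegral_comp_comm _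
        (hU.intervalIntegrable (hmono r hr) (by fun_prop))]
    rfl
  have i1 : IntervalIntegrable (fun s => phase j s * L (F s)) volume 0 t := by
    have : IntervalIntegrable (fun s => L (F s)) volume 0 t :=
      ⟨L.integrable_comp hFt.1, L.integrable_comp hFt.2⟩
    exact this.continuousOn_mul (continuous_phase j).continuousOn
  have i2 : IntervalIntegrable (fun s => ∫ r in s..t, phase j r * L (mulL2 W (U (r - s) (F s))))
      volume 0 t := by
    rw [intervalIntegrable_iff_integrableOn_Ioc_of_le ht.1]
    have h1 := (hK.indicator (measurableSet_le (measurable_snd (α := ℝ) (β := ℝ))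
      measurable_fst)).integral_prod_right
    refine h1.congr ?_
    filter_upwards [ae_restrict_mem measurableSet_Ioc] with s hs
    have h3 : ∫ r in s..t, phase j r * L (mulL2 W (U (r - s) (F s))) =
        ∫ r in Icc s t, phase j r * L (mulL2 W (U (r - s) (F s))) := by
      rw [intervalIntegral.integral_of_le hs.2, integral_Icc_eq_integral_Ioc]
    have h2 : Icc s t = Ioc 0 t ∩ Ici s := by
      ext x
      simp only [mem_Icc, mem_inter_iff, mem_Ioc, mem_Ici]
      exact ⟨fun h => ⟨⟨hs.1.trans_le h.1, h.2⟩, h.1⟩, fun h => ⟨h.2, h.1.2⟩⟩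
    rw [h3, h2, ← setIntegral_indicator measurableSet_Ici]
    rfl
  have i3 : IntervalIntegrable (fun s => phase j s * L (mulL2 W (U s f))) volume 0 t :=
    Continuous.intervalIntegrable ((continuous_phase j).mul
      (L.continuous.comp ((mulL2 W).continuous.comp (hU.continuous f)))) _ _
  have i4 : IntervalIntegrable
      (fun r => phase j r * L (mulL2 W (∫ s in (0 : ℝ)..r, U (r - s) (F s)))) volume 0 t := by
    refine ContinuousOn.intervalIntegrable ?_
    rw [uIcc_of_le ht.1]
    exact (continuous_phase j).continuousOn.mul (L.continuous.comp_continuousOn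
      ((mulL2 W).continuous.comp_continuousOn (hU.continuousOn_integral ht.1 hFt)))
  have e4 : ∫ s in (0 : ℝ)..t, phase j s * L (F s + mulL2 W (duhamel U f F s)) =
      (∫ s in (0 : ℝ)..t, phase j s * L (F s)) +
      ((∫ s in (0 : ℝ)..t, phase j s * L (mulL2 W (U s f))) - Complex.I *
        ∫ r in (0 : ℝ)..t, phase j r * L (mulL2 W (∫ s in (0 : ℝ)..r, U (r - s) (F s)))) := by
    rw [← intervalIntegral.integral_const_mul, ← intervalIntegral.integral_sub i3 (i4.const_mul _),
      ← intervalIntegral.integral_add i1 (i3.sub (i4.const_mul _))]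
    refine intervalIntegral.integral_congr fun s _ => ?_
    simp only [duhamel, map_add, map_sub, map_smul, smul_eq_mul]
    ring
  rw [intervalIntegral.integral_sub i1 (i2.const_mul _), intervalIntegral.integral_const_mul] at e1
  rw [e4, duhamel, map_sub, map_smul, smul_eq_mul, mul_sub, hA f t]
  linear_combination (-Complex.I) * e1 + Complex.I ^ 2 * (e3 - e2)

end IsSchrodingerGroup

end

noncomputable section

/-! ### Bessel inequalities -/

theorem L2.norm_sq_eq_integral {α E : Type*} [MeasurableSpace α] {μ : Measure α}
    [NormedAddCommGroup E] (f : Lp E 2 μ) : ‖f‖ ^ 2 = ∫ x, ‖f x‖ ^ 2 ∂μ := by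
  have h0 : 0 ≤ ∫ x, ‖f x‖ ^ 2 ∂μ := integral_nonneg fun _ => sq_nonneg _
  rw [Lp.norm_def, (Lp.memLp f).eLpNorm_eq_integral_rpow_norm (by norm_num) (by norm_num)]
  simp only [ENNReal.toReal_ofNat, Real.rpow_ofNat]
  rw [ENNReal.toReal_ofReal (Real.rpow_nonneg h0 _), ← Real.rpow_natCast, ← Real.rpow_mul h0]
  norm_num

/-- The Cauchy–Schwarz inequality, read off from the nonnegative integral of ((b - a)u - M)². -/
theorem sq_integral_le {u : ℝ → ℝ} {a b : ℝ} (hab : a ≤ b)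
    (hu : IntervalIntegrable u volume a b)
    (hu2 : IntervalIntegrable (fun s => u s ^ 2) volume a b) :
    (∫ s in a..b, u s) ^ 2 ≤ (b - a) * ∫ s in a..b, u s ^ 2 := by
  set M := ∫ s in a..b, u s with hM
  have h1 : 0 ≤ ∫ s in a..b, ((b - a) * u s - M) ^ 2 :=
    intervalIntegral.integral_nonneg hab fun s _ => sq_nonneg _
  have h2 : ∫ s in a..b, ((b - a) * u s - M) ^ 2 =
      (b - a) ^ 2 * (∫ s in a..b, u s ^ 2) - 2 * (b - a) * M * M + (b - a) * M ^ 2 := by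
    have h3 : ∀ s, ((b - a) * u s - M) ^ 2 =
        (b - a) ^ 2 * u s ^ 2 - 2 * (b - a) * M * u s + M ^ 2 := fun s => by ring
    simp only [h3]
    rw [intervalIntegral.integral_add ((hu2.const_mul _).sub (hu.const_mul _)) (by simp),
      intervalIntegral.integral_sub (hu2.const_mul _) (hu.const_mul _),
      intervalIntegral.integral_const_mul, intervalIntegral.integral_const_mul]
    simp [hM]
  rcases hab.eq_or_lt with rfl | h
  · simp [hM]
  · have h4 : 0 ≤ (b - a) * ((b - a) * (∫ s in a..b, u s ^ 2) - M ^ 2) := by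
      calc _ ≤ _ := h1
        _ = _ := by rw [h2]; ring
    have := nonneg_of_mul_nonneg_right h4 (sub_pos.2 h)
    linarith

theorem MeasureTheory.MemLp.intervalIntegrable {E : Type*} [NormedAddCommGroup E] {g : ℝ → E}
    {a b : ℝ} (hab : a ≤ b) (hg : MemLp g 2 (volume.restrict (Ioc a b))) :
    IntervalIntegrable g volume a b :=
  (intervalIntegrable_iff_integrableOn_Ioc_of_le hab).2 (hg.integrable (by norm_num))

theorem MeasureTheory.MemLp.intervalIntegrable_sq {E : Type*} [NormedAddCommGroup E] {g : ℝ → E}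
    {a b : ℝ} (hab : a ≤ b) (hg : MemLp g 2 (volume.restrict (Ioc a b))) :
    IntervalIntegrable (fun s => ‖g s‖ ^ 2) volume a b :=
  (intervalIntegrable_iff_integrableOn_Ioc_of_le hab).2
    ((memLp_two_iff_integrable_sq_norm hg.1).1 hg)

/-- Cauchy–Schwarz in time removes the unimodular phases; Bessel's inequality in `K` is then used at
each fixed time. -/
theorem bessel_orthonormal {K : Type*} [NormedAddCommGroup K] [InnerProductSpace ℂ K] {e : ℕ → K}
    (he : Orthonormal ℂ e) {G : ℝ → K} {a b : ℝ} (hab : a ≤ b)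
    (hG : MemLp G 2 (volume.restrict (Ioc a b))) (A : Finset ℕ) :
    ∑ j ∈ A, ‖∫ s in a..b, phase j s * inner ℂ (e j) (G s)‖ ^ 2 ≤
      (b - a) * ∫ s in a..b, ‖G s‖ ^ 2 := by
  have hm : ∀ j, MemLp (fun s => inner ℂ (e j) (G s)) 2 (volume.restrict (Ioc a b)) :=
    fun j => (innerSL ℂ (e j)).comp_memLp' hG
  have h1 : ∀ j ∈ A, ‖∫ s in a..b, phase j s * inner ℂ (e j) (G s)‖ ^ 2 ≤
      (b - a) * ∫ s in a..b, ‖inner ℂ (e j) (G s)‖ ^ 2 := by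
    intro j _
    refine le_trans ?_ (sq_integral_le hab ((hm j).intervalIntegrable hab).norm
      ((hm j).intervalIntegrable_sq hab))
    refine pow_le_pow_left₀ (norm_nonneg _) ?_ 2
    refine (intervalIntegral.norm_integral_le_integral_norm hab).trans_eq ?_
    refine intervalIntegral.integral_congr fun s _ => ?_
    simp only [norm_mul, norm_phase, one_mul]
  refine (Finset.sum_le_sum h1).trans ?_
  rw [← Finset.mul_sum, ← intervalIntegral.integral_finsetSum
    fun j _ => (hm j).intervalIntegrable_sq hab]
  refine mul_le_mul_of_nonneg_left ?_ (sub_nonneg.2 hab)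
  have hc := IntervalIntegrable.sum (μ := volume) (a := a) (b := b) A
    (f := fun j s => ‖inner ℂ (e j) (G s)‖ ^ 2) (fun j _ => (hm j).intervalIntegrable_sq hab)
  refine intervalIntegral.integral_mono_on hab ?_ (hG.intervalIntegrable_sq hab)
    fun s _ => he.sum_inner_products_le (G s)
  exact hc.congr fun s _ => by simp

/-- The integration runs over N common periods: (λ_k - λ_l) · 2N/π is 2π times an integer, since the
eigenvalues are π² times integers. -/
theorem integral_phase_mul_conj {N : ℕ} (k l : ℕ) :
    ∫ s in (0 : ℝ)..(N * (2 / Real.pi)), phase k s * (starRingEnd ℂ) (phase l s) =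
      if k = l then ((N * (2 / Real.pi) : ℝ) : ℂ) else 0 := by
  have h1 : ∀ s, phase k s * (starRingEnd ℂ) (phase l s) =
      Complex.exp (((eigenvalue k - eigenvalue l : ℝ) * Complex.I) * s) := by
    intro s
    rw [phase, phase, ← Complex.exp_conj, ← Complex.exp_add]
    congr 1
    simp only [map_mul, Complex.conj_ofReal, Complex.conj_I]
    push_cast
    ring
  simp only [h1]
  split_ifs with h
  · simp [h]
  · have hne : eigenvalue k - eigenvalue l ≠ 0 := by
      intro h0
      have h2 := sub_eq_zero.1 h0
      rw [eigenvalue, eigenvalue, pow_left_inj₀ (by positivity) (by positivity) two_ne_zero] at h2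
      have h3 := mul_right_cancel₀ Real.pi_ne_zero h2
      have h4 : k + 1 = l + 1 := by exact_mod_cast h3
      exact h (by omega)
    rw [integral_exp_mul_complex (mul_ne_zero (Complex.ofReal_ne_zero.2 hne) Complex.I_ne_zero)]
    have h5 : ((eigenvalue k - eigenvalue l : ℝ) * Complex.I) *
        ((N * (2 / Real.pi) : ℝ) : ℂ) =
        (((N : ℤ) * (((k + 1 : ℕ) : ℤ) ^ 2 - ((l + 1 : ℕ) : ℤ) ^ 2) : ℤ) : ℂ) *
          (2 * Real.pi * Complex.I) := by
      have hp : (Real.pi : ℂ) ≠ 0 := Complex.ofReal_ne_zero.2 Real.pi_ne_zero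
      rw [eigenvalue, eigenvalue]
      push_cast
      field_simp
    rw [h5, Complex.exp_int_mul_two_pi_mul_I]
    simp

/-- The Bessel inequality for the functions `e^{iλ_k t}`, which are orthogonal over their common
period `2/π`. -/
theorem bessel_phase (T : ℝ) : ∃ C : ℝ, 0 ≤ C ∧ ∀ (g : ℝ → ℂ) (a b : ℝ), 0 ≤ a → a ≤ b → b ≤ T →
    MemLp g 2 (volume.restrict (Ioc a b)) → ∀ A : Finset ℕ,
      ∑ j ∈ A, ‖∫ s in a..b, phase j s * g s‖ ^ 2 ≤ C * ∫ s in a..b, ‖g s‖ ^ 2 := by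
  -- N whole periods cover [0,T]; the additional one keeps `P` positive even when T ≤ 0.
  obtain ⟨n, hn⟩ := exists_nat_ge (T * Real.pi / 2)
  set N := n + 1
  set P : ℝ := N * (2 / Real.pi) with hP
  have hPpos : 0 < P := by
    have : (0 : ℝ) < N := by positivity
    have := Real.pi_pos
    positivity
  have hTP : T ≤ P := by
    have h2 : T * Real.pi / 2 ≤ N := by
      refine hn.trans ?_
      simp [N]
    rw [hP]
    have := Real.pi_pos
    field_simp
    linarith
  set μ := (volume : Measure ℝ).restrict (Ioc 0 P)
  -- The conjugate is normalised, so that the inner product, conjugate linear in its first argument,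
  -- yields `phase j` itself.
  have hme : ∀ j, MemLp (fun s => (((√P)⁻¹ : ℝ) : ℂ) * (starRingEnd ℂ) (phase j s)) 2 μ := by
    intro j
    refine MemLp.of_bound (C := (√P)⁻¹) ?_ (ae_of_all _ fun s => ?_)
    · exact (continuous_const.mul (Complex.continuous_conj.comp
        (continuous_phase j))).aestronglyMeasurable
    · rw [norm_mul, Complex.norm_real, RCLike.norm_conj, norm_phase, mul_one, Real.norm_of_nonneg
        (by positivity)]
  set e : ℕ → Lp ℂ 2 μ := fun j => (hme j).toLp
  have hinner : ∀ (j : ℕ) (f : Lp ℂ 2 μ), inner ℂ (e j) f =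
      (((√P)⁻¹ : ℝ) : ℂ) * ∫ s in (0 : ℝ)..P, phase j s * f s := by
    intro j f
    rw [L2.inner_def, ← intervalIntegral.integral_const_mul,
      intervalIntegral.integral_of_le hPpos.le]
    refine integral_congr_ae ?_
    filter_upwards [(hme j).coeFn_toLp] with s hs
    rw [hs]
    simp only [RCLike.inner_apply, map_mul, Complex.conj_ofReal, Complex.conj_conj]
    ring
  have he : Orthonormal ℂ e := by
    rw [orthonormal_iff_ite]
    intro k l
    rw [hinner]
    have h1 : ∫ s in (0 : ℝ)..P, phase k s * e l s =
        (((√P)⁻¹ : ℝ) : ℂ) * ∫ s in (0 : ℝ)..P, phase k s * (starRingEnd ℂ) (phase l s) := by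
      rw [← intervalIntegral.integral_const_mul]
      rw [intervalIntegral.integral_of_le hPpos.le, intervalIntegral.integral_of_le hPpos.le]
      refine integral_congr_ae ?_
      filter_upwards [(hme l).coeFn_toLp] with s hs
      rw [hs]
      ring
    rw [h1, integral_phase_mul_conj]
    split_ifs
    · rw [← hP, ← Complex.ofReal_mul, ← Complex.ofReal_mul, ← mul_assoc, ← mul_inv,
        Real.mul_self_sqrt hPpos.le, inv_mul_cancel₀ hPpos.ne', Complex.ofReal_one]
    · simp
  refine ⟨P, hPpos.le, fun g a b ha hab hb hg A => ?_⟩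
  have hsub : Ioc a b ⊆ Ioc 0 P := Ioc_subset_Ioc ha (hb.trans hTP)
  -- Orthogonality holds only over whole periods, hence g is extended by zero to (0, P].
  have hg' : MemLp ((Ioc a b).indicator g) 2 μ := by
    rw [memLp_indicator_iff_restrict measurableSet_Ioc, Measure.restrict_restrict measurableSet_Ioc,
      inter_eq_left.2 hsub]
    exact hg
  set G' : Lp ℂ 2 μ := hg'.toLp with hG'
  have h1 : ∀ j, ∫ s in a..b, phase j s * g s = ((√P : ℝ) : ℂ) * inner ℂ (e j) G' := by
    intro j
    rw [hinner, ← mul_assoc, ← Complex.ofReal_mul, mul_inv_cancel₀ (Real.sqrt_pos.2 hPpos).ne',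
      Complex.ofReal_one, one_mul, intervalIntegral.integral_of_le hPpos.le,
      intervalIntegral.integral_of_le hab]
    have h2 : ∫ s in Ioc 0 P, phase j s * G' s =
        ∫ s in Ioc 0 P, (Ioc a b).indicator (fun s => phase j s * g s) s := by
      refine integral_congr_ae ?_
      filter_upwards [hg'.coeFn_toLp] with s hs
      rw [hs, indicator_mul_right]
    rw [h2, setIntegral_indicator measurableSet_Ioc, inter_eq_right.2 hsub]
  have h3 : ∑ j ∈ A, ‖∫ s in a..b, phase j s * g s‖ ^ 2 =
      P * ∑ j ∈ A, ‖(inner ℂ (e j) G' : ℂ)‖ ^ 2 := by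
    rw [Finset.mul_sum]
    refine Finset.sum_congr rfl fun j _ => ?_
    rw [h1, norm_mul, mul_pow, Complex.norm_real, Real.norm_of_nonneg (Real.sqrt_nonneg _),
      Real.sq_sqrt hPpos.le]
  have h4 : ‖G'‖ ^ 2 = ∫ s in a..b, ‖g s‖ ^ 2 := by
    rw [L2.norm_sq_eq_integral, intervalIntegral.integral_of_le hab]
    have h2 : ∫ s, ‖G' s‖ ^ 2 ∂μ =
        ∫ s in Ioc 0 P, (Ioc a b).indicator (fun s => ‖g s‖ ^ 2) s := by
      refine integral_congr_ae ?_
      filter_upwards [hg'.coeFn_toLp] with s hs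
      rw [hs]
      by_cases hs' : s ∈ Ioc a b
      · simp [hs']
      · simp [hs']
    rw [h2, setIntegral_indicator measurableSet_Ioc, inter_eq_right.2 hsub]
  rw [h3, ← h4]
  exact mul_le_mul_of_nonneg_left (he.sum_inner_products_le _) hPpos.le

theorem norm_sub_sub_sq_le {E : Type*} [NormedAddCommGroup E] (x y z : E) :
    ‖x - y - z‖ ^ 2 ≤ 3 * (‖x‖ ^ 2 + ‖y‖ ^ 2 + ‖z‖ ^ 2) := by
  have h1 : ‖x - y - z‖ ≤ ‖x‖ + ‖y‖ + ‖z‖ :=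
    (norm_sub_le _ _).trans (add_le_add_left (norm_sub_le _ _) _)
  have h2 := pow_le_pow_left₀ (norm_nonneg _) h1 2
  nlinarith [sq_nonneg (‖x‖ - ‖y‖), sq_nonneg (‖x‖ - ‖z‖), sq_nonneg (‖y‖ - ‖z‖)]

/-- The smoothing estimate: sources in `L²(0,T; H³)` give coefficients in `ℓ²` although the source
does not satisfy the boundary conditions of `D(A^{3/2})`. -/
theorem smoothing_estimate (T : ℝ) (hT : 0 ≤ T) : ∃ C : ℝ, 0 ≤ C ∧ ∀ (F : ℝ → Y) (a b : ℝ),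
    0 ≤ a → a ≤ b → b ≤ T → MemLp F 2 (volume.restrict (Ioc a b)) → ∀ A : Finset ℕ,
      ∑ j ∈ A, ‖∫ s in a..b, phase j s * tau j (F s)‖ ^ 2 ≤ C * ∫ s in a..b, ‖F s‖ ^ 2 := by
  obtain ⟨C, hC0, hC⟩ := bessel_phase T
  set β : Y →L[ℂ] ℂ := (ContinuousMap.evalCLM ℂ (1 : Icc (0 : ℝ) 1)).comp Y.c2 with hβ
  -- The 3 comes from splitting `tau` into three terms, each 2 from |√2|², and the operator norms
  -- from bounding each term by F.
  refine ⟨3 * (2 * (C * ‖β‖ ^ 2) + 2 * (C * ‖Y.a2‖ ^ 2) + T * ‖Y.d3‖ ^ 2), by positivity,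
    fun F a b ha hab hb hF A => ?_⟩
  have hcomp : ∀ {E : Type} [NormedAddCommGroup E] [NormedSpace ℂ E] (L : Y →L[ℂ] E),
      MemLp (fun s => L (F s)) 2 (volume.restrict (Ioc a b)) := fun L => L.comp_memLp' hF
  have hle : ∀ {E : Type} [NormedAddCommGroup E] [NormedSpace ℂ E] (L : Y →L[ℂ] E),
      ∫ s in a..b, ‖L (F s)‖ ^ 2 ≤ ‖L‖ ^ 2 * ∫ s in a..b, ‖F s‖ ^ 2 := by
    intro E _ _ L
    rw [← intervalIntegral.integral_const_mul]
    refine intervalIntegral.integral_mono_on hab ((hcomp L).intervalIntegrable_sq hab)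
      ((hF.intervalIntegrable_sq hab).const_mul _) fun s _ => ?_
    rw [← mul_pow]
    exact pow_le_pow_left₀ (norm_nonneg _) (L.le_opNorm _) 2
  have hphase : ∀ (j : ℕ) (L : Y →L[ℂ] ℂ),
      IntervalIntegrable (fun s => phase j s * L (F s)) volume a b := fun j L =>
    ((hcomp L).intervalIntegrable hab).continuousOn_mul (continuous_phase j).continuousOn
  have h1 : ∀ j, ∫ s in a..b, phase j s * tau j (F s) =
      ((√2 : ℂ) * (-1) ^ (j + 1)) * (∫ s in a..b, phase j s * β (F s)) -
      (√2 : ℂ) * (∫ s in a..b, phase j s * Y.a2 (F s)) -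
      ∫ s in a..b, phase j s * inner ℂ (cosMode (j + 1)) (Y.d3 (F s)) := by
    intro j
    have h2 : IntervalIntegrable (fun s => phase j s * inner ℂ (cosMode (j + 1)) (Y.d3 (F s)))
        volume a b := hphase j ((innerSL ℂ (cosMode (j + 1))).comp Y.d3)
    rw [← intervalIntegral.integral_const_mul, ← intervalIntegral.integral_const_mul,
      ← intervalIntegral.integral_sub ((hphase j β).const_mul _) ((hphase j Y.a2).const_mul _),
      ← intervalIntegral.integral_sub
        (((hphase j β).const_mul _).sub ((hphase j Y.a2).const_mul _)) h2]
    refine intervalIntegral.integral_congr fun s _ => ?_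
    simp only [tau_apply, hβ, ContinuousLinearMap.comp_apply, ContinuousMap.evalCLM_apply]
    ring
  have hs2 : ‖(√2 : ℂ)‖ ^ 2 = 2 := by
    rw [Complex.norm_real, Real.norm_of_nonneg (Real.sqrt_nonneg _), Real.sq_sqrt (by norm_num)]
  have h3 : ∀ j ∈ A, ‖∫ s in a..b, phase j s * tau j (F s)‖ ^ 2 ≤
      3 * (2 * ‖∫ s in a..b, phase j s * β (F s)‖ ^ 2 +
        2 * ‖∫ s in a..b, phase j s * Y.a2 (F s)‖ ^ 2 +
        ‖∫ s in a..b, phase j s * inner ℂ (cosMode (j + 1)) (Y.d3 (F s))‖ ^ 2) := by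
    intro j _
    rw [h1]
    refine (norm_sub_sub_sq_le _ _ _).trans_eq ?_
    rw [norm_mul, norm_mul, norm_mul, norm_pow, norm_neg, norm_one, one_pow, mul_one, mul_pow,
      mul_pow, hs2]
  refine (Finset.sum_le_sum h3).trans ?_
  rw [← Finset.mul_sum, Finset.sum_add_distrib, Finset.sum_add_distrib, ← Finset.mul_sum,
    ← Finset.mul_sum]
  -- The two boundary terms are the same scalar function for all j, up to a unimodular factor, so
  -- only orthogonality in time can make their coefficients square summable. The third term uses the
  -- orthonormal cosines in space.
  have e1 := (hC _ a b ha hab hb (hcomp β) A).trans (mul_le_mul_of_nonneg_left (hle β) hC0)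
  have e2 := (hC _ a b ha hab hb (hcomp Y.a2) A).trans (mul_le_mul_of_nonneg_left (hle Y.a2) hC0)
  have e3 := (bessel_orthonormal orthonormal_cosMode hab (hcomp Y.d3) A).trans
    (mul_le_mul (by linarith : b - a ≤ T) (hle Y.d3)
      (intervalIntegral.integral_nonneg hab fun s _ => sq_nonneg _) hT)
  calc _ ≤ 3 * (2 * (C * (‖β‖ ^ 2 * ∫ s in a..b, ‖F s‖ ^ 2)) +
        2 * (C * (‖Y.a2‖ ^ 2 * ∫ s in a..b, ‖F s‖ ^ 2)) +
        T * (‖Y.d3‖ ^ 2 * ∫ s in a..b, ‖F s‖ ^ 2)) := by linarith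
    _ = _ := by ring

/-! ### Duhamel's formula for `A_V` in terms of sine coefficients -/

theorem norm_sq_le_of_sum_sineCoeff {f : L2I} {B : ℝ}
    (h : ∀ A : Finset ℕ, ∑ j ∈ A, ‖sineCoeff (j + 1) f‖ ^ 2 ≤ B) : ‖f‖ ^ 2 ≤ B := by
  have hB : 0 ≤ B := by simpa using h ∅
  have h1 : ‖sineBasis.repr f‖ ≤ √B := by
    refine lp.norm_le_of_forall_sum_le (by norm_num) (Real.sqrt_nonneg _) fun A => ?_
    simp only [sineBasis_repr, ENNReal.toReal_ofNat, Real.rpow_ofNat, Real.sq_sqrt hB]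
    exact h A
  rw [LinearIsometryEquiv.norm_map] at h1
  calc ‖f‖ ^ 2 ≤ √B ^ 2 := pow_le_pow_left₀ (norm_nonneg _) h1 2
    _ = B := Real.sq_sqrt hB

/-- Bessel's inequality gives ‖d(t)‖² ≤ T ‖W‖² ∫₀ᵗ ‖d‖², W acting by multiplication. Grönwall's
inequality with a = 0 finishes: the homogeneous equation has only the zero solution in L². -/
theorem eq_zero_of_phase_mul_sineCoeff {W : CI} {d : ℝ → L2I} {T : ℝ}
    (hd : ContinuousOn d (Icc 0 T))
    (h : ∀ t ∈ Icc 0 T, ∀ j, phase j t * sineCoeff (j + 1) (d t) =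
      -Complex.I * ∫ s in (0 : ℝ)..t, phase j s * sineCoeff (j + 1) (mulL2 W (d s)))
    {t : ℝ} (ht : t ∈ Icc 0 T) : d t = 0 := by
  have hT : 0 ≤ T := ht.1.trans ht.2
  have hc : ContinuousOn (fun s => ‖d s‖ ^ 2) (Icc 0 T) := hd.norm.pow 2
  have key := gronwall_integrable (m := fun _ => T * ‖mulL2 W‖ ^ 2) (v := fun s => ‖d s‖ ^ 2)
    (T := T) (a := 0) (by simp) (fun _ => by positivity) le_rfl hc (fun t ht => ?_) t ht
  · rw [zero_mul] at key
    simpa using le_antisymm key (sq_nonneg _)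
  · rw [zero_add]
    have hsub : Icc 0 t ⊆ Icc 0 T := Icc_subset_Icc_right ht.2
    have hW : ContinuousOn (fun s => mulL2 W (d s)) (Icc 0 t) :=
      (mulL2 W).continuous.comp_continuousOn (hd.mono hsub)
    have hm : MemLp (fun s => mulL2 W (d s)) 2 (volume.restrict (Ioc 0 t)) := by
      obtain ⟨B, hB⟩ := isCompact_Icc.exists_bound_of_continuousOn hW
      refine MemLp.of_bound (C := B) ((hW.mono Ioc_subset_Icc_self).aestronglyMeasurable
        measurableSet_Ioc) ?_
      filter_upwards [ae_restrict_mem measurableSet_Ioc] with s hs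
      exact hB s (Ioc_subset_Icc_self hs)
    refine norm_sq_le_of_sum_sineCoeff fun A => ?_
    have h1 := bessel_orthonormal orthonormal_dirichletMode ht.1 hm A
    have h2 : ∀ j, ‖sineCoeff (j + 1) (d t)‖ =
        ‖∫ s in (0 : ℝ)..t, phase j s * inner ℂ (dirichletMode (j + 1)) (mulL2 W (d s))‖ := by
      intro j
      have h3 := congrArg norm (h t ht j)
      rw [norm_mul, norm_phase, one_mul, norm_mul, norm_neg, Complex.norm_I, one_mul] at h3
      exact h3
    simp only [h2]
    refine h1.trans ?_
    rw [sub_zero, ← intervalIntegral.integral_const_mul]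
    refine intervalIntegral.integral_mono_on ht.1 ((hm.intervalIntegrable_sq ht.1).const_mul _) ?_
      fun s hs => ?_
    · refine ContinuousOn.intervalIntegrable ?_
      rw [uIcc_of_le ht.1]
      exact continuousOn_const.mul (hc.mono hsub)
    · have h4 := pow_le_pow_left₀ (norm_nonneg _) ((mulL2 W).le_opNorm (d s)) 2
      rw [mul_pow] at h4
      calc t * ‖mulL2 W (d s)‖ ^ 2 ≤ T * (‖mulL2 W‖ ^ 2 * ‖d s‖ ^ 2) :=
            mul_le_mul ht.2 h4 (sq_nonneg _) hT
        _ = _ := by ring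

theorem H30.continuous_toL2 : Continuous H30.toL2 :=
  (Y.toL2.continuous.comp H30.toY.continuous).congr H30.toL2_toY

/-- Given the group generated by `-i A_V`, solutions are characterised by their sine
coefficients. -/
theorem isDuhamelSolution_iff {V : ℝ → ℝ} {U : ℝ → L2I →L[ℂ] L2I} {W : CI}
    (hU : IsSchrodingerGroup V U) (hW : IsRestriction V W) {T : ℝ} (hT : 0 ≤ T) (ξ₀ : H30)
    (F : ℝ → L2I) (ξ : C(Icc (0 : ℝ) T, H30)) :
    IsDuhamelSolution V ξ₀ F ξ ↔ IntervalIntegrable F volume 0 T ∧ ∀ t : Icc (0 : ℝ) T, ∀ j,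
      phase j t * sineCoeff (j + 1) (ξ t).toL2 = sineCoeff (j + 1) ξ₀.toL2 -
        Complex.I * ∫ s in (0 : ℝ)..t, phase j s *
          sineCoeff (j + 1) (F s + mulL2 W (IccExtend hT ξ s).toL2) := by
  refine and_congr_right fun hF => ⟨?_, ?_⟩
  -- The coefficient identity holds for every group `U'` with this generator and does not mention
  -- it, so uniqueness of the group is not required.
  · rintro ⟨U', hU', h⟩ t j
    have h1 := hU'.phase_mul_sineCoeff_duhamel hW hF ξ₀.toL2 t.2 j
    have h2 : ∀ t : Icc (0 : ℝ) T, (ξ t).toL2 = duhamel U' ξ₀.toL2 F t := h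
    rw [h2, h1]
    congr 2
    refine intervalIntegral.integral_congr fun s hs => ?_
    rw [uIcc_of_le t.2.1] at hs
    rw [IccExtend_of_mem hT ξ ⟨hs.1, hs.2.trans t.2.2⟩, h2]
  · intro h
    refine ⟨U, hU, fun t => ?_⟩
    have hc : ContinuousOn (duhamel U ξ₀.toL2 F) (Icc 0 T) := hU.continuousOn_duhamel hT hF _
    have hξ : Continuous fun s => (IccExtend hT ξ s).toL2 :=
      H30.continuous_toL2.comp ξ.continuous.Icc_extend'
    -- The curve and the Duhamel expression satisfy the same coefficient equation; their difference
    -- solves the homogeneous one.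
    have h1 := eq_zero_of_phase_mul_sineCoeff (W := W)
      (d := fun s => (IccExtend hT ξ s).toL2 - duhamel U ξ₀.toL2 F s) (hξ.continuousOn.sub hc)
      (fun t ht j => ?_) t.2
    · rw [IccExtend_val] at h1
      exact sub_eq_zero.1 h1
    · have e1 := h ⟨t, ht⟩ j
      have e2 := hU.phase_mul_sineCoeff_duhamel hW hF ξ₀.toL2 ht j
      simp only [← sineCoeffL_apply, map_sub, map_add] at e1 e2 ⊢
      rw [IccExtend_of_mem hT ξ ht, mul_sub, e1, e2]
      have hFt : IntervalIntegrable F volume 0 t := by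
        refine hF.mono_set ?_
        rw [uIcc_of_le ht.1, uIcc_of_le hT]
        exact Icc_subset_Icc_right ht.2
      set L := sineCoeffL (j + 1)
      have i1 : IntervalIntegrable (fun s => phase j s * L (F s)) volume 0 t := by
        have : IntervalIntegrable (fun s => L (F s)) volume 0 t :=
          ⟨L.integrable_comp hFt.1, L.integrable_comp hFt.2⟩
        exact this.continuousOn_mul (continuous_phase j).continuousOn
      have i2 : IntervalIntegrable
          (fun s => phase j s * L (mulL2 W (IccExtend hT ξ s).toL2)) volume 0 t :=
        Continuous.intervalIntegrable ((continuous_phase j).mul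
          (L.continuous.comp ((mulL2 W).continuous.comp hξ))) _ _
      have i3 : IntervalIntegrable
          (fun s => phase j s * L (mulL2 W (duhamel U ξ₀.toL2 F s))) volume 0 t := by
        refine ContinuousOn.intervalIntegrable ?_
        rw [uIcc_of_le ht.1]
        exact (continuous_phase j).continuousOn.mul (L.continuous.comp_continuousOn
          ((mulL2 W).continuous.comp_continuousOn (hc.mono (Icc_subset_Icc_right ht.2))))
      simp only [mul_add, mul_sub]
      rw [intervalIntegral.integral_add i1 i2, intervalIntegral.integral_add i1 i3,
        intervalIntegral.integral_sub i2 i3]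
      ring

end

noncomputable section

/-! ### The free flow on `H³_{(0)}` -/

namespace H30

theorem norm_sq_le_of_sum_coeffs {f : H30} {B : ℝ}
    (h : ∀ A : Finset ℕ, ∑ j ∈ A, ‖coeffs f j‖ ^ 2 ≤ B) : ‖f‖ ^ 2 ≤ B := by
  have hB : 0 ≤ B := by simpa using h ∅
  have h1 : ‖coeffs f‖ ≤ √B := by
    refine lp.norm_le_of_forall_sum_le (by norm_num) (Real.sqrt_nonneg _) fun A => ?_
    simp only [ENNReal.toReal_ofNat, Real.rpow_ofNat, Real.sq_sqrt hB]
    exact h A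
  calc ‖f‖ ^ 2 ≤ √B ^ 2 := pow_le_pow_left₀ (norm_nonneg _) h1 2
    _ = B := Real.sq_sqrt hB

theorem exists_of_sum_le {c : ℕ → ℂ} {B : ℝ} (h : ∀ A : Finset ℕ, ∑ j ∈ A, ‖c j‖ ^ 2 ≤ B) :
    ∃ f : H30, ∀ j, coeffs f j = c j := by
  have hc : Memℓp c 2 := memℓp_gen' (C := B) fun A => by
    simpa only [ENNReal.toReal_ofNat, Real.rpow_ofNat] using h A
  obtain ⟨f, hf⟩ := coeffs_surjective ⟨c, hc⟩
  exact ⟨f, fun j => by rw [hf]⟩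

theorem sum_coeffs_le (f : H30) (A : Finset ℕ) : ∑ j ∈ A, ‖coeffs f j‖ ^ 2 ≤ ‖f‖ ^ 2 := by
  have h := lp.sum_rpow_le_norm_rpow (p := 2) (by norm_num) (coeffs f) A
  have h2 : ‖coeffs f‖ = ‖f‖ := rfl
  simpa only [ENNReal.toReal_ofNat, Real.rpow_ofNat, h2] using h

theorem coeffs_add_apply (f g : H30) (j : ℕ) : coeffs (f + g) j = coeffs f j + coeffs g j := by
  rw [map_add]; rfl

theorem coeffs_sub_apply (f g : H30) (j : ℕ) : coeffs (f - g) j = coeffs f j - coeffs g j := by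
  rw [map_sub]; rfl

theorem coeffs_smul_apply (c : ℂ) (f : H30) (j : ℕ) : coeffs (c • f) j = c * coeffs f j := by
  rw [map_smul]; rfl

theorem exists_freeFlow (t : ℝ) (f : H30) :
    ∃ g : H30, ∀ j, coeffs g j = phase j (-t) * coeffs f j :=
  exists_of_sum_le (B := ‖f‖ ^ 2) fun A => by
    simpa only [norm_mul, norm_phase, one_mul] using sum_coeffs_le f A

/-- `e^{-iAt}` on `H³_{(0)}`. -/
def freeFlow (t : ℝ) : H30 →ₗ[ℂ] H30 where
  toFun f := (exists_freeFlow t f).choose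
  map_add' f g := ext_coeffs fun j => by
    rw [(exists_freeFlow t (f + g)).choose_spec, coeffs_add_apply, coeffs_add_apply,
      (exists_freeFlow t f).choose_spec, (exists_freeFlow t g).choose_spec, mul_add]
  map_smul' c f := ext_coeffs fun j => by
    rw [(exists_freeFlow t (c • f)).choose_spec, coeffs_smul_apply, RingHom.id_apply,
      coeffs_smul_apply, (exists_freeFlow t f).choose_spec]
    ring

theorem coeffs_freeFlow (t : ℝ) (f : H30) (j : ℕ) :
    coeffs (freeFlow t f) j = phase j (-t) * coeffs f j := (exists_freeFlow t f).choose_spec j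

theorem norm_freeFlow_le (t : ℝ) (f : H30) : ‖freeFlow t f‖ ≤ ‖f‖ := by
  refine le_of_sq_le_sq ?_ (norm_nonneg _)
  refine norm_sq_le_of_sum_coeffs fun A => ?_
  simpa only [coeffs_freeFlow, norm_mul, norm_phase, one_mul] using sum_coeffs_le f A

theorem norm_sq_eq_tsum_coeffs (f : H30) : ‖f‖ ^ 2 = ∑' j, ‖coeffs f j‖ ^ 2 := by
  have h := lp.norm_rpow_eq_tsum (p := 2) (by norm_num) (coeffs f)
  have h2 : ‖coeffs f‖ = ‖f‖ := rfl
  simpa only [ENNReal.toReal_ofNat, Real.rpow_ofNat, h2] using h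

theorem summable_coeffs (f : H30) : Summable fun j => ‖coeffs f j‖ ^ 2 :=
  summable_of_sum_le (fun _ => sq_nonneg _) (sum_coeffs_le f)

/-- Each coefficient is continuous in time, and the phases being unimodular, the series of squares
is dominated by 4 ∑ |c_j|². -/
theorem continuous_freeFlow_left (f : H30) : Continuous fun t => freeFlow t f := by
  rw [continuous_iff_continuousAt]
  intro t
  rw [ContinuousAt, tendsto_iff_norm_sub_tendsto_zero]
  have h1 : Tendsto (fun s => ‖freeFlow s f - freeFlow t f‖ ^ 2) (𝓝 t) (𝓝 0) := by
    have h2 : ∀ s, ‖freeFlow s f - freeFlow t f‖ ^ 2 =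
        ∑' j, ‖(phase j (-s) - phase j (-t)) * coeffs f j‖ ^ 2 := by
      intro s
      rw [norm_sq_eq_tsum_coeffs]
      refine tsum_congr fun j => ?_
      rw [coeffs_sub_apply, coeffs_freeFlow, coeffs_freeFlow, sub_mul]
    simp only [h2]
    have h3 := tendsto_tsum_of_dominated_convergence (𝓕 := 𝓝 t)
      (f := fun s j => ‖(phase j (-s) - phase j (-t)) * coeffs f j‖ ^ 2) (g := fun _ => 0)
      (bound := fun j => 4 * ‖coeffs f j‖ ^ 2) ((summable_coeffs f).mul_left 4) (fun j => ?_) ?_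
    · simpa using h3
    · have hc : Continuous fun s => ‖(phase j (-s) - phase j (-t)) * coeffs f j‖ ^ 2 :=
        ((((continuous_phase j).comp continuous_neg).sub continuous_const).mul
          continuous_const).norm.pow 2
      have := hc.tendsto t
      simpa using this
    · refine Eventually.of_forall fun s j => ?_
      rw [norm_pow, norm_norm, norm_mul, mul_pow]
      refine mul_le_mul_of_nonneg_right ?_ (sq_nonneg _)
      have h4 : ‖phase j (-s) - phase j (-t)‖ ≤ 2 := by
        refine (norm_sub_le _ _).trans ?_
        rw [norm_phase, norm_phase]
        norm_num
      calc _ ≤ (2 : ℝ) ^ 2 := pow_le_pow_left₀ (norm_nonneg _) h4 2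
        _ = 4 := by norm_num
  have h5 := h1.sqrt
  simpa [Real.sqrt_sq (norm_nonneg _)] using h5

theorem continuous_freeFlow : Continuous fun p : ℝ × H30 => freeFlow p.1 p.2 := by
  rw [continuous_iff_continuousAt]
  rintro ⟨t, f⟩
  rw [ContinuousAt, tendsto_iff_norm_sub_tendsto_zero]
  have h1 : Continuous fun p : ℝ × H30 => ‖p.2 - f‖ + ‖freeFlow p.1 f - freeFlow t f‖ :=
    (continuous_snd.sub continuous_const).norm.add
      (((continuous_freeFlow_left f).comp continuous_fst).sub continuous_const).norm
  have h2 := h1.tendsto (t, f)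
  simp only [sub_self, norm_zero, add_zero] at h2
  refine squeeze_zero (fun _ => norm_nonneg _) (fun p => ?_) h2
  have h3 : freeFlow p.1 p.2 - freeFlow t f =
      freeFlow p.1 (p.2 - f) + (freeFlow p.1 f - freeFlow t f) := by
    rw [map_sub]; abel
  rw [h3]
  exact (norm_add_le _ _).trans (add_le_add_left (norm_freeFlow_le _ _) _)

/-- The free evolution of the initial state. -/
def freeEvolution (T : ℝ) : H30 →L[ℝ] C(Icc (0 : ℝ) T, H30) :=
  LinearMap.mkContinuous
    { toFun := fun f => ⟨fun t => freeFlow t f,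
        (continuous_freeFlow_left f).comp continuous_subtype_val⟩
      map_add' := fun f g => ContinuousMap.ext fun t => map_add (freeFlow t) f g
      map_smul' := fun c f => ContinuousMap.ext fun t => (freeFlow t).map_smul_of_tower c f }
    1 (fun f => by
      rw [one_mul, ContinuousMap.norm_le _ (norm_nonneg _)]
      exact fun t => norm_freeFlow_le t f)

theorem freeEvolution_apply (T : ℝ) (f : H30) (t : Icc (0 : ℝ) T) :
    freeEvolution T f t = freeFlow t f := rfl

end H30

/-! ### The Duhamel operator -/

/-- Lebesgue measure on `[0,T]`. -/
abbrev volT (T : ℝ) : Measure ℝ := volume.restrict (Icc (0 : ℝ) T)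

section Duhamel

variable {T : ℝ} (hT : 0 ≤ T)

/-- The constant of the smoothing estimate. -/
def smoothingConst : ℝ := (smoothing_estimate T hT).choose

theorem smoothingConst_nonneg : 0 ≤ smoothingConst hT := (smoothing_estimate T hT).choose_spec.1

theorem memLp_Ioc {E : Type*} [NormedAddCommGroup E] {F : ℝ → E} (hF : MemLp F 2 (volT T)) {a b : ℝ}
    (ha : 0 ≤ a) (hb : b ≤ T) : MemLp F 2 (volume.restrict (Ioc a b)) :=
  hF.mono_measure (Measure.restrict_mono (Ioc_subset_Icc_self.trans (Icc_subset_Icc ha hb)) le_rfl)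

theorem smoothing_le {F : ℝ → Y} (hF : MemLp F 2 (volT T)) {a b : ℝ} (ha : 0 ≤ a) (hab : a ≤ b)
    (hb : b ≤ T) (A : Finset ℕ) :
    ∑ j ∈ A, ‖∫ s in a..b, phase j s * tau j (F s)‖ ^ 2 ≤
      smoothingConst hT * ∫ s in a..b, ‖F s‖ ^ 2 :=
  (smoothing_estimate T hT).choose_spec.2 F a b ha hab hb (memLp_Ioc hF ha hb) A

theorem intervalIntegrable_phase_tau {F : ℝ → Y} (hF : MemLp F 2 (volT T)) {a b : ℝ} (ha : 0 ≤ a)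
    (hab : a ≤ b) (hb : b ≤ T) (j : ℕ) :
    IntervalIntegrable (fun s => phase j s * tau j (F s)) volume a b :=
  (((tau j).comp_memLp' (memLp_Ioc hF ha hb)).intervalIntegrable hab).continuousOn_mul
    (continuous_phase j).continuousOn

theorem intervalIntegrable_norm_sq {E : Type*} [NormedAddCommGroup E] {F : ℝ → E}
    (hF : MemLp F 2 (volT T)) {a b : ℝ} (ha : 0 ≤ a) (hab : a ≤ b) (hb : b ≤ T) :
    IntervalIntegrable (fun s => ‖F s‖ ^ 2) volume a b :=
  (memLp_Ioc hF ha hb).intervalIntegrable_sq hab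

/-- F(s) need not lie in `H30`, so the integral is not formed there. Its coefficients are integrated
separately, and the smoothing estimate makes the result square summable. -/
theorem exists_source (hT : 0 ≤ T) {F : ℝ → Y} (hF : MemLp F 2 (volT T)) (t : Icc (0 : ℝ) T) :
    ∃ f : H30, ∀ j, H30.coeffs f j = -Complex.I * ∫ s in (0 : ℝ)..t, phase j s * tau j (F s) :=
  H30.exists_of_sum_le fun A => by
    simp only [norm_mul, norm_neg, Complex.norm_I, one_mul]
    exact smoothing_le hT hF le_rfl t.2.1 t.2.2 A

/-- The function `-i ∫₀ᵗ e^{iAs} F(s) ds`. -/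
def source {F : ℝ → Y} (hF : MemLp F 2 (volT T)) (t : Icc (0 : ℝ) T) : H30 :=
  (exists_source hT hF t).choose

theorem coeffs_source {F : ℝ → Y} (hF : MemLp F 2 (volT T)) (t : Icc (0 : ℝ) T) (j : ℕ) :
    H30.coeffs (source hT hF t) j = -Complex.I * ∫ s in (0 : ℝ)..t, phase j s * tau j (F s) :=
  (exists_source hT hF t).choose_spec j

theorem norm_source_sq_le {F : ℝ → Y} (hF : MemLp F 2 (volT T)) (t : Icc (0 : ℝ) T) :
    ‖source hT hF t‖ ^ 2 ≤ smoothingConst hT * ∫ s in (0 : ℝ)..t, ‖F s‖ ^ 2 := by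
  refine H30.norm_sq_le_of_sum_coeffs fun A => ?_
  simp only [coeffs_source, norm_mul, norm_neg, Complex.norm_I, one_mul]
  exact smoothing_le hT hF le_rfl t.2.1 t.2.2 A

/-- The increment is the integral over [r, t]. The smoothing estimate covers arbitrary subintervals
for the sake of this bound. -/
theorem norm_source_sub_sq_le {F : ℝ → Y} (hF : MemLp F 2 (volT T)) {r t : Icc (0 : ℝ) T}
    (hrt : r ≤ t) :
    ‖source hT hF t - source hT hF r‖ ^ 2 ≤
      smoothingConst hT * ∫ s in (r : ℝ)..t, ‖F s‖ ^ 2 := by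
  refine H30.norm_sq_le_of_sum_coeffs fun A => ?_
  have h1 : ∀ j, H30.coeffs (source hT hF t - source hT hF r) j =
      -Complex.I * ∫ s in (r : ℝ)..t, phase j s * tau j (F s) := by
    intro j
    rw [H30.coeffs_sub_apply, coeffs_source, coeffs_source,
      ← intervalIntegral.integral_add_adjacent_intervals
      (intervalIntegrable_phase_tau hF le_rfl r.2.1 r.2.2 j)
      (intervalIntegrable_phase_tau hF r.2.1 hrt t.2.2 j)]
    ring
  simp only [h1, norm_mul, norm_neg, Complex.norm_I, one_mul]
  exact smoothing_le hT hF r.2.1 hrt t.2.2 A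

/-- The primitive of ‖F‖² is continuous and controls the squared increments. -/
theorem continuous_source {F : ℝ → Y} (hF : MemLp F 2 (volT T)) : Continuous (source hT hF) := by
  set Φ : Icc (0 : ℝ) T → ℝ := fun t => ∫ s in (0 : ℝ)..t, ‖F s‖ ^ 2 with hΦ
  have hΦc : Continuous Φ := by
    have h1 := intervalIntegral.continuousOn_primitive_interval'
      (intervalIntegrable_norm_sq hF le_rfl hT le_rfl) left_mem_uIcc
    rw [uIcc_of_le hT] at h1
    exact continuousOn_iff_continuous_domRestrict.1 h1
  have hle : ∀ r t : Icc (0 : ℝ) T, r ≤ t → ‖source hT hF t - source hT hF r‖ ^ 2 ≤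
      smoothingConst hT * |Φ t - Φ r| := by
    intro r t hrt
    refine (norm_source_sub_sq_le hT hF hrt).trans
      (mul_le_mul_of_nonneg_left ?_ (smoothingConst_nonneg hT))
    refine le_trans (le_of_eq ?_) (le_abs_self _)
    simp only [hΦ]
    rw [← intervalIntegral.integral_add_adjacent_intervals
      (intervalIntegrable_norm_sq hF le_rfl r.2.1 r.2.2)
      (intervalIntegrable_norm_sq hF r.2.1 hrt t.2.2)]
    ring
  have hle' : ∀ r t : Icc (0 : ℝ) T, ‖source hT hF t - source hT hF r‖ ≤
      √(smoothingConst hT * |Φ t - Φ r|) := by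
    intro r t
    refine Real.le_sqrt_of_sq_le ?_
    rcases le_total r t with h | h
    · exact hle r t h
    · rw [norm_sub_rev, abs_sub_comm]
      exact hle t r h
  rw [continuous_iff_continuousAt]
  intro r
  rw [ContinuousAt, tendsto_iff_norm_sub_tendsto_zero]
  refine squeeze_zero (fun _ => norm_nonneg _) (fun t => hle' r t) ?_
  have h2 : Continuous fun t => √(smoothingConst hT * |Φ t - Φ r|) :=
    (continuous_const.mul (hΦc.sub continuous_const).abs).sqrt
  have h3 := h2.tendsto r
  simpa using h3

theorem source_congr {F G : ℝ → Y} (hF : MemLp F 2 (volT T)) (hG : MemLp G 2 (volT T))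
    (h : F =ᵐ[volT T] G) (t : Icc (0 : ℝ) T) : source hT hF t = source hT hG t := by
  refine H30.ext_coeffs fun j => ?_
  rw [coeffs_source, coeffs_source, intervalIntegral.integral_of_le t.2.1,
    intervalIntegral.integral_of_le t.2.1]
  congr 1
  refine integral_congr_ae ?_
  filter_upwards [ae_restrict_of_ae_restrict_of_subset
    (Ioc_subset_Icc_self.trans (Icc_subset_Icc_right t.2.2)) h] with s hs
  rw [hs]

theorem source_add {F G : ℝ → Y} (hF : MemLp F 2 (volT T)) (hG : MemLp G 2 (volT T))
    (t : Icc (0 : ℝ) T) : source hT (hF.add hG) t = source hT hF t + source hT hG t := by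
  refine H30.ext_coeffs fun j => ?_
  rw [H30.coeffs_add_apply, coeffs_source, coeffs_source, coeffs_source]
  rw [← mul_add, ← intervalIntegral.integral_add
      (intervalIntegrable_phase_tau hF le_rfl t.2.1 t.2.2 j)
      (intervalIntegrable_phase_tau hG le_rfl t.2.1 t.2.2 j)]
  simp only [Pi.add_apply, map_add, mul_add]

theorem source_smul (c : ℝ) {F : ℝ → Y} (hF : MemLp F 2 (volT T)) (t : Icc (0 : ℝ) T) :
    source hT (hF.const_smul c) t = c • source hT hF t := by
  refine H30.ext_coeffs fun j => ?_
  have h : ∫ s in (0 : ℝ)..t, phase j s * tau j ((c • F) s) =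
      (c : ℂ) * ∫ s in (0 : ℝ)..t, phase j s * tau j (F s) := by
    rw [← intervalIntegral.integral_const_mul]
    refine intervalIntegral.integral_congr fun s _ => ?_
    simp only [Pi.smul_apply]
    rw [(tau j).map_smul_of_tower, Complex.real_smul]
    ring
  rw [← Complex.coe_smul, H30.coeffs_smul_apply, coeffs_source, coeffs_source, h]
  ring

theorem H30.continuous_freeFlow_comp {b : Icc (0 : ℝ) T → H30} (hb : Continuous b) :
    Continuous fun t : Icc (0 : ℝ) T => H30.freeFlow t (b t) :=
  H30.continuous_freeFlow.comp (f := fun t : Icc (0 : ℝ) T => ((t : ℝ), b t))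
    (continuous_subtype_val.prodMk hb)

/-- The curve `t ↦ -i ∫₀ᵗ e^{-iA(t-s)} F(s) ds`. -/
def duhamelCurve (F : Lp Y 2 (volT T)) : C(Icc (0 : ℝ) T, H30) where
  toFun t := H30.freeFlow t (source hT (Lp.memLp F) t)
  continuous_toFun := H30.continuous_freeFlow_comp (continuous_source hT (Lp.memLp F))

theorem duhamelCurve_apply (F : Lp Y 2 (volT T)) (t : Icc (0 : ℝ) T) :
    duhamelCurve hT F t = H30.freeFlow t (source hT (Lp.memLp F) t) := rfl

theorem norm_duhamelCurve_le (F : Lp Y 2 (volT T)) :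
    ‖duhamelCurve hT F‖ ≤ √(smoothingConst hT) * ‖F‖ := by
  rw [ContinuousMap.norm_le _ (by positivity)]
  intro t
  refine (H30.norm_freeFlow_le _ _).trans ?_
  refine le_of_sq_le_sq ?_ (by positivity)
  refine (norm_source_sq_le hT _ t).trans ?_
  rw [mul_pow, Real.sq_sqrt (smoothingConst_nonneg hT), L2.norm_sq_eq_integral,
    intervalIntegral.integral_of_le t.2.1]
  refine mul_le_mul_of_nonneg_left ?_ (smoothingConst_nonneg hT)
  exact setIntegral_mono_set ((memLp_two_iff_integrable_sq_norm (Lp.memLp F).1).1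
    (Lp.memLp F)) (ae_of_all _ fun _ => sq_nonneg _) (LE.le.eventuallyLE
      (Ioc_subset_Icc_self.trans (Icc_subset_Icc_right t.2.2)))

theorem duhamelCurve_add (F G : Lp Y 2 (volT T)) :
    duhamelCurve hT (F + G) = duhamelCurve hT F + duhamelCurve hT G := by
  ext1 t
  rw [ContinuousMap.add_apply, duhamelCurve_apply, duhamelCurve_apply, duhamelCurve_apply,
    source_congr hT (Lp.memLp (F + G)) ((Lp.memLp F).add (Lp.memLp G)) (Lp.coeFn_add F G) t,
    source_add, map_add]

theorem duhamelCurve_smul (c : ℝ) (F : Lp Y 2 (volT T)) :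
    duhamelCurve hT (c • F) = c • duhamelCurve hT F := by
  ext1 t
  rw [ContinuousMap.smul_apply, duhamelCurve_apply, duhamelCurve_apply,
    source_congr hT (Lp.memLp (c • F)) ((Lp.memLp F).const_smul c) (Lp.coeFn_smul c F) t,
    source_smul, (H30.freeFlow t).map_smul_of_tower]

/-- The solution operator `F ↦ -i ∫₀ᵗ e^{-iA(t-s)} F(s) ds`. -/
def duhamelOp : Lp Y 2 (volT T) →L[ℝ] C(Icc (0 : ℝ) T, H30) :=
  LinearMap.mkContinuous
    { toFun := duhamelCurve hT
      map_add' := duhamelCurve_add hT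
      map_smul' := duhamelCurve_smul hT }
    (√(smoothingConst hT)) (norm_duhamelCurve_le hT)

theorem duhamelOp_apply (F : Lp Y 2 (volT T)) (t : Icc (0 : ℝ) T) :
    duhamelOp hT F t = H30.freeFlow t (source hT (Lp.memLp F) t) := rfl

theorem memLp_curve {E : Type*} [NormedAddCommGroup E] (f : C(Icc (0 : ℝ) T, E)) :
    MemLp (IccExtend hT f) ∞ (volT T) :=
  MemLp.of_bound (f.continuous.Icc_extend'.aestronglyMeasurable) ‖f‖
    (ae_of_all _ fun _ => f.norm_coe_le_norm _)

/-- Curves as elements of `L^∞`. -/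
def curveToLp {E : Type*} [NormedAddCommGroup E] [NormedSpace ℝ E] :
    C(Icc (0 : ℝ) T, E) →L[ℝ] Lp E ∞ (volT T) :=
  LinearMap.mkContinuous
    { toFun := fun f => (memLp_curve hT f).toLp
      map_add' := fun f g => MemLp.toLp_add (memLp_curve hT f) (memLp_curve hT g)
      map_smul' := fun c f => MemLp.toLp_const_smul c (memLp_curve hT f) }
    -- `(∞ : ℝ≥0∞).toReal` is 0 and so is its inverse; the constant is therefore 1.
    (measureUnivNNReal (volT T) ^ (∞ : ℝ≥0∞).toReal⁻¹) (fun f =>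
      Lp.norm_le_of_ae_bound (norm_nonneg _) (by
        filter_upwards [(memLp_curve hT f).coeFn_toLp] with x hx
        exact (congrArg norm hx).trans_le (f.norm_coe_le_norm _)))

theorem coeFn_curveToLp {E : Type*} [NormedAddCommGroup E] [NormedSpace ℝ E]
    (f : C(Icc (0 : ℝ) T, E)) : curveToLp hT f =ᵐ[volT T] IccExtend hT f :=
  MemLp.coeFn_toLp (memLp_curve hT f)

/-- The solution operator for sources of the form `m(t) G(t)`. -/
def modulatedDuhamel :
    Lp ℝ 2 (volT T) →L[ℝ] C(Icc (0 : ℝ) T, Y) →L[ℝ] C(Icc (0 : ℝ) T, H30) :=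
  (ContinuousLinearMap.compL ℝ (C(Icc (0 : ℝ) T, Y)) (Lp Y 2 (volT T)) (C(Icc (0 : ℝ) T, H30))
    (duhamelOp hT)).comp
    (((ContinuousLinearMap.lsmul ℝ ℝ : ℝ →L[ℝ] Y →L[ℝ] Y).holderL (volT T) 2 ∞ 2).bilinearComp
      (ContinuousLinearMap.id ℝ _) (curveToLp hT))

theorem exists_modulatedDuhamel_eq (m : Lp ℝ 2 (volT T)) (G : C(Icc (0 : ℝ) T, Y)) :
    ∃ F : Lp Y 2 (volT T), (F =ᵐ[volT T] fun s => m s • IccExtend hT G s) ∧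
      modulatedDuhamel hT m G = duhamelOp hT F := by
  refine ⟨(ContinuousLinearMap.lsmul ℝ ℝ : ℝ →L[ℝ] Y →L[ℝ] Y).holder 2 m (curveToLp hT G), ?_, rfl⟩
  filter_upwards [(ContinuousLinearMap.lsmul ℝ ℝ : ℝ →L[ℝ] Y →L[ℝ] Y).coeFn_holder (r := 2) m
    (curveToLp hT G), coeFn_curveToLp hT G] with s h1 h2
  rw [h1, h2]
  rfl

theorem memLp_smul_curve {E : Type*} [NormedAddCommGroup E] [NormedSpace ℝ E]
    (m : Lp ℝ 2 (volT T)) (G : C(Icc (0 : ℝ) T, E)) :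
    MemLp (fun s => m s • IccExtend hT G s) 2 (volT T) := by
  refine MemLp.of_le_mul (c := ‖G‖) (Lp.memLp m)
    ((Lp.memLp m).1.smul G.continuous.Icc_extend'.aestronglyMeasurable) (ae_of_all _ fun s => ?_)
  rw [norm_smul, mul_comm]
  exact mul_le_mul_of_nonneg_right (G.norm_coe_le_norm _) (norm_nonneg _)

theorem modulatedDuhamel_apply (m : Lp ℝ 2 (volT T)) (G : C(Icc (0 : ℝ) T, Y))
    (t : Icc (0 : ℝ) T) : modulatedDuhamel hT m G t =
      H30.freeFlow t (source hT (memLp_smul_curve hT m G) t) := by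
  obtain ⟨F, hF, h⟩ := exists_modulatedDuhamel_eq hT m G
  rw [h, duhamelOp_apply, source_congr hT (Lp.memLp F) (memLp_smul_curve hT m G) hF]

theorem coeffs_modulatedDuhamel (m : Lp ℝ 2 (volT T)) (G : C(Icc (0 : ℝ) T, Y))
    (t : Icc (0 : ℝ) T) (j : ℕ) : H30.coeffs (modulatedDuhamel hT m G t) j =
      phase j (-t) * (-Complex.I *
        ∫ s in (0 : ℝ)..t, phase j s * tau j (m s • IccExtend hT G s)) := by
  rw [modulatedDuhamel_apply, H30.coeffs_freeFlow, coeffs_source]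

/-- This is the Volterra form of the smoothing estimate: only the values of G up to time t enter,
with the integrable weight m². For the control terms m is a component of u, known only to be square
integrable. -/
theorem norm_modulatedDuhamel_sq_le (m : Lp ℝ 2 (volT T)) (G : C(Icc (0 : ℝ) T, Y))
    (t : Icc (0 : ℝ) T) : ‖modulatedDuhamel hT m G t‖ ^ 2 ≤
      smoothingConst hT * ∫ s in (0 : ℝ)..t, m s ^ 2 * ‖IccExtend hT G s‖ ^ 2 := by
  rw [modulatedDuhamel_apply]
  refine (pow_le_pow_left₀ (norm_nonneg _) (H30.norm_freeFlow_le _ _) 2).trans ?_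
  refine (norm_source_sq_le hT _ t).trans_eq ?_
  congr 1
  refine intervalIntegral.integral_congr fun s _ => ?_
  simp only [norm_smul, mul_pow, Real.norm_eq_abs, sq_abs]

end Duhamel

end

noncomputable section

/-! ### Parameter-dependent nonlinear Volterra equations -/

section Volterra

variable {P : Type*} [NormedAddCommGroup P] [NormedSpace ℝ P]
  {E : Type*} [NormedAddCommGroup E] [NormedSpace ℝ E]
  {T : ℝ} (hT : 0 ≤ T)

theorem continuous_sq_norm_IccExtend {E : Type*} [NormedAddCommGroup E] (f : C(Icc (0 : ℝ) T, E)) :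
    Continuous fun s => ‖IccExtend hT f s‖ ^ 2 :=
  f.continuous.Icc_extend'.norm.pow 2

theorem norm_IccExtend_le {E : Type*} [NormedAddCommGroup E] (f : C(Icc (0 : ℝ) T, E)) (s : ℝ) :
    ‖IccExtend hT f s‖ ≤ ‖f‖ := f.norm_coe_le_norm _

theorem intervalIntegrable_mul_sq_norm {E : Type*} [NormedAddCommGroup E] {m : ℝ → ℝ}
    (hm : IntervalIntegrable m volume 0 T)
    (f : C(Icc (0 : ℝ) T, E)) (t : Icc (0 : ℝ) T) :
    IntervalIntegrable (fun s => m s * ‖IccExtend hT f s‖ ^ 2) volume 0 t :=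
  (hm.mono_set (by
    rw [uIcc_of_le hT, uIcc_of_le t.2.1]
    exact Icc_subset_Icc_right t.2.2)).mul_continuousOn
      (continuous_sq_norm_IccExtend hT f).continuousOn

/-- A linear Volterra operator `L` with an integrable kernel: `1 - L` is invertible. -/
theorem isUnit_one_sub_of_volterra [CompleteSpace E] {m : ℝ → ℝ}
    (hm : IntervalIntegrable m volume 0 T) (h0 : ∀ s, 0 ≤ m s)
    (L : C(Icc (0 : ℝ) T, E) →L[ℝ] C(Icc (0 : ℝ) T, E))
    (hL : ∀ ξ (t : Icc (0 : ℝ) T), ‖L ξ t‖ ^ 2 ≤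
      ∫ s in (0 : ℝ)..t, m s * ‖IccExtend hT ξ s‖ ^ 2) : IsUnit (1 - L) := by
  set M : ℝ := ∫ s in (0 : ℝ)..T, m s with hM
  have hM0 : 0 ≤ M := intervalIntegral.integral_nonneg hT fun s _ => h0 s
  have h1 : ∀ n ξ, ‖(L ^ n) ξ‖ ≤ √(M ^ n / n.factorial) * ‖ξ‖ := by
    intro n ξ
    rw [ContinuousMap.norm_le _ (by positivity)]
    intro t
    -- Iteration is done on squared norms, which gives ‖Lⁿ‖² ≤ Mⁿ / n!.
    have h2 := volterra_iterate (B := ‖ξ‖ ^ 2) hm h0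
      (fun n s => ‖IccExtend hT ((L ^ n) ξ) s‖ ^ 2)
      (fun n => (continuous_sq_norm_IccExtend hT _).continuousOn)
      (fun s _ => pow_le_pow_left₀ (norm_nonneg _) (norm_IccExtend_le hT _ s) 2)
      (fun n s hs => by
        have := hL ((L ^ n) ξ) ⟨s, hs⟩
        rw [pow_succ' L]
        rw [IccExtend_of_mem hT _ hs]
        exact this) n t t.2
    rw [IccExtend_of_mem hT _ t.2] at h2
    refine le_of_sq_le_sq ?_ (by positivity)
    rw [mul_pow, Real.sq_sqrt (by positivity)]
    refine h2.trans ?_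
    rw [mul_comm (_ / _), ← mul_div_assoc]
    have h3 : ∫ s in (0 : ℝ)..t, m s ≤ M := by
      rw [hM]
      exact intervalIntegral.integral_mono_interval le_rfl t.2.1 t.2.2
        (ae_of_all _ h0) hm
    have h4 : 0 ≤ ∫ s in (0 : ℝ)..t, m s :=
      intervalIntegral.integral_nonneg t.2.1 fun s _ => h0 s
    gcongr
  have h2 : Tendsto (fun n : ℕ => √(M ^ n / n.factorial)) atTop (𝓝 0) := by
    have := (FloorSemiring.tendsto_pow_div_factorial_atTop M).sqrt
    simpa using this
  obtain ⟨n, hn⟩ := (h2.eventually (gt_mem_nhds one_pos)).exists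
  have h3 : ‖L ^ n‖ < 1 := lt_of_le_of_lt
    (ContinuousLinearMap.opNorm_le_bound _ (Real.sqrt_nonneg _) (h1 n)) hn
  -- Some power of L is a strict contraction even if L is not. Since 1 - Lⁿ is the product of 1 - L
  -- with a commuting factor, 1 - L is a unit too.
  have h4 := isUnit_one_sub_of_norm_lt_one
    (R := C(Icc (0 : ℝ) T, E) →L[ℝ] C(Icc (0 : ℝ) T, E)) h3
  rw [← mul_neg_geom_sum] at h4
  refine ((Commute.isUnit_mul_iff ?_).1 h4).1
  exact (mul_neg_geom_sum L n).trans (geom_sum_mul_neg L n).symm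

theorem ContinuousLinearMap.IsInvertible.of_isUnit {X : Type*} [NormedAddCommGroup X]
    [NormedSpace ℝ X] {L : X →L[ℝ] X} (h : IsUnit L) : L.IsInvertible := by
  obtain ⟨u, rfl⟩ := h
  exact ⟨ContinuousLinearEquiv.ofUnit u, rfl⟩

/-- `F` is a continuously differentiable nonlinear Volterra operator with square-integrable
increments, depending on a parameter in a locally Lipschitz way. -/
structure IsVolterraMap (F : P × C(Icc (0 : ℝ) T, E) → C(Icc (0 : ℝ) T, E)) : Prop where
  contDiff : ContDiff ℝ 1 F
  -- The kernel may vary with z, as it involves the control; only its total integral is bounded on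
  -- balls. This is all that Grönwall's inequality needs for uniform constants.
  volterra : ∀ R : ℝ, ∃ C : ℝ, ∀ z, ‖z‖ ≤ R → ∃ m : ℝ → ℝ,
    IntervalIntegrable m volume 0 T ∧ (∀ s, 0 ≤ m s) ∧ ∫ s in (0 : ℝ)..T, m s ≤ C ∧
    ∀ ψ φ, ‖ψ‖ ≤ R → ‖φ‖ ≤ R → ∀ t : Icc (0 : ℝ) T,
      ‖F (z, ψ) t - F (z, φ) t‖ ^ 2 ≤
        ∫ s in (0 : ℝ)..t, m s * ‖IccExtend hT (ψ - φ) s‖ ^ 2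
  lipschitz : ∀ R : ℝ, ∃ C : ℝ, ∀ z z' ψ, ‖z‖ ≤ R → ‖z'‖ ≤ R → ‖ψ‖ ≤ R →
    ‖F (z, ψ) - F (z', ψ)‖ ≤ C * ‖z - z'‖

namespace IsVolterraMap

variable {hT} {F : P × C(Icc (0 : ℝ) T, E) → C(Icc (0 : ℝ) T, E)}

/-- Locally Lipschitz dependence of the solution on the parameter. -/
theorem exists_norm_sub_le (hF : IsVolterraMap hT F) (R : ℝ) : ∃ K : ℝ, 0 ≤ K ∧
    ∀ z z' ψ φ, ‖z‖ ≤ R → ‖z'‖ ≤ R → ‖ψ‖ ≤ R → ‖φ‖ ≤ R → F (z, ψ) = ψ → F (z', φ) = φ →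
      ‖ψ - φ‖ ≤ K * ‖z - z'‖ := by
  obtain ⟨C, hC⟩ := hF.volterra R
  obtain ⟨D, hD⟩ := hF.lipschitz R
  -- Pass from F(z, ψ) to F(z', φ) through F(z, φ). The squared sum is at most twice the sum of
  -- squares, so Grönwall's inequality runs with kernel 2m and initial term 2(D‖z - z'‖)².
  refine ⟨√(2 * D ^ 2 * Real.exp (2 * C)), Real.sqrt_nonneg _,
    fun z z' ψ φ hz hz' hψ hφ h1 h2 => ?_⟩
  obtain ⟨m, hm, h0, hmC, h⟩ := hC z hz
  rw [ContinuousMap.norm_le _ (by positivity)]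
  intro t
  have h3 := gronwall_integrable (m := fun s => 2 * m s)
    (v := fun s => ‖IccExtend hT (ψ - φ) s‖ ^ 2) (a := 2 * (D * ‖z - z'‖) ^ 2)
    (hm.const_mul 2) (fun s => mul_nonneg zero_le_two (h0 s)) (by positivity)
    (continuous_sq_norm_IccExtend hT _).continuousOn (fun s hs => ?_) t t.2
  · rw [IccExtend_of_mem hT _ t.2] at h3
    refine le_of_sq_le_sq (h3.trans ?_) (by positivity)
    rw [intervalIntegral.integral_const_mul, mul_pow √_, Real.sq_sqrt (by positivity)]
    have : Real.exp (2 * ∫ s in (0 : ℝ)..T, m s) ≤ Real.exp (2 * C) :=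
      Real.exp_le_exp.2 (by linarith)
    calc _ ≤ 2 * (D * ‖z - z'‖) ^ 2 * Real.exp (2 * C) := by gcongr
      _ = _ := by ring
  · rw [IccExtend_of_mem hT _ hs]
    have h4 := h ψ φ hψ hφ ⟨s, hs⟩
    have h5 : ‖F (z, φ) ⟨s, hs⟩ - F (z', φ) ⟨s, hs⟩‖ ≤ D * ‖z - z'‖ :=
      ((F (z, φ) - F (z', φ)).norm_coe_le_norm ⟨s, hs⟩).trans (hD z z' φ hz hz' hφ)
    have h6 : (ψ - φ) ⟨s, hs⟩ = (F (z, ψ) ⟨s, hs⟩ - F (z, φ) ⟨s, hs⟩) +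
        (F (z, φ) ⟨s, hs⟩ - F (z', φ) ⟨s, hs⟩) := by
      rw [h1, h2, ContinuousMap.sub_apply]
      abel
    simp only [mul_assoc]
    rw [intervalIntegral.integral_const_mul, h6]
    have h7 := pow_le_pow_left₀ (norm_nonneg _) (norm_add_le
      (F (z, ψ) ⟨s, hs⟩ - F (z, φ) ⟨s, hs⟩) (F (z, φ) ⟨s, hs⟩ - F (z', φ) ⟨s, hs⟩)) 2
    have h8 := pow_le_pow_left₀ (norm_nonneg _) h5 2
    refine h7.trans ((add_sq_le).trans ?_)
    linarith

theorem eq_of_fixed (hF : IsVolterraMap hT F) {z : P} {ψ φ : C(Icc (0 : ℝ) T, E)}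
    (hψ : F (z, ψ) = ψ) (hφ : F (z, φ) = φ) : ψ = φ := by
  obtain ⟨K, -, h⟩ := hF.exists_norm_sub_le (max ‖z‖ (max ‖ψ‖ ‖φ‖))
  have := h z z ψ φ (le_max_left _ _) (le_max_left _ _)
    ((le_max_left _ _).trans (le_max_right _ _)) ((le_max_right _ _).trans (le_max_right _ _)) hψ hφ
  rw [sub_self, norm_zero, mul_zero] at this
  exact sub_eq_zero.1 (norm_le_zero_iff.1 this)

/-- The partial derivative of a nonlinear Volterra operator is a linear one. -/
theorem isUnit_one_sub_fderiv [CompleteSpace E] (hF : IsVolterraMap hT F) (z : P)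
    (ψ : C(Icc (0 : ℝ) T, E)) :
    IsUnit (1 - (fderiv ℝ F (z, ψ)).comp (ContinuousLinearMap.inr ℝ P C(Icc (0 : ℝ) T, E))) := by
  -- The radius ‖ψ‖ + 1 leaves room for ψ + r ξ with small r.
  obtain ⟨C, hC⟩ := hF.volterra (max ‖z‖ (‖ψ‖ + 1))
  obtain ⟨m, hm, h0, -, h⟩ := hC z (le_max_left _ _)
  refine isUnit_one_sub_of_volterra hT hm h0 _ fun ξ t => ?_
  have hd : HasFDerivAt F (fderiv ℝ F (z, ψ)) (z, ψ) :=
    (hF.contDiff.differentiable one_ne_zero _).hasFDerivAt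
  have hline : HasDerivAt (fun r : ℝ => F (z, ψ + r • ξ))
      (fderiv ℝ F (z, ψ) (0, ξ)) 0 := by
    have h1 : HasDerivAt (fun r : ℝ => (z, ψ + r • ξ)) ((0 : P), ξ) 0 := by
      refine (hasDerivAt_const _ _).prodMk ?_
      simpa using ((hasDerivAt_id (0 : ℝ)).smul_const ξ).const_add ψ
    have h2 : HasFDerivAt F (fderiv ℝ F (z, ψ)) (z, ψ + (0 : ℝ) • ξ) := by simpa using hd
    exact h2.comp_hasDerivAt (0 : ℝ) h1
  have hev : Tendsto (fun r : ℝ => ‖(r⁻¹ • (F (z, ψ + r • ξ) - F (z, ψ))) t‖ ^ 2) (𝓝[≠] 0)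
      (𝓝 (‖fderiv ℝ F (z, ψ) (0, ξ) t‖ ^ 2)) := by
    have h1 := hline.tendsto_slope_zero
    simp only [zero_add, zero_smul, add_zero] at h1
    have h2 : Continuous fun f : C(Icc (0 : ℝ) T, E) => ‖f t‖ ^ 2 :=
      ((ContinuousEvalConst.continuous_eval_const t).norm).pow 2
    exact (h2.tendsto _).comp h1
  refine le_of_tendsto hev ?_
  have hsm : ∀ᶠ r : ℝ in 𝓝[≠] 0, ‖r • ξ‖ < 1 := by
    have : Continuous fun r : ℝ => ‖r • ξ‖ := (continuous_id.smul continuous_const).norm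
    have h1 := this.tendsto 0
    rw [zero_smul, norm_zero] at h1
    exact (h1.mono_left nhdsWithin_le_nhds).eventually (gt_mem_nhds one_pos)
  filter_upwards [hsm, self_mem_nhdsWithin] with r hr hr0
  have h1 := h (ψ + r • ξ) ψ ((norm_add_le _ _).trans ((by linarith : _ ≤ ‖ψ‖ + 1).trans
    (le_max_right _ _))) ((le_add_of_nonneg_right zero_le_one).trans (le_max_right _ _)) t
  -- The bound is quadratic in the increment r ξ, so r² cancels in the squared difference quotient
  -- and the same kernel serves the derivative.
  have h2 : ∫ s in (0 : ℝ)..t, m s * ‖IccExtend hT (ψ + r • ξ - ψ) s‖ ^ 2 =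
      r ^ 2 * ∫ s in (0 : ℝ)..t, m s * ‖IccExtend hT ξ s‖ ^ 2 := by
    rw [← intervalIntegral.integral_const_mul]
    refine intervalIntegral.integral_congr fun s _ => ?_
    have h3 : IccExtend hT (ψ + r • ξ - ψ) s = r • IccExtend hT ξ s := by
      rw [add_sub_cancel_left]
      rfl
    simp only [h3, norm_smul, mul_pow, Real.norm_eq_abs, sq_abs]
    ring
  rw [h2] at h1
  rw [ContinuousMap.smul_apply, ContinuousMap.sub_apply, norm_smul, mul_pow, norm_inv, inv_pow,
    Real.norm_eq_abs, sq_abs]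
  have hr2 : 0 < r ^ 2 := by
    have : r ≠ 0 := hr0
    positivity
  rw [inv_mul_le_iff₀ hr2]
  exact h1

/-- The linearised equation has at most one solution. -/
theorem eq_of_linearised [CompleteSpace E] (hF : IsVolterraMap hT F) {z w : P} {ψ ξ η : C(Icc (0 : ℝ) T, E)}
    (hξ : fderiv ℝ F (z, ψ) (w, ξ) = ξ) (hη : fderiv ℝ F (z, ψ) (w, η) = η) : ξ = η := by
  have h1 := (ContinuousLinearMap.IsInvertible.of_isUnit (hF.isUnit_one_sub_fderiv z ψ)).injective
  rw [← sub_eq_zero]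
  refine h1 ?_
  rw [map_zero]
  have h2 : fderiv ℝ F (z, ψ) (0, ξ - η) = ξ - η := by
    have : ((0 : P), ξ - η) = (w, ξ) - (w, η) := by simp
    rw [this, map_sub, hξ, hη]
  change (ξ - η) - fderiv ℝ F (z, ψ) (0, ξ - η) = 0
  rw [h2, sub_self]

/-- The derivative of the solution map solves the linearised equation. -/
theorem fderiv_solutionMap (hF : IsVolterraMap hT F) {z : P} {g : P → C(Icc (0 : ℝ) T, E)}
    (hg : ContDiffAt ℝ 1 g z) (h : ∀ᶠ y in 𝓝 z, F (y, g y) = g y) (w : P) :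
    fderiv ℝ F (z, g z) (w, fderiv ℝ g z w) = fderiv ℝ g z w := by
  have h1 : HasFDerivAt g (fderiv ℝ g z) z := (hg.differentiableAt one_ne_zero).hasFDerivAt
  have h2 : HasFDerivAt F (fderiv ℝ F (z, g z)) (z, g z) :=
    (hF.contDiff.differentiable one_ne_zero _).hasFDerivAt
  have h3 := (HasFDerivAt.comp (f := fun y => (y, g y)) z h2
    ((hasFDerivAt_id z).prodMk h1)).congr_of_eventuallyEq
    (h.mono fun y hy => hy.symm)
  exact (DFunLike.congr_fun (h3.unique h1) w)

variable [CompleteSpace P] [CompleteSpace E]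

/-- Near a parameter for which the equation `F (z, ψ) = ψ` has a solution it has solutions that
depend on the parameter in a continuously differentiable way. -/
theorem exists_solutionMap (hF : IsVolterraMap hT F) {z : P} {ψ : C(Icc (0 : ℝ) T, E)}
    (h : F (z, ψ) = ψ) : ∃ g : P → C(Icc (0 : ℝ) T, E), ContDiffAt ℝ 1 g z ∧ g z = ψ ∧
      ∀ᶠ y in 𝓝 z, F (y, g y) = g y := by
  -- Solutions are zeros of ψ - F(z, ψ). Its partial derivative in ψ is 1 - ∂_ψF, invertible by the
  -- Volterra property, so the implicit function theorem applies without any smallness.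
  set G : P × C(Icc (0 : ℝ) T, E) → C(Icc (0 : ℝ) T, E) := fun x => x.2 - F x with hG
  have hGc : ContDiffAt ℝ 1 G (z, ψ) := (contDiff_snd.sub hF.contDiff).contDiffAt
  have hd : fderiv ℝ G (z, ψ) = ContinuousLinearMap.snd ℝ P _ - fderiv ℝ F (z, ψ) :=
    (hasFDerivAt_snd.sub (hF.contDiff.differentiable one_ne_zero _).hasFDerivAt).fderiv
  have hinv : (fderiv ℝ G (z, ψ) ∘L .inr ℝ P _).IsInvertible := by
    refine ContinuousLinearMap.IsInvertible.of_isUnit ?_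
    have h1 : fderiv ℝ G (z, ψ) ∘L .inr ℝ P _ =
        1 - (fderiv ℝ F (z, ψ)).comp (.inr ℝ P C(Icc (0 : ℝ) T, E)) := by
      rw [hd]
      rfl
    rw [h1]
    exact hF.isUnit_one_sub_fderiv z ψ
  refine ⟨hGc.implicitFunction one_ne_zero hinv, hGc.contDiffAt_implicitFunction _ hinv,
    hGc.implicitFunction_apply_self _ hinv, ?_⟩
  filter_upwards [hGc.eventually_apply_implicitFunction one_ne_zero hinv] with y hy
  have h1 : G (z, ψ) = 0 := by simp [hG, h]
  rw [h1] at hy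
  exact (sub_eq_zero.1 hy).symm

/-- The set of parameters for which the equation is solvable contains balls around the parameters of
bounded solutions whose radius depends only on the bound. -/
theorem exists_radius (hF : IsVolterraMap hT F) (R : ℝ) : ∃ δ : ℝ, 0 < δ ∧
    ∀ z ψ, ‖z‖ ≤ R → ‖ψ‖ ≤ R → F (z, ψ) = ψ → ∀ y, ‖y - z‖ < δ → ∃ φ, F (y, φ) = φ := by
  obtain ⟨K, hK0, hK⟩ := hF.exists_norm_sub_le (R + 1)
  -- This δ ensures both ‖y - z‖ ≤ 1 and K‖y - z‖ < 1: parameters on the segment stay in the ball of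
  -- radius R + 1, and solutions within distance 1 of ψ are at distance less than 1.
  refine ⟨(K + 1)⁻¹, by positivity, fun z ψ hz hψ hzψ y hy => ?_⟩
  have hy1 : ‖y - z‖ ≤ 1 := hy.le.trans (inv_le_one_of_one_le₀ (by linarith))
  have hKy : K * ‖y - z‖ < 1 := by
    have h1 : (K + 1) * ‖y - z‖ < 1 := by
      have := mul_lt_mul_of_pos_left hy (by linarith : 0 < K + 1)
      rwa [mul_inv_cancel₀ (by linarith)] at this
    nlinarith [norm_nonneg (y - z)]
  set γ : ℝ → P := fun r => z + r • (y - z) with hγ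
  have hγc : Continuous γ := continuous_const.add (continuous_id.smul continuous_const)
  have hγz : ∀ r ∈ Icc (0 : ℝ) 1, ‖γ r - z‖ ≤ ‖y - z‖ := by
    intro r hr
    rw [hγ, add_sub_cancel_left, norm_smul, Real.norm_of_nonneg hr.1]
    exact mul_le_of_le_one_left (norm_nonneg _) hr.2
  have hγR : ∀ r ∈ Icc (0 : ℝ) 1, ‖γ r‖ ≤ R + 1 := by
    intro r hr
    have h1 := norm_le_norm_add_norm_sub' (γ r) z
    linarith [hγz r hr]
  -- Continuation along the segment: `S` holds the times whose parameter has a solution within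
  -- distance 1 of ψ.
  set S : Set ℝ := {r | ∃ φ, F (γ r, φ) = φ ∧ ‖φ - ψ‖ ≤ 1} with hS
  have hbd : ∀ φ, ‖φ - ψ‖ ≤ 1 → ‖φ‖ ≤ R + 1 := by
    intro φ hφ
    have h1 := norm_le_norm_add_norm_sub' φ ψ
    linarith
  have hψ' : ‖ψ‖ ≤ R + 1 := by linarith
  have hz' : ‖z‖ ≤ R + 1 := by linarith
  -- The Lipschitz bound improves ≤ 1 to < 1, so the constraint in `S` is never active and does not
  -- stop the continuation.
  have hlt : ∀ r ∈ Icc (0 : ℝ) 1, ∀ φ, F (γ r, φ) = φ → ‖φ - ψ‖ ≤ 1 → ‖φ - ψ‖ < 1 := by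
    intro r hr φ h1 h2
    refine (hK (γ r) z φ ψ (hγR r hr) hz' (hbd φ h2) hψ' h1 hzψ).trans_lt ?_
    exact (mul_le_mul_of_nonneg_left (hγz r hr) hK0).trans_lt hKy
  -- Lipschitz dependence makes solutions along a convergent sequence of parameters Cauchy, and
  -- continuity of F passes the equation to the limit.
  have hclosed : IsClosed (S ∩ Icc 0 1) := by
    refine IsSeqClosed.isClosed fun r r₀ hr hlim => ?_
    have hr₀ : r₀ ∈ Icc (0 : ℝ) 1 := isClosed_Icc.mem_of_tendsto hlim
      (Eventually.of_forall fun n => (hr n).2)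
    choose φ h1 h2 using fun n => (hr n).1
    have hγlim : Tendsto (fun n => γ (r n)) atTop (𝓝 (γ r₀)) := (hγc.tendsto r₀).comp hlim
    have hcau : CauchySeq φ := by
      have h3 := hγlim.cauchySeq
      rw [cauchySeq_iff_tendsto_dist_atTop_0] at h3 ⊢
      have h4 := h3.const_mul K
      rw [mul_zero] at h4
      refine squeeze_zero (fun _ => dist_nonneg) (fun n => ?_) h4
      rw [dist_eq_norm, dist_eq_norm]
      exact hK _ _ _ _ (hγR _ (hr _).2) (hγR _ (hr _).2) (hbd _ (h2 _)) (hbd _ (h2 _)) (h1 _) (h1 _)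
    obtain ⟨φ₀, hφ₀⟩ := cauchySeq_tendsto_of_complete hcau
    refine ⟨⟨φ₀, ?_, ?_⟩, hr₀⟩
    · have h5 : Tendsto (fun n => F (γ (r n), φ n)) atTop (𝓝 (F (γ r₀, φ₀))) :=
        (hF.contDiff.continuous.tendsto _).comp (hγlim.prodMk_nhds hφ₀)
      simp only [h1] at h5
      exact tendsto_nhds_unique h5 hφ₀
    · exact le_of_tendsto (hφ₀.sub_const ψ).norm (Eventually.of_forall h2)
  have h0 : (0 : ℝ) ∈ S := ⟨ψ, by simpa [hγ] using hzψ, by simp⟩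
  -- `S` extends to the right of each of its points before 1 by the local solution map, which stays
  -- within distance 1 thanks to `hlt`.
  have hsub := hclosed.Icc_subset_of_forall_exists_gt h0 fun r hr x hx => by
    obtain ⟨⟨φ, h1, h2⟩, hr1⟩ := hr
    have hrI : r ∈ Icc (0 : ℝ) 1 := ⟨hr1.1, hr1.2.le⟩
    obtain ⟨g, hg, hgz, hge⟩ := hF.exists_solutionMap h1
    have h3 : ∀ᶠ w in 𝓝 (γ r), ‖g w - ψ‖ < 1 := by
      have : ContinuousAt (fun w => ‖g w - ψ‖) (γ r) :=
        (hg.continuousAt.sub continuousAt_const).norm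
      refine this.eventually (gt_mem_nhds ?_)
      simp only [hgz]
      exact hlt r hrI φ h1 h2
    have h4 := (hγc.tendsto r).eventually (h3.and hge)
    have h5 : ∀ᶠ s in 𝓝[>] r, s ∈ Ioc r x := Ioc_mem_nhdsGT hx
    obtain ⟨s, hs, hs2⟩ := ((h4.filter_mono nhdsWithin_le_nhds).and h5).exists
    exact ⟨s, ⟨g (γ s), hs.2, hs.1.le⟩, hs2⟩
  obtain ⟨φ, hφ, -⟩ := hsub (right_mem_Icc.2 zero_le_one)
  refine ⟨φ, ?_⟩
  simpa [hγ] using hφ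

end IsVolterraMap

end Volterra

end

noncomputable section

/-! ### Pointwise operations on curves -/

section CurveOperations

variable {K : Type*} [TopologicalSpace K] [CompactSpace K]
  {E F G : Type*} [NormedAddCommGroup E] [NormedSpace ℝ E] [NormedAddCommGroup F] [NormedSpace ℝ F]
  [NormedAddCommGroup G] [NormedSpace ℝ G]

/-- A bounded bilinear map, applied pointwise to continuous curves. -/
def curveBilin (B : E →L[ℝ] F →L[ℝ] G) : C(K, E) →L[ℝ] C(K, F) →L[ℝ] C(K, G) :=
  LinearMap.mkContinuous₂
    (LinearMap.mk₂ ℝ (fun f g => (⟨fun t => B (f t) (g t), by fun_prop⟩ : C(K, G)))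
      (fun f f' g => by ext1 t; simp) (fun c f g => by ext1 t; simp)
      (fun f g g' => by ext1 t; simp) (fun c f g => by ext1 t; simp))
    ‖B‖ (fun f g => by
      rw [ContinuousMap.norm_le _ (by positivity)]
      intro t
      refine (B.le_opNorm₂ (f t) (g t)).trans ?_
      gcongr
      · exact f.norm_coe_le_norm t
      · exact g.norm_coe_le_norm t)

theorem curveBilin_apply (B : E →L[ℝ] F →L[ℝ] G) (f : C(K, E)) (g : C(K, F)) (t : K) :
    curveBilin B f g t = B (f t) (g t) := rfl

/-- A bounded linear map, applied pointwise to continuous curves. -/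
def curveMap {K : Type*} [TopologicalSpace K] (A : E →L[ℝ] F) : C(K, E) →L[ℝ] C(K, F) :=
  A.compLeftContinuous ℝ K

theorem curveMap_apply {K : Type*} [TopologicalSpace K] (A : E →L[ℝ] F) (f : C(K, E)) (t : K) : curveMap A f t = A (f t) := rfl

theorem ContinuousLinearMap.exists_bilin_bound (B : E →L[ℝ] F →L[ℝ] G) :
    ∃ b : ℝ, 0 ≤ b ∧ ∀ f g, ‖B f g‖ ≤ b * ‖f‖ * ‖g‖ :=
  ⟨‖B‖, B.opNorm_nonneg, B.le_opNorm₂⟩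

theorem ContDiff.bilin {X : Type*} [NormedAddCommGroup X] [NormedSpace ℝ X] {n : WithTop ℕ∞}
    (B : E →L[ℝ] F →L[ℝ] G) {f : X → E} {g : X → F} (hf : ContDiff ℝ n f) (hg : ContDiff ℝ n g) :
    ContDiff ℝ n fun x => B (f x) (g x) :=
  B.isBoundedBilinearMap.contDiff.comp (hf.prodMk hg)

end CurveOperations

section LipschitzCurves

variable {K : Type*} [TopologicalSpace K] [CompactSpace K]
  {E F G : Type*} [NormedAddCommGroup E] [NormedAddCommGroup F] [NormedAddCommGroup G]

/-- A pointwise locally Lipschitz map between spaces of curves. -/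
def PointwiseLipschitz (Φ : C(K, E) → C(K, F)) : Prop :=
  ∀ R : ℝ, ∃ C : ℝ, 0 ≤ C ∧ ∀ f g, ‖f‖ ≤ R → ‖g‖ ≤ R → ∀ t, ‖Φ f t - Φ g t‖ ≤ C * ‖f t - g t‖

namespace PointwiseLipschitz

theorem clm [NormedSpace ℝ E] [NormedSpace ℝ F] (A : E →L[ℝ] F) : PointwiseLipschitz (curveMap (K := K) A) :=
  fun _ => ⟨‖A‖, norm_nonneg _, fun f g _ _ t => by
    rw [curveMap_apply, curveMap_apply, ← map_sub]
    exact A.le_opNorm _⟩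

theorem id : PointwiseLipschitz (fun f : C(K, E) => f) :=
  fun _ => ⟨1, zero_le_one, fun f g _ _ t => by rw [one_mul]⟩

theorem exists_bound {Φ : C(K, E) → C(K, F)} (h : PointwiseLipschitz Φ) (R : ℝ) :
    ∃ D : ℝ, 0 ≤ D ∧ ∀ f, ‖f‖ ≤ R → ‖Φ f‖ ≤ D := by
  obtain ⟨C, hC0, hC⟩ := h (max R 0)
  refine ⟨‖Φ 0‖ + C * max R 0, by positivity, fun f hf => ?_⟩
  rw [ContinuousMap.norm_le _ (by positivity)]
  intro t
  have h1 := hC f 0 (hf.trans (le_max_left _ _)) (by simp) t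
  have h2 := norm_le_norm_add_norm_sub' (Φ f t) (Φ 0 t)
  have h3 : ‖f t - (0 : C(K, E)) t‖ ≤ max R 0 := by
    rw [ContinuousMap.zero_apply, sub_zero]
    exact (f.norm_coe_le_norm t).trans (hf.trans (le_max_left _ _))
  have h4 := (Φ 0).norm_coe_le_norm t
  have h5 := mul_le_mul_of_nonneg_left h3 hC0
  linarith

theorem comp {Φ : C(K, F) → C(K, G)} {Θ : C(K, E) → C(K, F)} (hΦ : PointwiseLipschitz Φ)
    (hΘ : PointwiseLipschitz Θ) : PointwiseLipschitz fun f => Φ (Θ f) := by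
  intro R
  obtain ⟨D, -, hD⟩ := hΘ.exists_bound R
  obtain ⟨C, hC0, hC⟩ := hΘ R
  obtain ⟨C', hC0', hC'⟩ := hΦ D
  refine ⟨C' * C, by positivity, fun f g hf hg t => (hC' _ _ (hD f hf) (hD g hg) t).trans ?_⟩
  rw [mul_assoc]
  exact mul_le_mul_of_nonneg_left (hC f g hf hg t) hC0'

theorem add {Φ Θ : C(K, E) → C(K, F)} (hΦ : PointwiseLipschitz Φ)
    (hΘ : PointwiseLipschitz Θ) : PointwiseLipschitz fun f => Φ f + Θ f := by
  intro R
  obtain ⟨C, hC0, hC⟩ := hΘ R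
  obtain ⟨C', hC0', hC'⟩ := hΦ R
  refine ⟨C' + C, by positivity, fun f g hf hg t => ?_⟩
  rw [ContinuousMap.add_apply, ContinuousMap.add_apply, add_sub_add_comm, add_mul]
  exact (norm_add_le _ _).trans (add_le_add (hC' f g hf hg t) (hC f g hf hg t))

theorem bilin [NormedSpace ℝ F] [NormedSpace ℝ G] {H : Type*} [NormedAddCommGroup H]
    [NormedSpace ℝ H] (B : F →L[ℝ] G →L[ℝ] H)
    {Φ : C(K, E) → C(K, F)} {Θ : C(K, E) → C(K, G)} (hΦ : PointwiseLipschitz Φ)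
    (hΘ : PointwiseLipschitz Θ) : PointwiseLipschitz fun f => curveBilin B (Φ f) (Θ f) := by
  intro R
  obtain ⟨C, hC0, hC⟩ := hΦ R
  obtain ⟨C', hC0', hC'⟩ := hΘ R
  obtain ⟨D, hD0, hD⟩ := hΦ.exists_bound R
  obtain ⟨D', hD0', hD'⟩ := hΘ.exists_bound R
  refine ⟨‖B‖ * C * D' + ‖B‖ * D * C', by positivity, fun f g hf hg t => ?_⟩
  rw [curveBilin_apply, curveBilin_apply]
  have h1 : B (Φ f t) (Θ f t) - B (Φ g t) (Θ g t) =
      B (Φ f t - Φ g t) (Θ f t) + B (Φ g t) (Θ f t - Θ g t) := by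
    rw [map_sub, map_sub, _root_.sub_apply]
    abel
  rw [h1, add_mul]
  refine (norm_add_le _ _).trans (add_le_add ?_ ?_)
  · refine (B.le_opNorm₂ _ _).trans ?_
    calc _ ≤ ‖B‖ * (C * ‖f t - g t‖) * D' := by
          gcongr
          · exact hC f g hf hg t
          · exact ((Θ f).norm_coe_le_norm t).trans (hD' f hf)
      _ = _ := by ring
  · refine (B.le_opNorm₂ _ _).trans ?_
    calc _ ≤ ‖B‖ * D * (C' * ‖f t - g t‖) := by
          gcongr
          · exact ((Φ g).norm_coe_le_norm t).trans (hD g hg)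
          · exact hC' f g hf hg t
      _ = _ := by ring

end PointwiseLipschitz

end LipschitzCurves

/-! ### The power nonlinearity -/

section CurvePower

variable {K : Type*} [TopologicalSpace K] [CompactSpace K]
  {E : Type*} [NormedAddCommGroup E] [NormedSpace ℝ E] (B : E →L[ℝ] E →L[ℝ] E) (J : E →L[ℝ] E)

/-- `(f J(f))ⁿ f` for a curve `f`, where the product is `B`. -/
def curvePower : ℕ → C(K, E) → C(K, E)
  | 0, f => f
  | n + 1, f => curveBilin B (curveBilin B f (curveMap J f)) (curvePower n f)

theorem curvePower_succ_apply (n : ℕ) (f : C(K, E)) (t : K) :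
    curvePower B J (n + 1) f t = B (B (f t) (J (f t))) (curvePower B J n f t) := rfl

theorem contDiff_curvePower (n : ℕ) : ContDiff ℝ 1 (curvePower B J n : C(K, E) → C(K, E)) := by
  induction n with
  | zero => exact contDiff_id
  | succ n ih =>
    exact ContDiff.bilin (curveBilin B)
      (ContDiff.bilin (curveBilin B) contDiff_id (curveMap J).contDiff) ih

/-- A Lipschitz bound in the maximum norm would not do: to enter a Volterra integral it has to hold
at each time separately. -/
theorem pointwiseLipschitz_curvePower (n : ℕ) :
    PointwiseLipschitz (curvePower B J n : C(K, E) → C(K, E)) := by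
  induction n with
  | zero => exact PointwiseLipschitz.id
  | succ n ih =>
    exact PointwiseLipschitz.bilin B
      (PointwiseLipschitz.bilin B PointwiseLipschitz.id (PointwiseLipschitz.clm J)) ih

theorem fderiv_curvePower_zero (f ξ : C(K, E)) : fderiv ℝ (curvePower B J 0) f ξ = ξ := by
  have h : (curvePower B J 0 : C(K, E) → C(K, E)) = fun f => f := rfl
  rw [h, fderiv_fun_id]
  rfl

theorem fderiv_curvePower_succ (n : ℕ) (f ξ : C(K, E)) (t : K) :
    fderiv ℝ (curvePower B J (n + 1)) f ξ t =
      B (B (f t) (J (f t))) (fderiv ℝ (curvePower B J n) f ξ t) +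
        B (B (f t) (J (ξ t)) + B (ξ t) (J (f t))) (curvePower B J n f t) := by
  have h1 : HasFDerivAt (curvePower B J n : C(K, E) → C(K, E)) (fderiv ℝ (curvePower B J n) f) f :=
    ((contDiff_curvePower B J n).differentiable one_ne_zero f).hasFDerivAt
  have h2 := (curveBilin B).hasFDerivAt_of_bilinear (hasFDerivAt_id f)
    (curveMap (K := K) J).hasFDerivAt
  have h3 := (curveBilin B).hasFDerivAt_of_bilinear h2 h1
  have h4 : fderiv ℝ (curvePower B J (n + 1)) f = _ := h3.fderiv
  rw [h4]
  rfl

end CurvePower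

namespace Y

/-- The multiplication of `Y` as a real bilinear map. -/
def mulReal : Y →L[ℝ] Y →L[ℝ] Y := mul.bilinearRestrictScalars ℝ

theorem mulReal_apply (y z : Y) : mulReal y z = mul y z := rfl

variable {K : Type*} [TopologicalSpace K] [CompactSpace K]

theorem c0_curvePower (n : ℕ) (f : C(K, Y)) (t : K) (x : Icc (0 : ℝ) 1) :
    c0 (curvePower mulReal conj n f t) x = (‖c0 (f t) x‖ : ℂ) ^ (2 * n) * c0 (f t) x := by
  induction n with
  | zero => simp [curvePower]
  | succ n ih =>
    rw [curvePower_succ_apply, mulReal_apply, mulReal_apply, c0_mul, c0_mul, c0_conj, ContinuousMap.mul_apply, ContinuousMap.mul_apply, ih,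
      ContinuousMap.star_apply, RCLike.star_def, Complex.mul_conj']
    ring

theorem c0_fderiv_curvePower (n : ℕ) (f ξ : C(K, Y)) (t : K) (x : Icc (0 : ℝ) 1) :
    c0 (fderiv ℝ (curvePower mulReal conj n) f ξ t) x =
      ((n : ℂ) + 1) * (‖c0 (f t) x‖ : ℂ) ^ (2 * n) * c0 (ξ t) x +
        (n : ℂ) * c0 (f t) x ^ 2 * (‖c0 (f t) x‖ : ℂ) ^ (2 * (n - 1)) *
          (starRingEnd ℂ) (c0 (ξ t) x) := by
  induction n with
  | zero =>
    rw [fderiv_curvePower_zero]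
    simp
  | succ n ih =>
    rw [fderiv_curvePower_succ]
    simp only [mulReal_apply]
    rw [map_add, c0_mul, c0_mul, c0_mul, map_add, c0_mul, c0_mul, c0_conj,
      c0_conj]
    simp only [ContinuousMap.add_apply, ContinuousMap.mul_apply, ContinuousMap.star_apply,
      RCLike.star_def, Complex.mul_conj', ih, c0_curvePower]
    -- For n = 0 the subtraction n - 1 is truncated and the powers do not match; the factor n makes
    -- both sides zero.
    have h2 : (n : ℂ) * (‖c0 (f t) x‖ : ℂ) ^ (2 * (n - 1)) * (‖c0 (f t) x‖ : ℂ) ^ 2 =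
        n * (‖c0 (f t) x‖ : ℂ) ^ (2 * n) := by
      rcases n with _ | n
      · simp
      · rw [Nat.add_sub_cancel]; ring
    have h3 : c0 (f t) x * (starRingEnd ℂ) (c0 (f t) x) = (‖c0 (f t) x‖ : ℂ) ^ 2 :=
      Complex.mul_conj' _
    rw [Nat.add_sub_cancel]
    push_cast
    linear_combination (c0 (f t) x ^ 2 * (starRingEnd ℂ) (c0 (ξ t) x)) * h2 +
      (c0 (ξ t) x * (‖c0 (f t) x‖ : ℂ) ^ (2 * n)) * h3

end Y

/-! ### The integral equation in `C([0,T]; H³_{(0)})` -/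

section DuhamelMap

variable {P : Type*} [NormedAddCommGroup P] [NormedSpace ℝ P] {T : ℝ} (hT : 0 ≤ T)
  {ι : Type*} [Fintype ι]
  {E : Type*} [NormedAddCommGroup E] [NormedSpace ℝ E]
  {Z : Type*} [NormedAddCommGroup Z] [NormedSpace ℝ Z]

/-- The map `(z, ψ) ↦ S z + ∑ᵢ B(aᵢ + ℓᵢ z, Gᵢ(ψ))`. -/
def duhamelMap (B : Lp ℝ 2 (volT T) →L[ℝ] C(Icc (0 : ℝ) T, Z) →L[ℝ] C(Icc (0 : ℝ) T, E))
    (S : P →L[ℝ] C(Icc (0 : ℝ) T, E)) (a : ι → Lp ℝ 2 (volT T))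
    (ℓ : ι → P →L[ℝ] Lp ℝ 2 (volT T)) (G : ι → C(Icc (0 : ℝ) T, E) → C(Icc (0 : ℝ) T, Z))
    (x : P × C(Icc (0 : ℝ) T, E)) : C(Icc (0 : ℝ) T, E) :=
  S x.1 + ∑ i, B (a i + ℓ i x.1) (G i x.2)

variable {B : Lp ℝ 2 (volT T) →L[ℝ] C(Icc (0 : ℝ) T, Z) →L[ℝ] C(Icc (0 : ℝ) T, E)}
  {S : P →L[ℝ] C(Icc (0 : ℝ) T, E)} {a : ι → Lp ℝ 2 (volT T)}
    {ℓ : ι → P →L[ℝ] Lp ℝ 2 (volT T)} {G : ι → C(Icc (0 : ℝ) T, E) → C(Icc (0 : ℝ) T, Z)}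

theorem intervalIntegrable_sq (hT : 0 ≤ T) (m : Lp ℝ 2 (volT T)) :
    IntervalIntegrable (fun s => m s ^ 2) volume 0 T := by
  have h := intervalIntegrable_norm_sq (Lp.memLp m) le_rfl hT le_rfl
  simpa only [Real.norm_eq_abs, sq_abs] using h

theorem integral_sq (hT : 0 ≤ T) (m : Lp ℝ 2 (volT T)) : ∫ s in (0 : ℝ)..T, m s ^ 2 = ‖m‖ ^ 2 := by
  rw [L2.norm_sq_eq_integral, intervalIntegral.integral_of_le hT, ← integral_Icc_eq_integral_Ioc]
  simp only [Real.norm_eq_abs, sq_abs]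

theorem contDiff_duhamelMap (hG : ∀ i, ContDiff ℝ 1 (G i)) :
    ContDiff ℝ 1 (duhamelMap B S a ℓ G) := by
  have h1 : ∀ i, ContDiff ℝ 1 fun x : P × C(Icc (0 : ℝ) T, E) =>
      B (a i + ℓ i x.1) (G i x.2) := fun i =>
    ContDiff.bilin (B)
      (contDiff_const.add ((ℓ i).contDiff.comp contDiff_fst)) ((hG i).comp contDiff_snd)
  exact (S.contDiff.comp contDiff_fst).add (ContDiff.sum fun i _ => h1 i)

theorem fderiv_duhamelMap (hG : ∀ i, ContDiff ℝ 1 (G i)) (z w : P)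
    (ψ ξ : C(Icc (0 : ℝ) T, E)) :
    fderiv ℝ (duhamelMap B S a ℓ G) (z, ψ) (w, ξ) =
      S w + ∑ i, (B (a i + ℓ i z) (fderiv ℝ (G i) ψ ξ) +
        B (ℓ i w) (G i ψ)) := by
  have h1 : ∀ i, HasFDerivAt (fun x : P × C(Icc (0 : ℝ) T, E) =>
      B (a i + ℓ i x.1) (G i x.2)) _ (z, ψ) := fun i =>
    B.hasFDerivAt_of_bilinear
      (((ℓ i).hasFDerivAt.comp (z, ψ) hasFDerivAt_fst).const_add (a i))
      ((((hG i).differentiable one_ne_zero ψ).hasFDerivAt).comp (z, ψ) hasFDerivAt_snd)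
  have h2 := (S.hasFDerivAt.comp (z, ψ) hasFDerivAt_fst).add
    (HasFDerivAt.fun_sum (u := Finset.univ) fun i _ => h1 i)
  have h3 : fderiv ℝ (duhamelMap B S a ℓ G) (z, ψ) = _ := h2.fderiv
  rw [h3, _root_.add_apply, _root_.sum_apply]
  rfl

/-- The term `S z` cancels. Cauchy–Schwarz over the finite index set costs the factor `Fintype.card
ι`, and the pointwise Lipschitz constants enter squared. -/
theorem duhamelMap_increment_le {c : ℝ} (hc : 0 ≤ c)
    (hB : ∀ m G (t : Icc (0 : ℝ) T), ‖B m G t‖ ^ 2 ≤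
      c * ∫ s in (0 : ℝ)..t, m s ^ 2 * ‖IccExtend hT G s‖ ^ 2)
    {R : ℝ} {C : ι → ℝ} (hC : ∀ i f g, ‖f‖ ≤ R → ‖g‖ ≤ R →
      ∀ t, ‖G i f t - G i g t‖ ≤ C i * ‖f t - g t‖) (z : P) {ψ φ : C(Icc (0 : ℝ) T, E)}
    (hψ : ‖ψ‖ ≤ R) (hφ : ‖φ‖ ≤ R) (t : Icc (0 : ℝ) T) :
    ‖duhamelMap B S a ℓ G (z, ψ) t - duhamelMap B S a ℓ G (z, φ) t‖ ^ 2 ≤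
      ∫ s in (0 : ℝ)..t, (c * Fintype.card ι *
        ∑ i, C i ^ 2 * (a i + ℓ i z) s ^ 2) * ‖IccExtend hT (ψ - φ) s‖ ^ 2 := by
  have h1 : duhamelMap B S a ℓ G (z, ψ) t - duhamelMap B S a ℓ G (z, φ) t =
      ∑ i, B (a i + ℓ i z) (G i ψ - G i φ) t := by
    simp only [duhamelMap, ContinuousMap.add_apply, ContinuousMap.sum_apply, map_sub,
      ContinuousMap.sub_apply, Finset.sum_sub_distrib]
    abel
  have hi : ∀ i, IntervalIntegrable (fun s => C i ^ 2 * (a i + ℓ i z) s ^ 2 *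
      ‖IccExtend hT (ψ - φ) s‖ ^ 2) volume 0 t := fun i =>
    intervalIntegrable_mul_sq_norm hT ((intervalIntegrable_sq hT _).const_mul _) _ t
  have h2 : ∀ i, ‖B (a i + ℓ i z) (G i ψ - G i φ) t‖ ^ 2 ≤
      c * ∫ s in (0 : ℝ)..t, C i ^ 2 * (a i + ℓ i z) s ^ 2 *
        ‖IccExtend hT (ψ - φ) s‖ ^ 2 := by
    intro i
    refine (hB _ _ t).trans
      (mul_le_mul_of_nonneg_left ?_ (hc))
    refine intervalIntegral.integral_mono_on t.2.1
      (intervalIntegrable_mul_sq_norm hT (intervalIntegrable_sq hT _) _ t) (hi i) fun s _ => ?_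
    have h3 : ‖IccExtend hT (G i ψ - G i φ) s‖ ≤ C i * ‖IccExtend hT (ψ - φ) s‖ :=
      hC i ψ φ hψ hφ _
    calc _ ≤ (a i + ℓ i z) s ^ 2 * (C i * ‖IccExtend hT (ψ - φ) s‖) ^ 2 := by gcongr
      _ = _ := by ring
  rw [h1]
  refine (pow_le_pow_left₀ (norm_nonneg _) (norm_sum_le _ _) 2).trans
    (sq_sum_le_card_mul_sum_sq.trans ?_)
  rw [Finset.card_univ]
  refine (mul_le_mul_of_nonneg_left (Finset.sum_le_sum fun i _ => h2 i)
    (Nat.cast_nonneg _)).trans_eq ?_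
  rw [← Finset.mul_sum, ← intervalIntegral.integral_finsetSum fun i _ => hi i, ← mul_assoc,
    mul_comm (Fintype.card ι : ℝ), ← intervalIntegral.integral_const_mul]
  simp only [Finset.sum_mul, mul_assoc]

theorem isVolterraMap_duhamelMap {c : ℝ} (hc : 0 ≤ c)
    (hB : ∀ m G (t : Icc (0 : ℝ) T), ‖B m G t‖ ^ 2 ≤
      c * ∫ s in (0 : ℝ)..t, m s ^ 2 * ‖IccExtend hT G s‖ ^ 2)
    (hG : ∀ i, ContDiff ℝ 1 (G i))
    (hL : ∀ i, PointwiseLipschitz (G i)) : IsVolterraMap hT (duhamelMap B S a ℓ G) where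
  contDiff := contDiff_duhamelMap hG
  volterra R := by
    choose C hC0 hC using fun i => hL i R
    -- The integral of the squared amplitude is ‖aᵢ + ℓᵢ z‖², which is bounded in terms of R alone.
    refine ⟨c * Fintype.card ι * ∑ i, C i ^ 2 * (‖a i‖ + ‖ℓ i‖ * R) ^ 2,
      fun z hz => ⟨fun s => c * Fintype.card ι *
        ∑ i, C i ^ 2 * (a i + ℓ i z) s ^ 2, ?_, fun s => ?_, ?_, fun ψ φ hψ hφ t =>
          duhamelMap_increment_le hT hc hB hC z hψ hφ t⟩⟩
    · refine IntervalIntegrable.const_mul ?_ _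
      have h := IntervalIntegrable.sum Finset.univ (f := fun i s => C i ^ 2 * (a i + ℓ i z) s ^ 2)
        fun i _ => (intervalIntegrable_sq hT _).const_mul _
      rwa [show (∑ i, fun s => C i ^ 2 * (a i + ℓ i z) s ^ 2) = fun s =>
        ∑ i, C i ^ 2 * (a i + ℓ i z) s ^ 2 from funext fun s => Finset.sum_apply _ _ _] at h
    · positivity
    · rw [intervalIntegral.integral_const_mul, intervalIntegral.integral_finsetSum fun i _ =>
        (intervalIntegrable_sq hT _).const_mul _]
      gcongr with i
      rw [intervalIntegral.integral_const_mul, integral_sq hT]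
      gcongr
      refine (norm_add_le _ _).trans (add_le_add le_rfl ?_)
      exact ((ℓ i).le_opNorm z).trans (mul_le_mul_of_nonneg_left hz (norm_nonneg _))
  lipschitz R := by
    choose D hD0 hD using fun i => (hL i).exists_bound R
    obtain ⟨b, hb0, hb⟩ := B.exists_bilin_bound
    refine ⟨‖S‖ + ∑ i, b * ‖ℓ i‖ * D i, fun z z' ψ _ _ hψ => ?_⟩
    have h1 : duhamelMap B S a ℓ G (z, ψ) - duhamelMap B S a ℓ G (z', ψ) =
        S (z - z') + ∑ i, B (ℓ i (z - z')) (G i ψ) := by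
      simp only [duhamelMap, map_sub, map_add, _root_.add_apply, _root_.sub_apply,
        Finset.sum_add_distrib, Finset.sum_sub_distrib]
      abel
    rw [h1, add_mul, Finset.sum_mul]
    refine (norm_add_le _ _).trans (add_le_add (S.le_opNorm _)
      ((norm_sum_le _ _).trans (Finset.sum_le_sum fun i _ => ?_)))
    refine (hb _ _).trans ?_
    calc _ ≤ b * (‖ℓ i‖ * ‖z - z'‖) * D i := by
          gcongr
          · exact (ℓ i).le_opNorm _
          · exact hD i ψ hψ
      _ = _ := by ring

end DuhamelMap

end

noncomputable section

/-! ### Mild solutions as solutions of the integral equation -/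

section MildSolutions

variable {V : ℝ → ℝ} {U : ℝ → L2I →L[ℂ] L2I} {W : CI} {T : ℝ} {ι : Type*} [Fintype ι]

theorem memLp_sum_smul_curve (hT : 0 ≤ T) (m : ι → Lp ℝ 2 (volT T))
    (g : ι → C(Icc (0 : ℝ) T, Y)) :
    MemLp (fun s => ∑ i, m i s • IccExtend hT (g i) s) 2 (volT T) :=
  memLp_finsetSum _ fun i _ => memLp_smul_curve hT (m i) (g i)

theorem tau_sum_smul {y : ι → Y} (h0 : ∀ i, Y.c0 (y i) 0 = 0) (h1 : ∀ i, Y.c0 (y i) 1 = 0)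
    (c : ι → ℝ) (j : ℕ) : tau j (∑ i, c i • y i) =
      (dirichletWeight (j + 1) : ℂ) * sineCoeff (j + 1) (Y.toL2 (∑ i, c i • y i)) := by
  have h : ∀ x, (∀ i, Y.c0 (y i) x = 0) → Y.c0 (∑ i, c i • y i) x = 0 := by
    intro x hx
    rw [map_sum, ContinuousMap.sum_apply]
    refine Finset.sum_eq_zero fun i _ => ?_
    rw [Y.c0.map_smul_of_tower, ContinuousMap.smul_apply, hx, smul_zero]
  exact tau_eq j (h 0 h0) (h 1 h1)

theorem coeffs_sum_modulatedDuhamel (hT : 0 ≤ T) (m : ι → Lp ℝ 2 (volT T))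
    (g : ι → C(Icc (0 : ℝ) T, Y)) (t : Icc (0 : ℝ) T) (j : ℕ) :
    H30.coeffs ((∑ i, modulatedDuhamel hT (m i) (g i)) t) j = phase j (-t) * (-Complex.I *
      ∫ s in (0 : ℝ)..t, phase j s * tau j (∑ i, m i s • IccExtend hT (g i) s)) := by
  have h1 : ∀ A : Finset ι, H30.coeffs (∑ i ∈ A, modulatedDuhamel hT (m i) (g i) t) j =
      ∑ i ∈ A, H30.coeffs (modulatedDuhamel hT (m i) (g i) t) j := by
    intro A
    rw [map_sum, lp.coeFn_sum, Finset.sum_apply]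
  rw [ContinuousMap.sum_apply, h1]
  simp only [coeffs_modulatedDuhamel, map_sum, Finset.mul_sum]
  rw [intervalIntegral.integral_finsetSum fun i _ =>
    intervalIntegrable_phase_tau (memLp_smul_curve hT (m i) (g i)) le_rfl t.2.1 t.2.2 j,
    Finset.mul_sum, Finset.mul_sum]

/-- The hypothesis `hF` puts the potential into the source, so that `isDuhamelSolution_iff` leaves
the free phases only. As the sources vanish at the endpoints, multiplying by the weight turns their
sine coefficients into `tau`, which `modulatedDuhamel` integrates. -/
theorem isDuhamelSolution_iff_eq (hU : IsSchrodingerGroup V U) (hW : IsRestriction V W)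
    (hT : 0 ≤ T) (m : ι → Lp ℝ 2 (volT T)) (g : ι → C(Icc (0 : ℝ) T, Y))
    (h0 : ∀ i t, Y.c0 (g i t) 0 = 0) (h1 : ∀ i t, Y.c0 (g i t) 1 = 0) (ξ₀ : H30) (F : ℝ → L2I)
    (ξ : C(Icc (0 : ℝ) T, H30))
    (hF : ∀ᵐ s, ∀ hs : s ∈ Icc (0 : ℝ) T, F s + mulL2 W (ξ ⟨s, hs⟩).toL2 =
      Y.toL2 (∑ i, m i s • g i ⟨s, hs⟩)) :
    IsDuhamelSolution V ξ₀ F ξ ↔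
      ξ = H30.freeEvolution T ξ₀ + ∑ i, modulatedDuhamel hT (m i) (g i) := by
  have hF' : ∀ᵐ s ∂(volT T), F s + mulL2 W (IccExtend hT ξ s).toL2 =
      Y.toL2 (∑ i, m i s • IccExtend hT (g i) s) := by
    rw [ae_restrict_iff' measurableSet_Icc]
    filter_upwards [hF] with s hs hsT
    simp only [IccExtend_of_mem hT _ hsT]
    exact hs hsT
  have hH := memLp_sum_smul_curve hT m g
  have hc : Continuous fun s => mulL2 W (IccExtend hT ξ s).toL2 :=
    (mulL2 W).continuous.comp (H30.continuous_toL2.comp ξ.continuous.Icc_extend')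
  have hint : IntervalIntegrable F volume 0 T := by
    have h2 : IntervalIntegrable (fun s => Y.toL2 (∑ i, m i s • IccExtend hT (g i) s) -
        mulL2 W (IccExtend hT ξ s).toL2) volume 0 T :=
      ((Y.toL2.comp_memLp' (memLp_Ioc hH le_rfl le_rfl)).intervalIntegrable hT).sub
        (hc.intervalIntegrable _ _)
    refine h2.congr_ae ?_
    rw [uIoc_of_le hT]
    filter_upwards [ae_restrict_of_ae_restrict_of_subset Ioc_subset_Icc_self hF'] with s hs
    rw [← hs, add_sub_cancel_right]
  have key : ∀ (t : Icc (0 : ℝ) T) j, (dirichletWeight (j + 1) : ℂ) *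
      ∫ s in (0 : ℝ)..t, phase j s *
        sineCoeff (j + 1) (F s + mulL2 W (IccExtend hT ξ s).toL2) =
      ∫ s in (0 : ℝ)..t, phase j s * tau j (∑ i, m i s • IccExtend hT (g i) s) := by
    intro t j
    rw [← intervalIntegral.integral_const_mul, intervalIntegral.integral_of_le t.2.1,
      intervalIntegral.integral_of_le t.2.1]
    refine integral_congr_ae ?_
    filter_upwards [ae_restrict_of_ae_restrict_of_subset
      (Ioc_subset_Icc_self.trans (Icc_subset_Icc_right t.2.2)) hF'] with s hs
    rw [hs, tau_sum_smul (y := fun i => IccExtend hT (g i) s) (fun i => h0 i _)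
      (fun i => h1 i _)]
    ring
  rw [isDuhamelSolution_iff hU hW hT, and_iff_right hint, ContinuousMap.ext_iff]
  refine forall_congr' fun t => ?_
  have h2 : ξ t = (H30.freeEvolution T ξ₀ + ∑ i, modulatedDuhamel hT (m i) (g i)) t ↔
      ∀ j, H30.coeffs (ξ t) j =
        H30.coeffs ((H30.freeEvolution T ξ₀ + ∑ i, modulatedDuhamel hT (m i) (g i)) t) j :=
    ⟨fun h j => by rw [h], H30.ext_coeffs⟩
  rw [h2]
  refine forall_congr' fun j => ?_
  rw [ContinuousMap.add_apply, H30.coeffs_add_apply, H30.freeEvolution_apply, H30.coeffs_freeFlow,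
    coeffs_sum_modulatedDuhamel, ← key, H30.coeffs_apply, H30.coeffs_apply]
  have h3 : phase j (-t) * phase j t = 1 := by rw [← phase_add, neg_add_cancel, phase_zero]
  have h4 := dirichletWeight_ne_zero j
  constructor
  · intro h
    have h5 := congrArg (fun z => phase j (-t) * ((dirichletWeight (j + 1) : ℂ) * z)) h
    linear_combination h5 - (dirichletWeight (j + 1) : ℂ) * sineCoeff (j + 1) (ξ t).toL2 * h3
  · intro h
    refine mul_left_cancel₀ h4 ?_
    have h5 := congrArg (fun z => phase j t * z) h
    linear_combination h5 + ((dirichletWeight (j + 1) : ℂ) * sineCoeff (j + 1) ξ₀.toL2 -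
      Complex.I * ((dirichletWeight (j + 1) : ℂ) * ∫ s in (0 : ℝ)..t, phase j s *
        sineCoeff (j + 1) (F s + mulL2 W (IccExtend hT ξ s).toL2))) * h3

/-- The predicate `S` abstracts the pointwise formula for the source, so that the nonlinear and the
linearised equation share one argument. In the converse direction F is the total source with the
potential term subtracted again. -/
theorem exists_isDuhamelSolution_iff (hU : IsSchrodingerGroup V U) (hW : IsRestriction V W)
    (hT : 0 ≤ T) (m : ι → Lp ℝ 2 (volT T)) (g : ι → C(Icc (0 : ℝ) T, Y))
    (h0 : ∀ i t, Y.c0 (g i t) 0 = 0) (h1 : ∀ i t, Y.c0 (g i t) 1 = 0) (ξ₀ : H30)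
    (ξ : C(Icc (0 : ℝ) T, H30)) (S : ∀ s, s ∈ Icc (0 : ℝ) T → L2I → Prop)
    (hS : ∀ᵐ s, ∀ (hs : s ∈ Icc (0 : ℝ) T) f, S s hs f ↔ f + mulL2 W (ξ ⟨s, hs⟩).toL2 =
      Y.toL2 (∑ i, m i s • g i ⟨s, hs⟩)) :
    (∃ F : ℝ → L2I, (∀ᵐ s, ∀ hs : s ∈ Icc (0 : ℝ) T, S s hs (F s)) ∧ IsDuhamelSolution V ξ₀ F ξ) ↔
      ξ = H30.freeEvolution T ξ₀ + ∑ i, modulatedDuhamel hT (m i) (g i) := by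
  have h2 : ∀ F : ℝ → L2I, (∀ᵐ s, ∀ hs : s ∈ Icc (0 : ℝ) T, S s hs (F s)) →
      ∀ᵐ s, ∀ hs : s ∈ Icc (0 : ℝ) T, F s + mulL2 W (ξ ⟨s, hs⟩).toL2 =
      Y.toL2 (∑ i, m i s • g i ⟨s, hs⟩) := by
    intro F hF
    filter_upwards [hF, hS] with s hs1 hs2 hs
    exact (hs2 hs _).1 (hs1 hs)
  constructor
  · rintro ⟨F, hF, h⟩
    exact (isDuhamelSolution_iff_eq hU hW hT m g h0 h1 ξ₀ F ξ (h2 F hF)).1 h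
  · intro h
    set F : ℝ → L2I := fun s => Y.toL2 (∑ i, m i s • IccExtend hT (g i) s) -
      mulL2 W (IccExtend hT ξ s).toL2 with hF
    have h3 : ∀ᵐ s, ∀ hs : s ∈ Icc (0 : ℝ) T, S s hs (F s) := by
      filter_upwards [hS] with s hs2 hs
      rw [hs2 hs, hF]
      simp only [IccExtend_of_mem hT _ hs, sub_add_cancel]
    exact ⟨F, h3, (isDuhamelSolution_iff_eq hU hW hT m g h0 h1 ξ₀ F ξ (h2 F h3)).2 h⟩

end MildSolutions

/-! ### Pointwise form of the sources -/

theorem H30.coeFn_toL2 (f : H30) :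
    ∀ᵐ x ∂volI, ∀ hx : x ∈ Icc (0 : ℝ) 1, f.toL2 x = Y.c0 (H30.toY f) ⟨x, hx⟩ := by
  rw [← H30.toL2_toY]
  filter_upwards [CI.coeFn_toLp 2 (Y.c0 (H30.toY f))] with x h1 hx
  rw [← CI.ext_apply]
  exact h1

theorem Y.ae_eq_iff_eq_toL2 (z : Y) (φ : ℝ → ℂ)
    (h : ∀ᵐ x ∂volI, ∀ hx : x ∈ Icc (0 : ℝ) 1, φ x = Y.c0 z ⟨x, hx⟩) (f : L2I) :
    f =ᵐ[volI] φ ↔ f = Y.toL2 z := by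
  have h1 : φ =ᵐ[volI] Y.toL2 z := by
    filter_upwards [h, CI.coeFn_toLp 2 (Y.c0 z), ae_restrict_mem measurableSet_Ioo] with x h2 h3 hx
    rw [h2 (Ioo_subset_Icc_self hx), ← CI.ext_apply]
    exact h3.symm
  exact ⟨fun h2 => Lp.ext (h2.trans h1), fun h2 => by rw [h2]; exact h1.symm⟩

/-- Lets the potential term be absorbed into a source with values in H³. -/
theorem Y.mulL2_c0_toL2 (y : Y) (f : H30) :
    mulL2 (Y.c0 y) f.toL2 = Y.toL2 (Y.mul y (H30.toY f)) := by
  have h : Y.toL2 (Y.mul y (H30.toY f)) = CI.toLp 2 (Y.c0 (Y.mul y (H30.toY f))) := rfl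
  have h' : f.toL2 = CI.toLp 2 (Y.c0 (H30.toY f)) := (H30.toL2_toY f).symm
  rw [h, h', mulL2_toLp, Y.c0_mul]

theorem Y.c0_real_smul (c : ℝ) (y : Y) (x : Icc (0 : ℝ) 1) : Y.c0 (c • y) x = c * Y.c0 y x := by
  rw [Y.c0.map_smul_of_tower, ContinuousMap.smul_apply, Complex.real_smul]

/-! ### Polynomial curve maps -/

section PolynomialCurveMap

variable {K : Type*} [TopologicalSpace K] [CompactSpace K]
  {E : Type*} [NormedAddCommGroup E] [NormedSpace ℝ E]
  {Z : Type*} [NormedAddCommGroup Z] [NormedSpace ℝ Z]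
  (κ : ℝ) (B : Z →L[ℝ] Z →L[ℝ] Z) (J : Z →L[ℝ] Z) (p : ℕ) (A : E →L[ℝ] Z) (L : Z →L[ℝ] Z)

/-- `f ↦ κ (Af J(Af))ᵖ Af + L A f`. -/
def polynomialCurveMap (f : C(K, E)) : C(K, Z) :=
  κ • curvePower B J p (curveMap A f) + curveMap L (curveMap A f)

theorem contDiff_polynomialCurveMap :
    ContDiff ℝ 1 (polynomialCurveMap κ B J p A L : C(K, E) → C(K, Z)) := by
  have h0 : ContDiff ℝ 1 fun f : C(K, E) => curveMap A f :=
    (curveMap (K := K) A).contDiff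
  have h1 : ContDiff ℝ 1 fun f : C(K, E) => curvePower B J p (curveMap A f) :=
    (contDiff_curvePower B J p).comp h0
  have h2 : ContDiff ℝ 1 fun f : C(K, E) => curveMap L (curveMap A f) :=
    (curveMap (K := K) L).contDiff.comp h0
  exact (h1.const_smul κ).add h2

theorem pointwiseLipschitz_polynomialCurveMap :
    PointwiseLipschitz (polynomialCurveMap κ B J p A L : C(K, E) → C(K, Z)) :=
  PointwiseLipschitz.add
    ((PointwiseLipschitz.clm (κ • ContinuousLinearMap.id ℝ Z)).comp
      ((pointwiseLipschitz_curvePower B J p).comp (PointwiseLipschitz.clm A)))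
    ((PointwiseLipschitz.clm L).comp (PointwiseLipschitz.clm A))

theorem fderiv_polynomialCurveMap (f ξ : C(K, E)) :
    fderiv ℝ (polynomialCurveMap κ B J p A L) f ξ =
      κ • fderiv ℝ (curvePower B J p) (curveMap A f) (curveMap A ξ) +
        curveMap L (curveMap A ξ) := by
  have h1 := ((contDiff_curvePower B J p).differentiable one_ne_zero
    (curveMap (K := K) A f)).hasFDerivAt
  have h2 : HasFDerivAt (polynomialCurveMap κ B J p A L : C(K, E) → C(K, Z)) _ f :=
    ((h1.comp f (curveMap (K := K) A).hasFDerivAt).const_smul κ).add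
      ((curveMap (K := K) L).hasFDerivAt.comp f (curveMap (K := K) A).hasFDerivAt)
  rw [h2.fderiv]
  rfl

end PolynomialCurveMap

end

noncomputable section

/-! ### The nonlinear Schrödinger equation as an integral equation -/

section NLS

/-- The embedding of `H³_{(0)}` as a real linear map. -/
def H30.toYReal : H30 →L[ℝ] Y := H30.toY.restrictScalars ℝ

variable {q : ℕ} {T : ℝ}

/-- The amplitudes of the source terms that do not depend on the control. -/
def amplitude (T : ℝ) : Option (Fin q) → Lp ℝ 2 (volT T)
  | none => (memLp_const (1 : ℝ)).toLp
  | some _ => 0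

/-- The components of the control. -/
def controlPart (T : ℝ) : Option (Fin q) → H30 × L2Control T q →L[ℝ] Lp ℝ 2 (volT T)
  | none => 0
  | some j => ((EuclideanSpace.proj j : EuclideanSpace ℝ (Fin q) →L[ℝ] ℝ).compLpL 2 (volT T)).comp
      (ContinuousLinearMap.snd ℝ _ _)

/-- The source terms. -/
def sourceMap (κ : ℝ) (p : ℕ) (VY : Y) (QY : Fin q → Y) :
    Option (Fin q) → C(Icc (0 : ℝ) T, H30) → C(Icc (0 : ℝ) T, Y)
  | none => polynomialCurveMap κ Y.mulReal Y.conj p H30.toYReal (Y.mulReal VY)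
  | some j => fun ψ => curveMap (Y.mulReal (QY j)) (curveMap H30.toYReal ψ)

theorem controlPart_ae (z : H30 × L2Control T q) :
    ∀ᵐ s ∂(volT T), controlPart T none z s = 0 ∧
      ∀ j, controlPart T (some j) z s = z.2 s j := by
  have h1 : ∀ j, ∀ᵐ s ∂(volT T), controlPart T (some j) z s = z.2 s j := fun j =>
    ContinuousLinearMap.coeFn_compLpL
      (EuclideanSpace.proj j : EuclideanSpace ℝ (Fin q) →L[ℝ] ℝ) z.2
  filter_upwards [ae_all_iff.2 h1, Lp.coeFn_zero ℝ 2 (volT T)] with s hs h0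
  exact ⟨h0, hs⟩

theorem amplitude_add_controlPart_ae (z : H30 × L2Control T q) :
    ∀ᵐ s ∂(volT T), (amplitude (q := q) T none + controlPart T none z) s = 1 ∧
      ∀ j, (amplitude T (some j) + controlPart T (some j) z) s = z.2 s j := by
  have h0 : amplitude (q := q) T none + controlPart T none z =
      (memLp_const (1 : ℝ)).toLp := add_zero _
  have h1 : ∀ j, amplitude T (some j) + controlPart T (some j) z = controlPart T (some j) z :=
    fun j => zero_add _
  rw [h0]
  simp only [h1]
  filter_upwards [controlPart_ae z, (memLp_const (μ := volT T) (p := 2) (1 : ℝ)).coeFn_toLp]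
    with s hs h2
  exact ⟨h2, hs.2⟩

variable (κ : ℝ) (p : ℕ) (VY : Y) (QY : Fin q → Y)

theorem contDiff_sourceMap (i : Option (Fin q)) :
    ContDiff ℝ 1 (sourceMap (T := T) κ p VY QY i) := by
  rcases i with _ | j
  · exact contDiff_polynomialCurveMap κ Y.mulReal Y.conj p H30.toYReal (Y.mulReal VY)
  · exact ((curveMap (K := Icc (0 : ℝ) T) (Y.mulReal (QY j))).comp
      (curveMap H30.toYReal)).contDiff

theorem pointwiseLipschitz_sourceMap (i : Option (Fin q)) :
    PointwiseLipschitz (sourceMap (T := T) κ p VY QY i) := by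
  rcases i with _ | j
  · exact pointwiseLipschitz_polynomialCurveMap κ Y.mulReal Y.conj p H30.toYReal (Y.mulReal VY)
  · exact (PointwiseLipschitz.clm (Y.mulReal (QY j))).comp (PointwiseLipschitz.clm H30.toYReal)

theorem sourceMap_none_apply (ψ : C(Icc (0 : ℝ) T, H30)) (t : Icc (0 : ℝ) T) :
    sourceMap κ p VY QY none ψ t =
      κ • curvePower Y.mulReal Y.conj p (curveMap H30.toYReal ψ) t +
        Y.mul VY (H30.toY (ψ t)) := rfl

theorem sourceMap_some_apply (j : Fin q) (ψ : C(Icc (0 : ℝ) T, H30)) (t : Icc (0 : ℝ) T) :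
    sourceMap κ p VY QY (some j) ψ t = Y.mul (QY j) (H30.toY (ψ t)) := rfl

theorem fderiv_sourceMap_none_apply (ψ ξ : C(Icc (0 : ℝ) T, H30)) (t : Icc (0 : ℝ) T) :
    fderiv ℝ (sourceMap κ p VY QY none) ψ ξ t =
      κ • fderiv ℝ (curvePower Y.mulReal Y.conj p) (curveMap H30.toYReal ψ)
        (curveMap H30.toYReal ξ) t + Y.mul VY (H30.toY (ξ t)) := by
  have h := fderiv_polynomialCurveMap κ Y.mulReal Y.conj p H30.toYReal (Y.mulReal VY) ψ ξ
  exact DFunLike.congr_fun h t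

theorem fderiv_sourceMap_some_apply (j : Fin q) (ψ ξ : C(Icc (0 : ℝ) T, H30))
    (t : Icc (0 : ℝ) T) :
    fderiv ℝ (sourceMap κ p VY QY (some j)) ψ ξ t = Y.mul (QY j) (H30.toY (ξ t)) := by
  have h : HasFDerivAt (sourceMap κ p VY QY (some j)) _ ψ :=
    ((curveMap (K := Icc (0 : ℝ) T) (Y.mulReal (QY j))).comp
      (curveMap H30.toYReal)).hasFDerivAt
  rw [h.fderiv]
  rfl

/-- Every source term contains ψ as a factor, so it vanishes at the endpoints whatever V and Q do
there. This is the only boundary condition that `tau_eq` asks for. -/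
theorem c0_sourceMap_eq_zero (i : Option (Fin q)) (ψ : C(Icc (0 : ℝ) T, H30)) (t : Icc (0 : ℝ) T)
    {x : Icc (0 : ℝ) 1} (hx : ∀ f : H30, Y.c0 (H30.toY f) x = 0) :
    Y.c0 (sourceMap κ p VY QY i ψ t) x = 0 := by
  have h1 : Y.c0 (curveMap H30.toYReal ψ t) x = 0 := hx (ψ t)
  rcases i with _ | j
  · rw [sourceMap_none_apply, map_add, ContinuousMap.add_apply, Y.c0_real_smul, Y.c0_curvePower,
      Y.c0_mul, ContinuousMap.mul_apply, hx, h1]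
    simp
  · rw [sourceMap_some_apply, Y.c0_mul, ContinuousMap.mul_apply, hx, mul_zero]

theorem c0_fderiv_sourceMap_eq_zero (i : Option (Fin q)) (ψ ξ : C(Icc (0 : ℝ) T, H30))
    (t : Icc (0 : ℝ) T) {x : Icc (0 : ℝ) 1} (hx : ∀ f : H30, Y.c0 (H30.toY f) x = 0) :
    Y.c0 (fderiv ℝ (sourceMap κ p VY QY i) ψ ξ t) x = 0 := by
  have h1 : Y.c0 (curveMap H30.toYReal ξ t) x = 0 := hx (ξ t)
  rcases i with _ | j
  · rw [fderiv_sourceMap_none_apply, map_add, ContinuousMap.add_apply, Y.c0_real_smul,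
      Y.c0_fderiv_curvePower, Y.c0_mul, ContinuousMap.mul_apply, hx, h1]
    simp
  · rw [fderiv_sourceMap_some_apply, Y.c0_mul, ContinuousMap.mul_apply, hx, mul_zero]

/-- The right hand side of the integral equation. -/
def nlsMap (hT : 0 ≤ T) : (H30 × L2Control T q) × C(Icc (0 : ℝ) T, H30) → C(Icc (0 : ℝ) T, H30) :=
  duhamelMap (modulatedDuhamel hT)
    ((H30.freeEvolution T).comp (ContinuousLinearMap.fst ℝ H30 (L2Control T q)))
    (amplitude T) (controlPart T) (sourceMap κ p VY QY)

theorem isVolterraMap_nlsMap (hT : 0 ≤ T) : IsVolterraMap hT (nlsMap κ p VY QY hT) :=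
  isVolterraMap_duhamelMap hT (smoothingConst_nonneg hT) (norm_modulatedDuhamel_sq_le hT)
    (contDiff_sourceMap κ p VY QY) (pointwiseLipschitz_sourceMap κ p VY QY)

variable {κ p VY QY} {V : ℝ → ℝ} {Q : ℝ → EuclideanSpace ℝ (Fin q)} {U : ℝ → L2I →L[ℂ] L2I}

theorem c0_sum_control (hQ : ∀ j (x : Icc (0 : ℝ) 1), Y.c0 (QY j) x = (Q x j : ℂ))
    (v : EuclideanSpace ℝ (Fin q)) (y : Y) (x : Icc (0 : ℝ) 1) :
    Y.c0 (∑ j, v j • Y.mul (QY j) y) x = (inner ℝ v (Q x) : ℂ) * Y.c0 y x := by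
  rw [map_sum, ContinuousMap.sum_apply, PiLp.inner_apply, Complex.ofReal_sum, Finset.sum_mul]
  refine Finset.sum_congr rfl fun j _ => ?_
  rw [Y.c0_real_smul, Y.c0_mul, ContinuousMap.mul_apply, hQ]
  simp
  ring

/-- The index `none` carries the nonlinearity and the potential with amplitude 1; the index `some j`
carries Q_j ψ with amplitude u_j. -/
theorem isNLSSolution_iff (hU : IsSchrodingerGroup V U) (hT : 0 ≤ T)
    (hV : IsRestriction V (Y.c0 VY))
    (hQ : ∀ j (x : Icc (0 : ℝ) 1), Y.c0 (QY j) x = (Q x j : ℂ))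
    (ψ₀ : H30) (u : L2Control T q) (ψ : C(Icc (0 : ℝ) T, H30)) :
    IsNLSSolution V Q κ p ψ₀ u ψ ↔ nlsMap κ p VY QY hT ((ψ₀, u), ψ) = ψ := by
  rw [eq_comm]
  refine exists_isDuhamelSolution_iff hU hV hT
    (fun i => amplitude T i + controlPart T i (ψ₀, u)) (fun i => sourceMap κ p VY QY i ψ)
    (fun i t => c0_sourceMap_eq_zero κ p VY QY i ψ t H30.c0_toY_zero)
    (fun i t => c0_sourceMap_eq_zero κ p VY QY i ψ t H30.c0_toY_one) ψ₀ ψ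
    (fun s hs f => f =ᵐ[volI] fun x =>
      (κ : ℂ) * (‖(ψ ⟨s, hs⟩).toL2 x‖ : ℂ) ^ (2 * p) * (ψ ⟨s, hs⟩).toL2 x
        + (inner ℝ (u s) (Q x) : ℂ) * (ψ ⟨s, hs⟩).toL2 x) ?_
  have h1 := amplitude_add_controlPart_ae (ψ₀, u)
  rw [ae_restrict_iff' measurableSet_Icc] at h1
  filter_upwards [h1] with s h2 hs f
  obtain ⟨h3, h4⟩ := h2 hs
  have h5 : ∑ i, (amplitude T i + controlPart T i (ψ₀, u)) s • sourceMap κ p VY QY i ψ ⟨s, hs⟩ =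
      (κ • curvePower Y.mulReal Y.conj p (curveMap H30.toYReal ψ) ⟨s, hs⟩ +
        ∑ j, u s j • Y.mul (QY j) (H30.toY (ψ ⟨s, hs⟩))) + Y.mul VY (H30.toY (ψ ⟨s, hs⟩)) := by
    rw [Fintype.sum_option, h3, one_smul, sourceMap_none_apply]
    simp only [h4, sourceMap_some_apply]
    abel
  rw [h5, map_add, Y.mulL2_c0_toL2, add_left_inj]
  refine Y.ae_eq_iff_eq_toL2 _ _ ?_ f
  filter_upwards [H30.coeFn_toL2 (ψ ⟨s, hs⟩)] with x hx hxI
  have h6 : Y.c0 (curveMap H30.toYReal ψ ⟨s, hs⟩) ⟨x, hxI⟩ =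
    Y.c0 (H30.toY (ψ ⟨s, hs⟩)) ⟨x, hxI⟩ := rfl
  rw [hx hxI, map_add, ContinuousMap.add_apply, Y.c0_real_smul, Y.c0_curvePower,
    c0_sum_control hQ, h6]
  ring

/-- By the product rule the derivative has two families of sources: the old amplitudes with
linearised sources, and the amplitudes of v with the sources at ψ. Hence the sum type as index set.
In the second family the index `none` contributes zero. -/
theorem isLinearisedSolution_iff (hU : IsSchrodingerGroup V U) (hT : 0 ≤ T)
    (hV : IsRestriction V (Y.c0 VY))
    (hQ : ∀ j (x : Icc (0 : ℝ) 1), Y.c0 (QY j) x = (Q x j : ℂ))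
    (ψ₀ : H30) (u v : L2Control T q) (ψ ξ : C(Icc (0 : ℝ) T, H30)) :
    IsLinearisedSolution V Q κ p u ψ v ξ ↔
      fderiv ℝ (nlsMap κ p VY QY hT) ((ψ₀, u), ψ) ((0, v), ξ) = ξ := by
  have h0 : fderiv ℝ (nlsMap κ p VY QY hT) ((ψ₀, u), ψ) ((0, v), ξ) =
      H30.freeEvolution T 0 + ∑ i : Option (Fin q) ⊕ Option (Fin q), modulatedDuhamel hT
        (Sum.elim (fun i => amplitude T i + controlPart T i (ψ₀, u))
          (fun i => controlPart T i (0, v)) i)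
        (Sum.elim (fun i => fderiv ℝ (sourceMap κ p VY QY i) ψ ξ)
          (fun i => sourceMap κ p VY QY i ψ) i) := by
    rw [nlsMap, fderiv_duhamelMap (contDiff_sourceMap κ p VY QY), Fintype.sum_sum_type,
      Finset.sum_add_distrib]
    rfl
  rw [h0, eq_comm]
  refine exists_isDuhamelSolution_iff hU hV hT _ _ ?_ ?_ 0 ξ
    (fun s hs f => f =ᵐ[volI] fun x =>
      ((p : ℂ) + 1) * κ * (‖(ψ ⟨s, hs⟩).toL2 x‖ : ℂ) ^ (2 * p) * (ξ ⟨s, hs⟩).toL2 x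
        + (p : ℂ) * κ * (ψ ⟨s, hs⟩).toL2 x ^ 2 * (‖(ψ ⟨s, hs⟩).toL2 x‖ : ℂ) ^ (2 * (p - 1))
          * (starRingEnd ℂ) ((ξ ⟨s, hs⟩).toL2 x)
        + (inner ℝ (u s) (Q x) : ℂ) * (ξ ⟨s, hs⟩).toL2 x
        + (inner ℝ (v s) (Q x) : ℂ) * (ψ ⟨s, hs⟩).toL2 x) ?_
  · rintro (i | i) t
    · exact c0_fderiv_sourceMap_eq_zero κ p VY QY i ψ ξ t H30.c0_toY_zero
    · exact c0_sourceMap_eq_zero κ p VY QY i ψ t H30.c0_toY_zero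
  · rintro (i | i) t
    · exact c0_fderiv_sourceMap_eq_zero κ p VY QY i ψ ξ t H30.c0_toY_one
    · exact c0_sourceMap_eq_zero κ p VY QY i ψ t H30.c0_toY_one
  have h1 := amplitude_add_controlPart_ae (ψ₀, u)
  have h1' := controlPart_ae ((0 : H30), v)
  rw [ae_restrict_iff' measurableSet_Icc] at h1 h1'
  filter_upwards [h1, h1'] with s h2 h2' hs f
  obtain ⟨h3, h4⟩ := h2 hs
  obtain ⟨h3', h4'⟩ := h2' hs
  have h5 : ∑ i : Option (Fin q) ⊕ Option (Fin q),
      (Sum.elim (fun i => amplitude T i + controlPart T i (ψ₀, u))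
        (fun i => controlPart T i (0, v)) i : Lp ℝ 2 (volT T)) s •
      (Sum.elim (fun i => fderiv ℝ (sourceMap κ p VY QY i) ψ ξ)
          (fun i => sourceMap κ p VY QY i ψ) i : C(Icc (0 : ℝ) T, Y)) ⟨s, hs⟩ =
      (κ • fderiv ℝ (curvePower Y.mulReal Y.conj p) (curveMap H30.toYReal ψ)
        (curveMap H30.toYReal ξ) ⟨s, hs⟩ +
        ∑ j, u s j • Y.mul (QY j) (H30.toY (ξ ⟨s, hs⟩)) +
        ∑ j, v s j • Y.mul (QY j) (H30.toY (ψ ⟨s, hs⟩))) + Y.mul VY (H30.toY (ξ ⟨s, hs⟩)) := by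
    rw [Fintype.sum_sum_type]
    simp only [Sum.elim_inl, Sum.elim_inr]
    rw [Fintype.sum_option, Fintype.sum_option, h3, h3', one_smul, zero_smul, zero_add,
      fderiv_sourceMap_none_apply]
    simp only [h4, h4', sourceMap_some_apply, fderiv_sourceMap_some_apply]
    abel
  rw [h5, map_add, Y.mulL2_c0_toL2, add_left_inj]
  refine Y.ae_eq_iff_eq_toL2 _ _ ?_ f
  filter_upwards [H30.coeFn_toL2 (ψ ⟨s, hs⟩), H30.coeFn_toL2 (ξ ⟨s, hs⟩)] with x hx hx' hxI
  have h6 : Y.c0 (curveMap H30.toYReal ψ ⟨s, hs⟩) ⟨x, hxI⟩ =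
    Y.c0 (H30.toY (ψ ⟨s, hs⟩)) ⟨x, hxI⟩ := rfl
  have h7 : Y.c0 (curveMap H30.toYReal ξ ⟨s, hs⟩) ⟨x, hxI⟩ =
    Y.c0 (H30.toY (ξ ⟨s, hs⟩)) ⟨x, hxI⟩ := rfl
  rw [hx hxI, hx' hxI, map_add, map_add, ContinuousMap.add_apply, ContinuousMap.add_apply,
    Y.c0_real_smul, Y.c0_fderiv_curvePower, c0_sum_control hQ, c0_sum_control hQ, h6, h7]
  ring

theorem IsNLSSolution.apply_zero {hT : 0 ≤ T} {ψ₀ : H30} {u : L2Control T q}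
    {ψ : C(Icc (0 : ℝ) T, H30)} (h : IsNLSSolution V Q κ p ψ₀ u ψ) :
    ψ ⟨0, left_mem_Icc.2 hT⟩ = ψ₀ := by
  obtain ⟨F, -, -, U, hU, h1⟩ := h
  have h2 := h1 ⟨0, left_mem_Icc.2 hT⟩
  simp only [intervalIntegral.integral_same, smul_zero, sub_zero, hU.zero,
    ContinuousLinearMap.id_apply] at h2
  exact Subtype.ext h2

end NLS

end

/-! ### The proof of the proposition -/

theorem proposition2p1 {q : ℕ} (V : ℝ → ℝ) (hV : ContDiffOn ℝ ∞ V (Icc 0 1))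
    (Q : ℝ → EuclideanSpace ℝ (Fin q)) (hQ : ContDiffOn ℝ ∞ Q (Icc 0 1))
    (κ : ℝ) (p : ℕ) (hp : 1 ≤ p) (T : ℝ) (hT : 0 < T) (Λ : ℝ) :
    ∃ δ : ℝ, 0 < δ ∧
      ∀ (ψhat₀ : H30) (uhat : L2Control T q) (ψhat : C(Icc (0 : ℝ) T, H30)),
        IsNLSSolution V Q κ p ψhat₀ uhat ψhat → ‖ψhat‖ + ‖uhat‖ = Λ →
        (∀ (ψ₀ : H30) (u : L2Control T q), ‖ψ₀ - ψhat₀‖ + ‖u - uhat‖ < δ →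
          ∃! ψ : C(Icc (0 : ℝ) T, H30), IsNLSSolution V Q κ p ψ₀ u ψ) ∧
        (∀ Ψ : H30 × L2Control T q → H30,
          (∀ (ψ₀ : H30) (u : L2Control T q), ‖ψ₀ - ψhat₀‖ + ‖u - uhat‖ < δ →
            ∀ ψ : C(Icc (0 : ℝ) T, H30), IsNLSSolution V Q κ p ψ₀ u ψ →
              Ψ (ψ₀, u) = ψ ⟨T, right_mem_Icc.2 hT.le⟩) →
          ContDiffOn ℝ 1 Ψ {z | ‖z.1 - ψhat₀‖ + ‖z.2 - uhat‖ < δ} ∧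
          ∃ D : L2Control T q →L[ℝ] H30,
            HasFDerivAt (fun u => Ψ (ψhat₀, u)) D uhat ∧
            ∀ v : L2Control T q,
              (∃! ξ : C(Icc (0 : ℝ) T, H30), IsLinearisedSolution V Q κ p uhat ψhat v ξ) ∧
              ∀ ξ : C(Icc (0 : ℝ) T, H30), IsLinearisedSolution V Q κ p uhat ψhat v ξ →
                D v = ξ ⟨T, right_mem_Icc.2 hT.le⟩) := by
  obtain ⟨VY, hVY⟩ := exists_Y_of_contDiffOn (Complex.ofRealCLM.contDiff.comp_contDiffOn hV)
  choose QY hQY using fun j => exists_Y_of_contDiffOn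
    ((Complex.ofRealCLM.comp (EuclideanSpace.proj j : EuclideanSpace ℝ (Fin q) →L[ℝ] ℝ)).contDiff
      |>.comp_contDiffOn hQ)
  have hF := isVolterraMap_nlsMap κ p VY QY hT.le
  -- δ is chosen before the reference solution, from T, the bound Λ and the fixed data.
  obtain ⟨δ, hδ, hex⟩ := hF.exists_radius Λ
  refine ⟨δ, hδ, fun ψhat₀ uhat ψhat hsol hΛ => ?_⟩
  -- The reference solution itself supplies the group, so Stone's theorem is not needed.
  obtain ⟨U, hU⟩ : ∃ U, IsSchrodingerGroup V U := by
    obtain ⟨F, -, -, U, hU, -⟩ := hsol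
    exact ⟨U, hU⟩
  have hiff : ∀ ψ₀ u ψ, IsNLSSolution V Q κ p ψ₀ u ψ ↔ nlsMap κ p VY QY hT.le ((ψ₀, u), ψ) = ψ :=
    isNLSSolution_iff hU hT.le hVY hQY
  have hfix := (hiff _ _ _).1 hsol
  have hψ : ‖ψhat‖ ≤ Λ := by linarith [norm_nonneg uhat]
  have hz : ‖(ψhat₀, uhat)‖ ≤ Λ := by
    refine max_le ?_ (by linarith [norm_nonneg ψhat])
    -- The initial state is the value of the curve at time 0, hence also bounded by Λ.
    rw [← hsol.apply_zero (hT := hT.le)]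
    exact (ψhat.norm_coe_le_norm _).trans hψ
  have hsolv : ∀ z : H30 × L2Control T q, ‖z.1 - ψhat₀‖ + ‖z.2 - uhat‖ < δ →
      ∃ ψ, nlsMap κ p VY QY hT.le (z, ψ) = ψ := fun z hzδ =>
    -- The product carries the maximum norm, which is at most the sum of norms in (2).
    hex _ _ hz hψ hfix z (lt_of_le_of_lt (max_le (le_add_of_nonneg_right (norm_nonneg _))
      (le_add_of_nonneg_left (norm_nonneg _))) hzδ)
  refine ⟨fun ψ₀ u hd => ?_, fun Ψ hΨ => ?_⟩
  · obtain ⟨ψ, h⟩ := hsolv (ψ₀, u) hd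
    exact ⟨ψ, (hiff _ _ _).2 h, fun φ hφ => hF.eq_of_fixed ((hiff _ _ _).1 hφ) h⟩
  set ev : C(Icc (0 : ℝ) T, H30) →L[ℝ] H30 :=
    ContinuousMap.evalCLM ℝ (⟨T, right_mem_Icc.2 hT.le⟩ : Icc (0 : ℝ) T) with hev
  have hopen : IsOpen {z : H30 × L2Control T q | ‖z.1 - ψhat₀‖ + ‖z.2 - uhat‖ < δ} :=
    isOpen_lt ((continuous_fst.sub continuous_const).norm.add
      (continuous_snd.sub continuous_const).norm) continuous_const
  -- Ψ is prescribed at every solution, so near z it coincides with the evaluation at T of any local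
  -- solution map. Differentiability is inherited from the implicit function.
  have hloc : ∀ z : H30 × L2Control T q, ‖z.1 - ψhat₀‖ + ‖z.2 - uhat‖ < δ →
      ∀ g : H30 × L2Control T q → C(Icc (0 : ℝ) T, H30),
        (∀ᶠ y in 𝓝 z, nlsMap κ p VY QY hT.le (y, g y) = g y) → Ψ =ᶠ[𝓝 z] fun y => ev (g y) := by
    intro z hzδ g hg
    filter_upwards [hg, hopen.mem_nhds hzδ] with y hy hyδ
    exact hΨ y.1 y.2 hyδ (g y) ((hiff _ _ _).2 hy)
  refine ⟨fun z hzδ => ?_, ?_⟩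
  · obtain ⟨ψ, h⟩ := hsolv z hzδ
    obtain ⟨g, hg, -, hge⟩ := hF.exists_solutionMap h
    exact ((ev.contDiff.contDiffAt.comp z hg).congr_of_eventuallyEq
      (hloc z hzδ g hge)).contDiffWithinAt
  obtain ⟨g, hg, hgz, hge⟩ := hF.exists_solutionMap hfix
  have hzδ : ‖(ψhat₀, uhat).1 - ψhat₀‖ + ‖(ψhat₀, uhat).2 - uhat‖ < δ := by simpa using hδ
  have hΨd : HasFDerivAt Ψ (ev.comp (fderiv ℝ g (ψhat₀, uhat))) (ψhat₀, uhat) :=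
    (ev.hasFDerivAt.comp _ (hg.differentiableAt one_ne_zero).hasFDerivAt).congr_of_eventuallyEq
      (hloc _ hzδ g hge)
  refine ⟨(ev.comp (fderiv ℝ g (ψhat₀, uhat))).comp (ContinuousLinearMap.inr ℝ H30 _),
    hΨd.comp uhat (hasFDerivAt_prodMk_right ψhat₀ uhat), fun v => ?_⟩
  have hlin : ∀ ξ, IsLinearisedSolution V Q κ p uhat ψhat v ξ ↔
      fderiv ℝ (nlsMap κ p VY QY hT.le) ((ψhat₀, uhat), ψhat) ((0, v), ξ) = ξ :=
    isLinearisedSolution_iff hU hT.le hVY hQY ψhat₀ uhat v ψhat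
  -- The derivative of the solution map in the direction (0, v) is a solution of the linearised
  -- equation, which settles existence; D is this derivative evaluated at T.
  have hξ := hF.fderiv_solutionMap hg hge (0, v)
  rw [hgz] at hξ
  have huniq : ∀ ξ, IsLinearisedSolution V Q κ p uhat ψhat v ξ →
      ξ = fderiv ℝ g (ψhat₀, uhat) (0, v) := fun ξ h =>
    hF.eq_of_linearised ((hlin ξ).1 h) hξ
  refine ⟨⟨_, (hlin _).2 hξ, huniq⟩, fun ξ h => ?_⟩
  rw [huniq ξ h]
  rfl
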